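/- Let $n\ge 3$ and regard $\mathbb S^n\times\mathbb R=\{x\in\mathbb R^{n+2}: x_1^2+\dots+x_{n+1}^2=1\}$ as a subset of Euclidean space $\mathbb R^{n+2}$. Let $P^2\subset P^3$ be linear subspaces of $\mathbb R^{n+2}$ of dimensions $2$ and $3$, with $\partial/\partial x_{n+2}\in P^2$. A *rotation hypersurface* of $\mathbb S^n\times\mathbb R$ with axis $P^2$ is a smooth immersion $f\colon M^n\to\mathbb S^n\times\mathbb R$ of a connected $n$-dimensional manifold whose image is the orbit, under the group of all isometries of $\mathbb R^{n+2}$ fixing $P^2$ pointwise, of a smooth curve $\alpha\colon I\to(\mathbb S^n\times\mathbb R)\cap P^3$, parametrized by arc length on a (nondegenerate) interval $I$ and lying in one of the two closed half-spaces of $P^3$ bounded by $P^2$; $M^n$ carries the metric induced by $f$. **Theorem.** Let $f\colon M^n\to\mathbb S^n\times\mathbb R$, $n\ge3$, be a rotation hypersurface with axis $P^2$ and constant sectional curvature $c$. Then $c\ge 1$. Moreover: (i) If $c=1$, then $f(M^n)$ is an open subset of a slice $\mathbb S^n\times\{t\}$. (ii) If $c>1$, then, up to an isometry of $\mathbb R^{n+2}$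 that maps $\mathbb S^n\times\mathbb R$ onto itself, $f(M^n)$ is an open subset of the hypersurface $$\Sigma_c=\{(\sin k(s),\ \cos k(s)\,\varphi,\ h(s)) : s\in[0,\pi/\sqrt c\,],\ \varphi\in\mathbb S^{n-1}\subset\mathbb R^n\},$$ where $$k(s)=\arccos\Big(\tfrac1{\sqrt c}\sin(\sqrt c\,s)\Big),\qquad h(s)=-\sqrt{\tfrac{c-1}{c}}\;\ln\left(\frac{\cos(\sqrt c\,s)+\sqrt{c-\sin^2(\sqrt c\,s)}}{1+\sqrt c}\right).$$ That is, there is an isometry $\Phi$ of $\mathbb R^{n+2}$ with $\Phi(\mathbb S^n\times\mathbb R)=\mathbb S^n\times\mathbb R$ such that $\Phi(\Sigma_c)$ is (the image of) a complete rotation hypersurface of $\mathbb S^n\times\mathbb R$ with the same axis $P^2$, and $f(M^n)$ is an open subset of $\Phi(\Sigma_c)$. -/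

import Mathlib

open Set Filter Topology MeasureTheory Manifold
open scoped ContDiff RealInnerProductSpace ENNReal

noncomputable section

/-- The Euclidean space `𝔼ⁿ⁺²`; coordinate `0` is `x₁` and the last coordinate is `xₙ₊₂`. -/
abbrev EAmb (n : ℕ) : Type := EuclideanSpace ℝ (Fin (n + 2))

/-- The unit vector `∂/∂xₙ₊₂` spanning the factor `ℝ` of `𝕊ⁿ × ℝ`. -/
def vertical (n : ℕ) : EAmb n := EuclideanSpace.single (Fin.last (n + 1)) 1

/-- `𝕊ⁿ × ℝ ⊆ 𝔼ⁿ⁺²`: the points with `x₁² + ⋯ + xₙ₊₁² = 1`. -/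
def sphereLine (n : ℕ) : Set (EAmb n) :=
  {x | ∑ i : Fin (n + 1), x i.castSucc ^ 2 = 1}

/-- The slice `𝕊ⁿ × {t}`. -/
def sphereSlice (n : ℕ) (t : ℝ) : Set (EAmb n) :=
  {x | x ∈ sphereLine n ∧ x (Fin.last (n + 1)) = t}

/-- `A` is an open subset of the subspace `B`. -/
def IsOpenSubsetOf {X : Type*} [TopologicalSpace X] (A B : Set X) : Prop :=
  ∃ U : Set X, IsOpen U ∧ A = U ∩ B

section Curvature

variable {n : ℕ}

/-- The `i`-th partial derivative of `φ` at `u`. -/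
def partialD (i : Fin n) (φ : EuclideanSpace ℝ (Fin n) → ℝ) (u : EuclideanSpace ℝ (Fin n)) : ℝ :=
  fderiv ℝ φ u (EuclideanSpace.single i 1)

/-- The Christoffel symbol `Γᵏᵢⱼ` of the metric with coefficient matrix `g`. -/
def christoffel (g : EuclideanSpace ℝ (Fin n) → Matrix (Fin n) (Fin n) ℝ) (k i j : Fin n)
    (u : EuclideanSpace ℝ (Fin n)) : ℝ :=
  1 / 2 * ∑ l, (g u)⁻¹ k l *
    (partialD i (fun v => g v j l) u + partialD j (fun v => g v i l) u
      - partialD l (fun v => g v i j) u)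

/-- The component `Rˡᵢⱼₖ` of the curvature tensor: `R(∂ᵢ, ∂ⱼ) ∂ₖ = ∑ₗ Rˡᵢⱼₖ ∂ₗ`, where
`R(X, Y) Z = ∇_X ∇_Y Z - ∇_Y ∇_X Z - ∇_{[X, Y]} Z` for the Levi-Civita connection. -/
def curvatureTensor (g : EuclideanSpace ℝ (Fin n) → Matrix (Fin n) (Fin n) ℝ) (l i j k : Fin n)
    (u : EuclideanSpace ℝ (Fin n)) : ℝ :=
  partialD i (christoffel g l j k) u - partialD j (christoffel g l i k) u
    + ∑ m, (christoffel g l i m u * christoffel g m j k u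
      - christoffel g l j m u * christoffel g m i k u)

/-- The inner product of two tangent vectors at `u`. -/
def metricInner (g : EuclideanSpace ℝ (Fin n) → Matrix (Fin n) (Fin n) ℝ)
    (u X Y : EuclideanSpace ℝ (Fin n)) : ℝ :=
  ∑ i, ∑ j, g u i j * X i * Y j

/-- The sectional curvature `⟨R(X, Y) Y, X⟩ / (|X|² |Y|² - ⟨X, Y⟩²)` of the plane spanned by
linearly independent tangent vectors `X`, `Y` at `u`. -/
def sectionalCurvature (g : EuclideanSpace ℝ (Fin n) → Matrix (Fin n) (Fin n) ℝ)
    (u X Y : EuclideanSpace ℝ (Fin n)) : ℝ :=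
  (∑ i, ∑ j, ∑ k, ∑ l, ∑ m, curvatureTensor g l i j k u * g u l m * X i * Y j * Y k * X m) /
    (metricInner g u X X * metricInner g u Y Y - metricInner g u X Y ^ 2)

/-- The coefficients `⟨∂ᵢF, ∂ⱼF⟩` of the metric induced by a parametrization `F`. -/
def inducedMetric (F : EuclideanSpace ℝ (Fin n) → EAmb n) (u : EuclideanSpace ℝ (Fin n)) :
    Matrix (Fin n) (Fin n) ℝ :=
  Matrix.of fun i j =>
    ⟪fderiv ℝ F u (EuclideanSpace.single i 1), fderiv ℝ F u (EuclideanSpace.single j 1)⟫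

end Curvature

section Hypersurface

variable (n : ℕ) {M : Type*} [TopologicalSpace M] [ChartedSpace (EuclideanSpace ℝ (Fin n)) M]

/-- `f` is a smooth immersed hypersurface of `𝕊ⁿ × ℝ`, regarded as a map into `𝔼ⁿ⁺²`. -/
structure IsHypersurface (f : M → EAmb n) : Prop where
  smooth : ContMDiff (𝓡 n) 𝓘(ℝ, EAmb n) ∞ f
  immersion : ∀ x, Function.Injective (mfderiv (𝓡 n) 𝓘(ℝ, EAmb n) f x)
  mem : ∀ x, f x ∈ sphereLine n

/-- The metric induced by the immersion `f` has constant sectional curvature `c`: in every chart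
of `M`, all the tangent planes at all the points have sectional curvature `c`. -/
def HasConstantSectionalCurvature (f : M → EAmb n) (c : ℝ) : Prop :=
  ∀ φ ∈ IsManifold.maximalAtlas (𝓡 n) ∞ M, ∀ u ∈ φ.target, ∀ X Y : EuclideanSpace ℝ (Fin n),
    LinearIndependent ℝ ![X, Y] → sectionalCurvature (inducedMetric (f ∘ φ.symm)) u X Y = c

/-- The distance on `M` of the metric induced by `f`: the infimum of the lengths of the `C¹` paths
joining two points. -/
def inducedEDist (f : M → EAmb n) (p q : M) : ℝ≥0∞ :=
  ⨅ (γ : ℝ → M) (_ : γ 0 = p) (_ : γ 1 = q)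
    (_ : ContMDiffOn 𝓘(ℝ, ℝ) (𝓡 n) 1 γ (Icc 0 1)), ∫⁻ t in Icc (0 : ℝ) 1, ‖deriv (f ∘ γ) t‖ₑ

/-- The metric induced by `f` is complete: Cauchy sequences for its distance converge in `M`. -/
def IsCompleteInduced (f : M → EAmb n) : Prop :=
  ∀ x : ℕ → M,
    (∀ ε : ℝ≥0∞, 0 < ε → ∃ K, ∀ i ≥ K, ∀ j ≥ K, inducedEDist n f (x i) (x j) < ε) →
      ∃ p, Tendsto x atTop (𝓝 p)

/-- `P` is an axis: a two-dimensional subspace of `𝔼ⁿ⁺²` containing `∂/∂xₙ₊₂`. -/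
structure IsAxis (P : Submodule ℝ (EAmb n)) : Prop where
  finrank_eq : Module.finrank ℝ P = 2
  vertical_mem : vertical n ∈ P

/-- `α`, on the interval `I`, is a smooth curve parametrized by arc length in
`(𝕊ⁿ × ℝ) ∩ P³ = 𝕊¹ × ℝ`, for a three-dimensional subspace `P³` (here `Q`) containing the axis `P`,
and it lies in one of the two closed half-spaces of `P³` bounded by `P`. -/
structure IsProfileCurve (P : Submodule ℝ (EAmb n)) (α : ℝ → EAmb n) (I : Set ℝ) : Prop where
  ordConnected : I.OrdConnected
  nontrivial : I.Nontrivial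
  smooth : ContDiffOn ℝ ∞ α I
  unit_speed : ∀ s ∈ I, ‖derivWithin α I s‖ = 1
  mem : ∀ s ∈ I, α s ∈ sphereLine n
  half_space : ∃ Q : Submodule ℝ (EAmb n), Module.finrank ℝ Q = 3 ∧ P ≤ Q ∧ (∀ s ∈ I, α s ∈ Q) ∧
    ∃ b ∈ Q, b ≠ 0 ∧ (∀ p ∈ P, ⟪b, p⟫ = 0) ∧ ∀ s ∈ I, 0 ≤ ⟪b, α s⟫

/-- The orbit of the curve `α` under the group of the isometries of `𝔼ⁿ⁺²` that fix `P`
pointwise. (They fix the origin, hence they are linear.) -/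
def rotationOrbit (P : Submodule ℝ (EAmb n)) (α : ℝ → EAmb n) (I : Set ℝ) : Set (EAmb n) :=
  {x | ∃ A : EAmb n ≃ₗᵢ[ℝ] EAmb n, (∀ p ∈ P, A p = p) ∧ ∃ s ∈ I, x = A (α s)}

/-- `f` is a rotation hypersurface of `𝕊ⁿ × ℝ` with axis `P`. -/
structure IsRotationHypersurface (P : Submodule ℝ (EAmb n)) (f : M → EAmb n) : Prop where
  isHypersurface : IsHypersurface n f
  isAxis : IsAxis n P
  orbit : ∃ (α : ℝ → EAmb n) (I : Set ℝ), IsProfileCurve n P α I ∧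
    range f = rotationOrbit n P α I

end Hypersurface

/-- The subset `S` of `𝕊ⁿ × ℝ` is a complete rotation hypersurface with axis `P`: it is the image
of a rotation hypersurface whose induced metric is complete. -/
def IsCompleteRotationHypersurface (n : ℕ) (P : Submodule ℝ (EAmb n)) (S : Set (EAmb n)) : Prop :=
  ∃ (N : Type) (_ : TopologicalSpace N) (_ : T2Space N) (_ : SecondCountableTopology N)
    (_ : ConnectedSpace N) (_ : ChartedSpace (EuclideanSpace ℝ (Fin n)) N)
    (_ : IsManifold (𝓡 n) ∞ N) (F : N → EAmb n),
    IsRotationHypersurface n P F ∧ IsCompleteInduced n F ∧ range F = S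

/-- The point `(sin k(s), cos k(s) φ₁, …, cos k(s) φₙ, h(s))`. -/
def rotationParam (n : ℕ) (k h : ℝ → ℝ) (s : ℝ) (φ : EuclideanSpace ℝ (Fin n)) : EAmb n :=
  WithLp.toLp 2 (Fin.cons (Real.sin (k s))
    (Fin.snoc (α := fun _ => ℝ) (fun i : Fin n => Real.cos (k s) * φ i) (h s)))

/-- `k(s) = arccos (sin (√c s) / √c)`. -/
def profileK (c s : ℝ) : ℝ :=
  Real.arccos (1 / √c * Real.sin (√c * s))

/-- `h(s) = -√((c-1)/c) log ((cos (√c s) + √(c - sin² (√c s))) / (1 + √c))`. -/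
def profileH (c s : ℝ) : ℝ :=
  -√((c - 1) / c) *
    Real.log ((Real.cos (√c * s) + √(c - Real.sin (√c * s) ^ 2)) / (1 + √c))

/-- The set of the points `(sin k(s), cos k(s) φ, h(s))` with `s ∈ [0, π/√c]`, `φ ∈ 𝕊ⁿ⁻¹`. -/
def explicitHypersurface (n : ℕ) (c : ℝ) : Set (EAmb n) :=
  {x | ∃ s ∈ Icc (0 : ℝ) (Real.pi / √c), ∃ φ : EuclideanSpace ℝ (Fin n), ‖φ‖ = 1 ∧
    x = rotationParam n (profileK c) (profileH c) s φ}

end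

/-!
Let `e` be a unit vector that spans the axis together with `v = ∂/∂xₙ₊₂`, and let `a = ⟪f, e⟫`,
`h = ⟪f, v⟫` be the axial coordinates of the rotation hypersurface `f`. They take values in a smooth
curve, which has empty interior in the plane, so their differentials are everywhere proportional
(`IsRotationHypersurface.rotationPatch`). This is the only property of the orbit that the local
argument needs; it is recorded in the structure `RotationPatch`.

At a point off the axis, the tangent space is the sum of the orthogonal complement of `e`, `v` and
the radial vector, and of one meridian direction. The second fundamental form is umbilical on the
first summand, which has dimension `n - 1 ≥ 2`, so the Gauss equation for a plane in it expresses
the curvature by the slope of the meridian (`RotationPatch.exists_slope`):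
`c (A² + (1 - a²) B²) = A² + B²`, where `A`, `B` are the derivatives of `a`, `h` along the meridian.
Hence `c ≥ 1`, and points off the axis being dense, the equation
`(c - 1) da² = (1 - c + c a²) dh²` holds everywhere (`RotationPatch.meridian_equation`).

If `c = 1`, the equation reads `a² dh² = 0`; an open set with `a = 0` would be a product, of
curvature zero, so `h` is constant. If `c > 1`, put `κ² = (c - 1) / c`. The equation gives
`(κ da/dh)² = a² - κ²`, whose solutions are `a = ± κ` and the catenaries
`a = ± κ cosh ((h - t) / κ)`. The constant solutions are again excluded because they have curvature
zero, and `a` has no zeros, so for the right orientation of `e` it is positive and lies locally on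
catenaries (`RotationPatch.exists_catenary_off_axis`). Points on the axis are isolated, and as
punctured balls are connected, the parameter `t` is the same on all sides of such a point
(`RotationPatch.exists_catenary`); as `M` is connected, it is the same everywhere. So `f` maps into
a slice or into the `catenoid` about the axis with parameter `t`. Both are regular level sets of
dimension `n`, in which the image of an immersion is open (`IsHypersurface.isOpenSubsetOf_level`).

The catenoid is the image of a round `n`-sphere under an explicit embedding with a smooth left
inverse; it is complete because the sphere is compact and chords are shorter than paths
(`isCompleteRotationHypersurface_catenoid`). The explicit hypersurface is the catenoid about the
first coordinate axis for one value of `t` (`explicitHypersurface_eq_catenoid`), and all catenoids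
with the same `c` are congruent by a reflection and a vertical translation
(`exists_isometry_image_catenoid`).
-/

/-! ### The Gauss equation in a parametrization -/

theorem differentiableAt_matrix_det {E : Type*} [NormedAddCommGroup E] [NormedSpace ℝ E] {m : ℕ}
    {A : E → Matrix (Fin m) (Fin m) ℝ} {u : E}
    (hA : ∀ i j, DifferentiableAt ℝ (fun v => A v i j) u) :
    DifferentiableAt ℝ (fun v => (A v).det) u := by
  simp only [Matrix.det_apply]
  refine DifferentiableAt.fun_sum fun σ _ => DifferentiableAt.fun_const_smul ?_ _
  fun_prop

theorem differentiableAt_matrix_inv {E : Type*} [NormedAddCommGroup E] [NormedSpace ℝ E] {m : ℕ}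
    {A : E → Matrix (Fin m) (Fin m) ℝ} {u : E}
    (hA : ∀ i j, DifferentiableAt ℝ (fun v => A v i j) u) (hdet : (A u).det ≠ 0) (k l : Fin m) :
    DifferentiableAt ℝ (fun v => (A v)⁻¹ k l) u := by
  simp only [Matrix.inv_def, Matrix.smul_apply, Ring.inverse_eq_inv', smul_eq_mul,
    Matrix.adjugate_apply]
  refine ((differentiableAt_matrix_det hA).inv hdet).mul (differentiableAt_matrix_det fun i j => ?_)
  simp only [Matrix.updateRow_apply]
  split_ifs
  · exact differentiableAt_const _
  · exact hA i j

section GaussEquation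

variable {n : ℕ} {F : EuclideanSpace ℝ (Fin n) → EAmb n} {U : Set (EuclideanSpace ℝ (Fin n))}
  {u : EuclideanSpace ℝ (Fin n)}

theorem contDiffOn_fderiv_of_smooth {E V : Type*} [NormedAddCommGroup E] [NormedSpace ℝ E]
    [NormedAddCommGroup V] [NormedSpace ℝ V] {G : E → V} {s : Set E} (hs : IsOpen s)
    (hG : ContDiffOn ℝ ∞ G s) : ContDiffOn ℝ ∞ (fderiv ℝ G) s :=
  hG.fderiv_of_isOpen hs (by simp)

theorem differentiableAt_of_smooth {E V : Type*} [NormedAddCommGroup E] [NormedSpace ℝ E]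
    [NormedAddCommGroup V] [NormedSpace ℝ V] {G : E → V} {s : Set E} (hs : IsOpen s)
    (hG : ContDiffOn ℝ ∞ G s) {x : E} (hx : x ∈ s) : DifferentiableAt ℝ G x :=
  (hG.contDiffAt (hs.mem_nhds hx)).differentiableAt (by simp)

theorem fderiv_fderiv_symm {E V : Type*} [NormedAddCommGroup E] [NormedSpace ℝ E]
    [NormedAddCommGroup V] [NormedSpace ℝ V] {G : E → V} {s : Set E} (hs : IsOpen s)
    (hG : ContDiffOn ℝ ∞ G s) {x : E} (hx : x ∈ s) (X Y : E) :
    fderiv ℝ (fderiv ℝ G) x X Y = fderiv ℝ (fderiv ℝ G) x Y X :=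
  ((hG.contDiffAt (hs.mem_nhds hx)).isSymmSndFDerivAt
    (by rw [minSmoothness_of_isRCLikeNormedField]; exact WithTop.coe_le_coe.2 le_top)) X Y

theorem HasFDerivAt.apply_const {E V W : Type*} [NormedAddCommGroup E] [NormedSpace ℝ E]
    [NormedAddCommGroup V] [NormedSpace ℝ V] [NormedAddCommGroup W] [NormedSpace ℝ W]
    {G : E → W →L[ℝ] V} {G' : E →L[ℝ] W →L[ℝ] V} {x : E} (hG : HasFDerivAt G G' x) (X : W) :
    HasFDerivAt (fun v => G v X) (G'.flip X) x :=
  (ContinuousLinearMap.apply ℝ V X).hasFDerivAt.comp x hG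

/-- The derivative of `v ↦ dF_v(X)`. -/
theorem hasFDerivAt_fderiv_apply {E V : Type*} [NormedAddCommGroup E] [NormedSpace ℝ E]
    [NormedAddCommGroup V] [NormedSpace ℝ V] {G : E → V} {s : Set E} (hs : IsOpen s)
    (hG : ContDiffOn ℝ ∞ G s) {x : E} (hx : x ∈ s) (X : E) :
    HasFDerivAt (fun v => fderiv ℝ G v X) ((fderiv ℝ (fderiv ℝ G) x).flip X) x :=
  (differentiableAt_of_smooth hs (contDiffOn_fderiv_of_smooth hs hG) hx).hasFDerivAt.apply_const X

theorem partialD_inducedMetric (hU : IsOpen U) (hF : ContDiffOn ℝ ∞ F U) (hu : u ∈ U)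
    (l i j : Fin n) :
    partialD l (fun v => inducedMetric F v i j) u =
      ⟪fderiv ℝ (fderiv ℝ F) u (EuclideanSpace.single l 1) (EuclideanSpace.single i 1),
        fderiv ℝ F u (EuclideanSpace.single j 1)⟫ +
      ⟪fderiv ℝ F u (EuclideanSpace.single i 1),
        fderiv ℝ (fderiv ℝ F) u (EuclideanSpace.single l 1) (EuclideanSpace.single j 1)⟫ := by
  have h := (hasFDerivAt_fderiv_apply hU hF hu (EuclideanSpace.single i 1)).inner ℝ
    (hasFDerivAt_fderiv_apply hU hF hu (EuclideanSpace.single j 1))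
  unfold partialD inducedMetric
  simp only [Matrix.of_apply]
  rw [h.fderiv]
  simp [add_comm]

theorem differentiableAt_inducedMetric (hU : IsOpen U) (hF : ContDiffOn ℝ ∞ F U) (hu : u ∈ U)
    (i j : Fin n) : DifferentiableAt ℝ (fun v => inducedMetric F v i j) u :=
  ((hasFDerivAt_fderiv_apply hU hF hu (EuclideanSpace.single i 1)).inner ℝ
    (hasFDerivAt_fderiv_apply hU hF hu (EuclideanSpace.single j 1))).differentiableAt

theorem sum_smul_single {n : ℕ} (X : EuclideanSpace ℝ (Fin n)) :
    ∑ i, X i • EuclideanSpace.single i (1 : ℝ) = X := by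
  simpa using (EuclideanSpace.basisFun (Fin n) ℝ).sum_repr X

theorem metricInner_inducedMetric (X Y : EuclideanSpace ℝ (Fin n)) :
    metricInner (inducedMetric F) u X Y = ⟪fderiv ℝ F u X, fderiv ℝ F u Y⟫ := by
  conv_rhs => rw [← sum_smul_single X, ← sum_smul_single Y]
  simp only [map_sum, map_smul, sum_inner, inner_sum, inner_smul_left, inner_smul_right]
  simp only [metricInner, inducedMetric, Matrix.of_apply]
  rw [Finset.sum_comm]
  simp only [Finset.mul_sum]
  refine Finset.sum_congr rfl fun i _ => Finset.sum_congr rfl fun j _ => ?_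
  simp; ring

theorem det_inducedMetric_ne_zero (hinj : Function.Injective (fderiv ℝ F u)) :
    (inducedMetric F u).det ≠ 0 := by
  intro h0
  obtain ⟨x, hx, hgx⟩ := Matrix.exists_mulVec_eq_zero_iff.2 h0
  set X : EuclideanSpace ℝ (Fin n) := WithLp.toLp 2 x
  have h1 : metricInner (inducedMetric F) u X X = 0 := by
    have : metricInner (inducedMetric F) u X X = ∑ i, X i * ((inducedMetric F u).mulVec x) i := by
      simp only [metricInner, Matrix.mulVec, dotProduct, Finset.mul_sum]
      refine Finset.sum_congr rfl fun i _ => Finset.sum_congr rfl fun j _ => ?_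
      simp [X]; ring
    rw [this, hgx]; simp
  rw [metricInner_inducedMetric, inner_self_eq_zero] at h1
  have h2 : X = 0 := hinj (by simpa using h1)
  exact hx (by simpa [X] using h2)

/-- The Christoffel symbols are the components of the tangential part of the second derivative. -/
theorem sum_inducedMetric_mul_christoffel (hU : IsOpen U) (hF : ContDiffOn ℝ ∞ F U) (hu : u ∈ U)
    (hinj : Function.Injective (fderiv ℝ F u)) (m i j : Fin n) :
    ∑ k, inducedMetric F u m k * christoffel (inducedMetric F) k i j u =
      ⟪fderiv ℝ (fderiv ℝ F) u (EuclideanSpace.single i 1) (EuclideanSpace.single j 1),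
        fderiv ℝ F u (EuclideanSpace.single m 1)⟫ := by
  have h1 : ∀ k, christoffel (inducedMetric F) k i j u =
      ((inducedMetric F u)⁻¹.mulVec fun l =>
        ⟪fderiv ℝ (fderiv ℝ F) u (EuclideanSpace.single i 1) (EuclideanSpace.single j 1),
          fderiv ℝ F u (EuclideanSpace.single l 1)⟫) k := by
    intro k
    simp only [christoffel, Matrix.mulVec, dotProduct, Finset.mul_sum]
    refine Finset.sum_congr rfl fun l _ => ?_
    rw [partialD_inducedMetric hU hF hu, partialD_inducedMetric hU hF hu,
      partialD_inducedMetric hU hF hu, fderiv_fderiv_symm hU hF hu (EuclideanSpace.single j 1)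
        (EuclideanSpace.single i 1), fderiv_fderiv_symm hU hF hu (EuclideanSpace.single l 1)
        (EuclideanSpace.single i 1), fderiv_fderiv_symm hU hF hu (EuclideanSpace.single l 1)
        (EuclideanSpace.single j 1), real_inner_comm (fderiv ℝ F u (EuclideanSpace.single j 1))]
    ring
  simp_rw [h1]
  change ((inducedMetric F u).mulVec ((inducedMetric F u)⁻¹.mulVec _)) m = _
  rw [Matrix.mulVec_mulVec, Matrix.mul_nonsing_inv _
    (isUnit_iff_ne_zero.2 (det_inducedMetric_ne_zero hinj)), Matrix.one_mulVec]

theorem differentiableAt_christoffel (hU : IsOpen U) (hF : ContDiffOn ℝ ∞ F U) (hu : u ∈ U)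
    (hinj : Function.Injective (fderiv ℝ F u)) (k i j : Fin n) :
    DifferentiableAt ℝ (christoffel (inducedMetric F) k i j) u := by
  have hpart : ∀ l i j, DifferentiableAt ℝ (partialD l fun v => inducedMetric F v i j) u := by
    intro l i j
    have hF1 := contDiffOn_fderiv_of_smooth hU hF
    have hD : ∀ X, DifferentiableAt ℝ (fun v => fderiv ℝ F v X) u := fun X =>
      (hasFDerivAt_fderiv_apply hU hF hu X).differentiableAt
    have hD2 : ∀ X Y, DifferentiableAt ℝ (fun v => fderiv ℝ (fderiv ℝ F) v X Y) u := fun X Y =>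
      ((hasFDerivAt_fderiv_apply hU hF1 hu X).apply_const Y).differentiableAt
    refine DifferentiableAt.congr_of_eventuallyEq (((hD2 (EuclideanSpace.single l 1)
      (EuclideanSpace.single i 1)).inner ℝ (hD (EuclideanSpace.single j 1))).add
      ((hD (EuclideanSpace.single i 1)).inner ℝ (hD2 (EuclideanSpace.single l 1)
      (EuclideanSpace.single j 1)))) ?_
    filter_upwards [hU.mem_nhds hu] with v hv
    exact partialD_inducedMetric hU hF hv l i j
  unfold christoffel
  refine DifferentiableAt.const_mul (DifferentiableAt.fun_sum fun l _ => ?_) _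
  exact (differentiableAt_matrix_inv (differentiableAt_inducedMetric hU hF hu)
    (det_inducedMetric_ne_zero hinj) k l).mul
    (((hpart _ _ _).add (hpart _ _ _)).sub (hpart _ _ _))

/-- The Gauss equation for coordinate vector fields, with the tangential part of the second
derivative written through the Christoffel symbols. -/
theorem sum_curvatureTensor_mul_inducedMetric (hU : IsOpen U) (hF : ContDiffOn ℝ ∞ F U)
    (hinj : ∀ v ∈ U, Function.Injective (fderiv ℝ F v)) (hu : u ∈ U) (i j k m : Fin n) :
    ∑ l, curvatureTensor (inducedMetric F) l i j k u * inducedMetric F u l m =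
      (⟪fderiv ℝ (fderiv ℝ F) u (EuclideanSpace.single i 1) (EuclideanSpace.single m 1),
        fderiv ℝ (fderiv ℝ F) u (EuclideanSpace.single j 1) (EuclideanSpace.single k 1) -
        ∑ l, christoffel (inducedMetric F) l j k u • fderiv ℝ F u (EuclideanSpace.single l 1)⟫) -
      ⟪fderiv ℝ (fderiv ℝ F) u (EuclideanSpace.single j 1) (EuclideanSpace.single m 1),
        fderiv ℝ (fderiv ℝ F) u (EuclideanSpace.single i 1) (EuclideanSpace.single k 1) -
        ∑ l, christoffel (inducedMetric F) l i k u • fderiv ℝ F u (EuclideanSpace.single l 1)⟫ := by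
  have hF1 := contDiffOn_fderiv_of_smooth hU hF
  have hsymm : ∀ a b, inducedMetric F u a b = inducedMetric F u b a := fun a b => by
    simp [inducedMetric, real_inner_comm]
  -- the identity `⟪dF Γ(∂ⱼ, ∂ₖ), ∂ₘF⟫ = ⟪∂ⱼ∂ₖF, ∂ₘF⟫`, differentiated in the direction `∂ᵢ`
  have key : ∀ i j k : Fin n,
      ∑ l, inducedMetric F u m l * partialD i (christoffel (inducedMetric F) l j k) u =
      ⟪fderiv ℝ (fderiv ℝ (fderiv ℝ F)) u (EuclideanSpace.single i 1) (EuclideanSpace.single j 1)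
          (EuclideanSpace.single k 1), fderiv ℝ F u (EuclideanSpace.single m 1)⟫ +
      ⟪fderiv ℝ (fderiv ℝ F) u (EuclideanSpace.single j 1) (EuclideanSpace.single k 1),
        fderiv ℝ (fderiv ℝ F) u (EuclideanSpace.single i 1) (EuclideanSpace.single m 1)⟫ -
      ∑ l, partialD i (fun v => inducedMetric F v m l) u *
        christoffel (inducedMetric F) l j k u := by
    intro i j k
    have h1 : HasFDerivAt (fun v => ∑ l, inducedMetric F v m l *
        christoffel (inducedMetric F) l j k v) _ u :=
      HasFDerivAt.fun_sum fun l _ => (differentiableAt_inducedMetric hU hF hu m l).hasFDerivAt.mul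
        (differentiableAt_christoffel hU hF hu (hinj u hu) l j k).hasFDerivAt
    have h2 := ((hasFDerivAt_fderiv_apply hU hF1 hu (EuclideanSpace.single j 1)).apply_const
      (EuclideanSpace.single k 1)).inner ℝ
      (hasFDerivAt_fderiv_apply hU hF hu (EuclideanSpace.single m 1))
    have h3 := h2.congr_of_eventuallyEq (f₁ := fun v => ∑ l, inducedMetric F v m l *
        christoffel (inducedMetric F) l j k v) (by
      filter_upwards [hU.mem_nhds hu] with v hv
      exact sum_inducedMetric_mul_christoffel hU hF hv (hinj v hv) m j k)
    have h4 := congrArg (fun L => L (EuclideanSpace.single i (1 : ℝ))) (h1.unique h3)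
    simp [Finset.sum_add_distrib] at h4
    simp only [partialD]
    rw [Finset.sum_congr rfl fun l _ => mul_comm (fderiv ℝ (fun v => inducedMetric F v m l) u
      (EuclideanSpace.single i 1)) (christoffel (inducedMetric F) l j k u)]
    linarith [h4]
  have hmain : ∑ l, curvatureTensor (inducedMetric F) l i j k u * inducedMetric F u l m =
      (∑ l, inducedMetric F u m l * partialD i (christoffel (inducedMetric F) l j k) u) -
      (∑ l, inducedMetric F u m l * partialD j (christoffel (inducedMetric F) l i k) u) +
      ∑ q, ((∑ l, inducedMetric F u m l * christoffel (inducedMetric F) l i q u) *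
          christoffel (inducedMetric F) q j k u -
        (∑ l, inducedMetric F u m l * christoffel (inducedMetric F) l j q u) *
          christoffel (inducedMetric F) q i k u) := by
    simp only [curvatureTensor, add_mul, sub_mul, Finset.sum_add_distrib, Finset.sum_sub_distrib,
      Finset.sum_mul]
    rw [Finset.sum_comm (f := fun l q => christoffel (inducedMetric F) l i q u *
      christoffel (inducedMetric F) q j k u * inducedMetric F u l m),
      Finset.sum_comm (f := fun l q => christoffel (inducedMetric F) l j q u *
      christoffel (inducedMetric F) q i k u * inducedMetric F u l m)]
    congr 1
    · congr 1 <;> exact Finset.sum_congr rfl fun l _ => by rw [hsymm l m]; ring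
    · congr 1 <;> exact Finset.sum_congr rfl fun q _ => Finset.sum_congr rfl fun l _ => by
        rw [hsymm l m]; ring
  rw [hmain, key, key]
  simp only [sum_inducedMetric_mul_christoffel hU hF hu (hinj u hu),
    partialD_inducedMetric hU hF hu, inner_sub_right, inner_sum, inner_smul_right, add_mul,
    Finset.sum_add_distrib, Finset.sum_sub_distrib]
  have h3 : fderiv ℝ (fderiv ℝ (fderiv ℝ F)) u (EuclideanSpace.single i 1)
      (EuclideanSpace.single j 1) = fderiv ℝ (fderiv ℝ (fderiv ℝ F)) u (EuclideanSpace.single j 1)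
      (EuclideanSpace.single i 1) := fderiv_fderiv_symm hU hF1 hu _ _
  rw [h3, real_inner_comm (fderiv ℝ (fderiv ℝ F) u (EuclideanSpace.single j 1)
      (EuclideanSpace.single k 1)), real_inner_comm (fderiv ℝ (fderiv ℝ F) u
      (EuclideanSpace.single i 1) (EuclideanSpace.single k 1))]
  simp only [real_inner_comm _ (fderiv ℝ F u (EuclideanSpace.single m 1)), mul_comm
    (christoffel _ _ _ _ _)]
  ring

theorem inner_sum_sum {V : Type*} [NormedAddCommGroup V] [InnerProductSpace ℝ V] {m : ℕ}
    (p q : Fin m → Fin m → V) :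
    ⟪∑ i, ∑ k, p i k, ∑ j, ∑ l, q j l⟫ = ∑ i, ∑ k, ∑ j, ∑ l, ⟪p i k, q j l⟫ := by
  rw [sum_inner]
  refine Finset.sum_congr rfl fun i _ => ?_
  rw [sum_inner]
  refine Finset.sum_congr rfl fun k _ => ?_
  rw [inner_sum]
  exact Finset.sum_congr rfl fun j _ => inner_sum _ _ _

theorem sum_rotate {m : ℕ} (p : Fin m → Fin m → Fin m → ℝ) :
    ∑ j, ∑ k, ∑ l, p j k l = ∑ l, ∑ j, ∑ k, p j k l := by
  rw [Finset.sum_comm (f := fun l j => ∑ k, p j k l)]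
  exact Finset.sum_congr rfl fun j _ => Finset.sum_comm

theorem sum_contraction {V : Type*} [NormedAddCommGroup V] [InnerProductSpace ℝ V] {m : ℕ}
    (b S : Fin m → Fin m → V) (X Y : EuclideanSpace ℝ (Fin m)) :
    ∑ i, ∑ j, ∑ k, ∑ q, X i * Y j * Y k * X q * (⟪b i q, S j k⟫ - ⟪b j q, S i k⟫) =
      ⟪∑ i, ∑ q, (X i * X q) • b i q, ∑ j, ∑ k, (Y j * Y k) • S j k⟫ -
      ⟪∑ j, ∑ q, (Y j * X q) • b j q, ∑ i, ∑ k, (X i * Y k) • S i k⟫ := by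
  rw [inner_sum_sum, inner_sum_sum]
  simp only [mul_sub, Finset.sum_sub_distrib]
  congr 1
  · refine Finset.sum_congr rfl fun i _ => ?_
    rw [sum_rotate]
    refine Finset.sum_congr rfl fun q _ => Finset.sum_congr rfl fun j _ =>
      Finset.sum_congr rfl fun k _ => ?_
    rw [real_inner_smul_left, real_inner_smul_right]; ring
  · rw [Finset.sum_comm]
    refine Finset.sum_congr rfl fun i _ => ?_
    rw [sum_rotate]
    refine Finset.sum_congr rfl fun q _ => Finset.sum_congr rfl fun j _ =>
      Finset.sum_congr rfl fun k _ => ?_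
    rw [real_inner_smul_left, real_inner_smul_right]; ring

theorem bilin_eq_sum {V : Type*} [NormedAddCommGroup V] [InnerProductSpace ℝ V] {m : ℕ}
    (B : EuclideanSpace ℝ (Fin m) →L[ℝ] EuclideanSpace ℝ (Fin m) →L[ℝ] V)
    (X Y : EuclideanSpace ℝ (Fin m)) :
    B X Y = ∑ i, ∑ q, (X i * Y q) • B (EuclideanSpace.single i 1) (EuclideanSpace.single q 1) := by
  conv_lhs => rw [← sum_smul_single X, ← sum_smul_single Y]
  simp only [map_sum, map_smul, _root_.sum_apply, _root_.smul_apply, Finset.smul_sum, smul_smul]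
  rw [Finset.sum_comm]
  exact Finset.sum_congr rfl fun j _ => Finset.sum_congr rfl fun k _ => by rw [mul_comm]

theorem inner_map_sum_smul {V : Type*} [NormedAddCommGroup V] [InnerProductSpace ℝ V] {m : ℕ}
    {L : EuclideanSpace ℝ (Fin m) →L[ℝ] V}
    {B : EuclideanSpace ℝ (Fin m) →L[ℝ] EuclideanSpace ℝ (Fin m) →L[ℝ] V}
    {G : Fin m → Fin m → EuclideanSpace ℝ (Fin m)}
    (h : ∀ q j k, ⟪L (EuclideanSpace.single q 1), L (G j k)⟫ =
      ⟪L (EuclideanSpace.single q 1), B (EuclideanSpace.single j 1) (EuclideanSpace.single k 1)⟫)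
    (X Y Z : EuclideanSpace ℝ (Fin m)) :
    ⟪L Z, L (∑ j, ∑ k, (X j * Y k) • G j k)⟫ = ⟪L Z, B X Y⟫ := by
  rw [bilin_eq_sum B X Y]
  have hZ : L Z = ∑ q, Z q • L (EuclideanSpace.single q 1) := by
    conv_lhs => rw [← sum_smul_single Z]
    simp
  rw [hZ]
  simp only [map_sum, map_smul, sum_inner, inner_sum, real_inner_smul_left, real_inner_smul_right,
    h]

/-- The Gauss equation: if the second derivatives of the immersion split into tangential parts and
normal parts `N₁`, `N₂`, `N₃`, then the numerator of the sectional curvature is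
`⟪N₁, N₂⟫ - ‖N₃‖²`. -/
theorem gauss_equation (hU : IsOpen U) (hF : ContDiffOn ℝ ∞ F U)
    (hinj : ∀ v ∈ U, Function.Injective (fderiv ℝ F v)) (hu : u ∈ U)
    {X Y p q r : EuclideanSpace ℝ (Fin n)} {N₁ N₂ N₃ : EAmb n}
    (h₁ : fderiv ℝ (fderiv ℝ F) u X X = fderiv ℝ F u p + N₁)
    (h₂ : fderiv ℝ (fderiv ℝ F) u Y Y = fderiv ℝ F u q + N₂)
    (h₃ : fderiv ℝ (fderiv ℝ F) u X Y = fderiv ℝ F u r + N₃)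
    (hN₂ : ∀ Z, ⟪fderiv ℝ F u Z, N₂⟫ = 0)
    (hN₃ : ∀ Z, ⟪fderiv ℝ F u Z, N₃⟫ = 0) :
    sectionalCurvature (inducedMetric F) u X Y =
      (⟪N₁, N₂⟫ - ⟪N₃, N₃⟫) /
        (⟪fderiv ℝ F u X, fderiv ℝ F u X⟫ * ⟪fderiv ℝ F u Y, fderiv ℝ F u Y⟫ -
          ⟪fderiv ℝ F u X, fderiv ℝ F u Y⟫ ^ 2) := by
  set Γ : EuclideanSpace ℝ (Fin n) → EuclideanSpace ℝ (Fin n) → EuclideanSpace ℝ (Fin n) :=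
    fun Y Z => ∑ j, ∑ k, (Y j * Z k) • ∑ l, christoffel (inducedMetric F) l j k u •
      EuclideanSpace.single l 1 with hΓ
  have hΓspec : ∀ X Y Z, ⟪fderiv ℝ F u Z, fderiv ℝ F u (Γ X Y)⟫ =
      ⟪fderiv ℝ F u Z, fderiv ℝ (fderiv ℝ F) u X Y⟫ := by
    intro X Y Z
    have hb : ∀ m j k, ⟪fderiv ℝ F u (EuclideanSpace.single m 1), fderiv ℝ F u
        (∑ l, christoffel (inducedMetric F) l j k u • EuclideanSpace.single l 1)⟫ =
        ⟪fderiv ℝ F u (EuclideanSpace.single m 1),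
          fderiv ℝ (fderiv ℝ F) u (EuclideanSpace.single j 1) (EuclideanSpace.single k 1)⟫ := by
      intro m j k
      rw [real_inner_comm (fderiv ℝ (fderiv ℝ F) u _ _),
        ← sum_inducedMetric_mul_christoffel hU hF hu (hinj u hu) m j k]
      simp [inner_sum, inner_smul_right, inducedMetric, mul_comm]
    exact inner_map_sum_smul hb X Y Z
  have hnum : ∑ i, ∑ j, ∑ k, ∑ l, ∑ m, curvatureTensor (inducedMetric F) l i j k u *
      inducedMetric F u l m * X i * Y j * Y k * X m =
      ⟪fderiv ℝ (fderiv ℝ F) u X X, fderiv ℝ (fderiv ℝ F) u Y Y - fderiv ℝ F u (Γ Y Y)⟫ -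
      ⟪fderiv ℝ (fderiv ℝ F) u Y X, fderiv ℝ (fderiv ℝ F) u X Y - fderiv ℝ F u (Γ X Y)⟫ := by
    have h1 : ∑ i, ∑ j, ∑ k, ∑ l, ∑ m, curvatureTensor (inducedMetric F) l i j k u *
        inducedMetric F u l m * X i * Y j * Y k * X m =
        ∑ i, ∑ j, ∑ k, ∑ m, (X i * Y j * Y k * X m) *
          ∑ l, curvatureTensor (inducedMetric F) l i j k u * inducedMetric F u l m := by
      refine Finset.sum_congr rfl fun i _ => Finset.sum_congr rfl fun j _ =>
        Finset.sum_congr rfl fun k _ => ?_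
      rw [Finset.sum_comm]
      refine Finset.sum_congr rfl fun m _ => ?_
      rw [Finset.mul_sum]
      refine Finset.sum_congr rfl fun l _ => by ring
    have hII : ∀ S T : EuclideanSpace ℝ (Fin n),
        fderiv ℝ (fderiv ℝ F) u S T - fderiv ℝ F u (Γ S T) = ∑ j, ∑ k, (S j * T k) •
          (fderiv ℝ (fderiv ℝ F) u (EuclideanSpace.single j 1) (EuclideanSpace.single k 1) -
        ∑ l, christoffel (inducedMetric F) l j k u •
          fderiv ℝ F u (EuclideanSpace.single l 1)) := by
      intro S T
      rw [bilin_eq_sum _ S T]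
      simp only [hΓ, map_sum, map_smul, smul_sub, Finset.sum_sub_distrib]
    rw [h1, hII, hII]
    simp only [sum_curvatureTensor_mul_inducedMetric hU hF hinj hu]
    rw [bilin_eq_sum _ X X, bilin_eq_sum _ Y X]
    exact sum_contraction _ _ X Y
  have horth : ∀ {S T s : EuclideanSpace ℝ (Fin n)} {N : EAmb n},
      fderiv ℝ (fderiv ℝ F) u S T = fderiv ℝ F u s + N → (∀ Z, ⟪fderiv ℝ F u Z, N⟫ = 0) →
      fderiv ℝ (fderiv ℝ F) u S T - fderiv ℝ F u (Γ S T) = N := by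
    intro S T s N hST hN
    have h0 : fderiv ℝ F u (s - Γ S T) = 0 := by
      have h1 := hΓspec S T (s - Γ S T)
      rw [hST, inner_add_right, hN, add_zero, eq_comm, ← sub_eq_zero, ← inner_sub_right,
        ← map_sub] at h1
      exact inner_self_eq_zero.1 h1
    rw [map_sub, sub_eq_zero] at h0
    rw [hST, h0, add_sub_cancel_left]
  unfold sectionalCurvature
  rw [hnum, horth h₂ hN₂, horth h₃ hN₃, fderiv_fderiv_symm hU hF hu Y X, h₁, h₃, inner_add_left,
    inner_add_left, hN₂, hN₃, zero_add, zero_add, metricInner_inducedMetric,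
    metricInner_inducedMetric, metricInner_inducedMetric]

end GaussEquation

/-! ### The tangent space of a rotation hypersurface -/

section TangentStructure

variable {V : Type*} [NormedAddCommGroup V] [InnerProductSpace ℝ V] {n : ℕ}
  {e v w : V} {a : ℝ} {D : EuclideanSpace ℝ (Fin n) →L[ℝ] V}

theorem mem_orthogonal_span_triple {y : V} :
    y ∈ (Submodule.span ℝ (Set.range ![e, v, w]))ᗮ ↔ ⟪e, y⟫ = 0 ∧ ⟪v, y⟫ = 0 ∧ ⟪w, y⟫ = 0 := by
  rw [Submodule.mem_orthogonal]
  constructor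
  · intro h
    exact ⟨h e (Submodule.subset_span ⟨0, rfl⟩), h v (Submodule.subset_span ⟨1, rfl⟩),
      h w (Submodule.subset_span ⟨2, rfl⟩)⟩
  · rintro ⟨h1, h2, h3⟩ z hz
    induction hz using Submodule.span_induction with
    | mem x hx =>
      obtain ⟨i, rfl⟩ := hx
      fin_cases i <;> assumption
    | zero => simp
    | add x y _ _ hx hy => rw [inner_add_left, hx, hy, add_zero]
    | smul r x _ hx => rw [real_inner_smul_left, hx, mul_zero]

theorem finrank_orthogonal_span_triple [FiniteDimensional ℝ V]
    (hV : Module.finrank ℝ V = n + 2) (he : e ≠ 0) (hv : v ≠ 0)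
    (hw : w ≠ 0) (hev : ⟪e, v⟫ = 0) (hew : ⟪e, w⟫ = 0) (hvw : ⟪v, w⟫ = 0) :
    Module.finrank ℝ (Submodule.span ℝ (Set.range ![e, v, w]))ᗮ + 1 = n := by
  have hli : LinearIndependent ℝ ![e, v, w] := by
    refine linearIndependent_of_ne_zero_of_inner_eq_zero (𝕜 := ℝ) ?_ ?_
    · intro i; fin_cases i <;> assumption
    · intro i j hij
      fin_cases i <;> fin_cases j <;>
        simp_all [real_inner_comm]
  have h1 := Submodule.finrank_add_finrank_orthogonal (Submodule.span ℝ (Set.range ![e, v, w]))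
  rw [finrank_span_eq_card hli, hV, Fintype.card_fin] at h1
  omega

/-- The tangent space of a hypersurface at a point off the axis, when the coordinates along the axis
have proportional differentials: it is the sum of the orthogonal complement of `e`, `v` and the
radial vector `w`, and of the line spanned by `A e + B v - (a A / ‖w‖²) w`. -/
theorem exists_meridian_direction [FiniteDimensional ℝ V]
    (hV : Module.finrank ℝ V = n + 2) (he : ‖e‖ = 1) (hv : ‖v‖ = 1)
    (hw : w ≠ 0) (hev : ⟪e, v⟫ = 0) (hew : ⟪e, w⟫ = 0) (hvw : ⟪v, w⟫ = 0)
    (hD : Function.Injective D)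
    (hwedge : ∀ X Y, ⟪D X, e⟫ * ⟪D Y, v⟫ = ⟪D Y, e⟫ * ⟪D X, v⟫)
    (hrad : ∀ X, ⟪w, D X⟫ = -a * ⟪D X, e⟫) :
    ∃ (T : EuclideanSpace ℝ (Fin n)) (A B : ℝ), 0 < A ^ 2 + B ^ 2 ∧
      D T = A • e + B • v - (a * A / ‖w‖ ^ 2) • w ∧
      (∀ y, ⟪e, y⟫ = 0 → ⟪v, y⟫ = 0 → ⟪w, y⟫ = 0 → ∃ X, D X = y) ∧
      ∀ X, ∃ (t : ℝ) (Z : EuclideanSpace ℝ (Fin n)), X = Z + t • T ∧ ⟪e, D Z⟫ = 0 ∧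
        ⟪v, D Z⟫ = 0 ∧ ⟪w, D Z⟫ = 0 := by
  have he0 : e ≠ 0 := fun h => by simp [h] at he
  have hv0 : v ≠ 0 := fun h => by simp [h] at hv
  have hee : ⟪e, e⟫ = 1 := by rw [real_inner_self_eq_norm_sq, he]; norm_num
  have hvv : ⟪v, v⟫ = 1 := by rw [real_inner_self_eq_norm_sq, hv]; norm_num
  have hww : ⟪w, w⟫ = ‖w‖ ^ 2 := real_inner_self_eq_norm_sq w
  have hw2 : ‖w‖ ^ 2 ≠ 0 := by simpa using hw
  set W := (Submodule.span ℝ (Set.range ![e, v, w]))ᗮ with hW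
  have hWfin : Module.finrank ℝ W + 1 = n :=
    finrank_orthogonal_span_triple hV he0 hv0 hw hev hew hvw
  -- the differentials of the axial coordinates do not both vanish, by counting dimensions
  obtain ⟨T₀, hT₀⟩ : ∃ T₀, 0 < ⟪D T₀, e⟫ ^ 2 + ⟪D T₀, v⟫ ^ 2 := by
    by_contra! hcon
    have hle : LinearMap.range (D : EuclideanSpace ℝ (Fin n) →ₗ[ℝ] V) ≤ W := by
      rintro _ ⟨X, rfl⟩
      have h1 : ⟪D X, e⟫ = 0 := by nlinarith [hcon X, sq_nonneg ⟪D X, e⟫, sq_nonneg ⟪D X, v⟫]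
      have h2 : ⟪D X, v⟫ = 0 := by nlinarith [hcon X, sq_nonneg ⟪D X, e⟫, sq_nonneg ⟪D X, v⟫]
      refine mem_orthogonal_span_triple.2 ⟨?_, ?_, ?_⟩
      · rw [real_inner_comm]; exact h1
      · rw [real_inner_comm]; exact h2
      · change ⟪w, D X⟫ = 0
        rw [hrad, h1, mul_zero]
    have h1 := Submodule.finrank_mono hle
    rw [LinearMap.finrank_range_of_inj (f := (D : EuclideanSpace ℝ (Fin n) →ₗ[ℝ] V)) hD] at h1
    simp at h1
    omega
  set A := ⟪D T₀, e⟫ with hA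
  set B := ⟪D T₀, v⟫ with hB
  let ξ : EuclideanSpace ℝ (Fin n) →ₗ[ℝ] ℝ :=
    A • ((innerₛₗ ℝ e) ∘ₗ (D : EuclideanSpace ℝ (Fin n) →ₗ[ℝ] V)) +
    B • ((innerₛₗ ℝ v) ∘ₗ (D : EuclideanSpace ℝ (Fin n) →ₗ[ℝ] V))
  have hξ : ∀ X, ξ X = A * ⟪D X, e⟫ + B * ⟪D X, v⟫ := fun X => by
    simp [ξ, real_inner_comm]
  have hker : ∀ X, ξ X = 0 → ⟪e, D X⟫ = 0 ∧ ⟪v, D X⟫ = 0 ∧ ⟪w, D X⟫ = 0 := by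
    intro X hX
    rw [hξ] at hX
    have hwX := hwedge X T₀
    rw [← hA, ← hB] at hwX
    have h1 : ⟪D X, e⟫ = 0 := by
      have : (A ^ 2 + B ^ 2) * ⟪D X, e⟫ = 0 := by linear_combination A * hX + B * hwX
      exact (mul_eq_zero.1 this).resolve_left hT₀.ne'
    have h2 : ⟪D X, v⟫ = 0 := by
      have : (A ^ 2 + B ^ 2) * ⟪D X, v⟫ = 0 := by linear_combination B * hX - A * hwX
      exact (mul_eq_zero.1 this).resolve_left hT₀.ne'
    refine ⟨by rw [real_inner_comm]; exact h1, by rw [real_inner_comm]; exact h2, ?_⟩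
    rw [hrad, h1, mul_zero]
  have hmap : (LinearMap.ker ξ).map (D : EuclideanSpace ℝ (Fin n) →ₗ[ℝ] V) = W := by
    refine Submodule.eq_of_le_of_finrank_le ?_ ?_
    · rintro _ ⟨X, hX, rfl⟩
      exact mem_orthogonal_span_triple.2 (hker X hX)
    · rw [← (Submodule.equivMapOfInjective (D : EuclideanSpace ℝ (Fin n) →ₗ[ℝ] V) hD
        (LinearMap.ker ξ)).finrank_eq]
      have h1 := LinearMap.finrank_range_add_finrank_ker ξ
      have h2 : Module.finrank ℝ (LinearMap.range ξ) ≤ 1 := by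
        simpa using Submodule.finrank_le (LinearMap.range ξ)
      simp at h1
      omega
  have hsurj : ∀ y, ⟪e, y⟫ = 0 → ⟪v, y⟫ = 0 → ⟪w, y⟫ = 0 → ∃ X, D X = y := by
    intro y h1 h2 h3
    have hy : y ∈ W := mem_orthogonal_span_triple.2 ⟨h1, h2, h3⟩
    rw [← hmap] at hy
    obtain ⟨X, -, hX⟩ := hy
    exact ⟨X, hX⟩
  obtain ⟨Z₀, hZ₀⟩ := hsurj (D T₀ - (A • e + B • v - (a * A / ‖w‖ ^ 2) • w))
    (by simp only [inner_sub_right, inner_add_right, real_inner_smul_right, hee, hev, hew]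
        rw [real_inner_comm, ← hA]; ring)
    (by simp only [inner_sub_right, inner_add_right, real_inner_smul_right, hvv, hvw]
        rw [real_inner_comm, ← hB, real_inner_comm, hev]; ring)
    (by simp only [inner_sub_right, inner_add_right, real_inner_smul_right, hrad, hww, ← hA]
        rw [real_inner_comm, hew, real_inner_comm, hvw]; field_simp; ring)
  have hT : D (T₀ - Z₀) = A • e + B • v - (a * A / ‖w‖ ^ 2) • w := by
    rw [map_sub, hZ₀]; abel
  refine ⟨T₀ - Z₀, A, B, hT₀, hT, hsurj, fun X => ?_⟩
  have hTe : ⟪D (T₀ - Z₀), e⟫ = A := by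
    rw [hT]
    simp only [inner_sub_left, inner_add_left, real_inner_smul_left, hee]
    rw [real_inner_comm, hev, real_inner_comm, hew]; ring
  have hTv : ⟪D (T₀ - Z₀), v⟫ = B := by
    rw [hT]
    simp only [inner_sub_left, inner_add_left, real_inner_smul_left, hvv, hev]
    rw [real_inner_comm, hvw]; ring
  refine ⟨ξ X / (A ^ 2 + B ^ 2), X - (ξ X / (A ^ 2 + B ^ 2)) • (T₀ - Z₀), by abel, hker _ ?_⟩
  have hξT : ξ (T₀ - Z₀) = A ^ 2 + B ^ 2 := by rw [hξ, hTe, hTv]; ring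
  rw [map_sub, map_smul, hξT, smul_eq_mul, div_mul_cancel₀ _ hT₀.ne', sub_self]

/-- At least two orthonormal tangent directions are orthogonal to the meridian when `n ≥ 3`. -/
theorem exists_orthonormal_parallel_pair [FiniteDimensional ℝ V] (hn : 3 ≤ n)
    (hV : Module.finrank ℝ V = n + 2) (he : ‖e‖ = 1) (hv : ‖v‖ = 1)
    (hw : w ≠ 0) (hev : ⟪e, v⟫ = 0) (hew : ⟪e, w⟫ = 0) (hvw : ⟪v, w⟫ = 0) :
    ∃ y z : V, (⟪e, y⟫ = 0 ∧ ⟪v, y⟫ = 0 ∧ ⟪w, y⟫ = 0) ∧ (⟪e, z⟫ = 0 ∧ ⟪v, z⟫ = 0 ∧ ⟪w, z⟫ = 0) ∧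
      ⟪y, y⟫ = 1 ∧ ⟪z, z⟫ = 1 ∧ ⟪y, z⟫ = 0 := by
  have he0 : e ≠ 0 := fun h => by simp [h] at he
  have hv0 : v ≠ 0 := fun h => by simp [h] at hv
  have hWfin := finrank_orthogonal_span_triple hV he0 hv0 hw hev hew hvw
  set W := (Submodule.span ℝ (Set.range ![e, v, w]))ᗮ with hW
  have hb := (stdOrthonormalBasis ℝ W).orthonormal
  set b := stdOrthonormalBasis ℝ W
  have h0 : 0 < Module.finrank ℝ W := by omega
  have h1 : 1 < Module.finrank ℝ W := by omega
  refine ⟨b ⟨0, h0⟩, b ⟨1, h1⟩, mem_orthogonal_span_triple.1 (b ⟨0, h0⟩).2,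
    mem_orthogonal_span_triple.1 (b ⟨1, h1⟩).2, ?_, ?_, ?_⟩
  · rw [← Submodule.coe_inner, real_inner_self_eq_norm_sq, hb.1]; norm_num
  · rw [← Submodule.coe_inner, real_inner_self_eq_norm_sq, hb.1]; norm_num
  · rw [← Submodule.coe_inner]
    exact hb.2 (by simp)

end TangentStructure

/-! ### Curvature of an immersion whose axial coordinates are dependent -/

theorem inner_vertical {n : ℕ} (x : EAmb n) : ⟪x, vertical n⟫ = x (Fin.last (n + 1)) := by
  simp [vertical, EuclideanSpace.inner_single_right]

theorem norm_vertical (n : ℕ) : ‖vertical n‖ = 1 := by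
  simp [vertical]

theorem inner_vertical_self (n : ℕ) : ⟪vertical n, vertical n⟫ = 1 := by
  rw [real_inner_self_eq_norm_sq, norm_vertical]; norm_num

theorem mem_sphereLine_iff {n : ℕ} {x : EAmb n} :
    x ∈ sphereLine n ↔ ⟪x, x⟫ - ⟪x, vertical n⟫ ^ 2 = 1 := by
  rw [inner_vertical, real_inner_self_eq_norm_sq, EuclideanSpace.norm_sq_eq, Fin.sum_univ_castSucc]
  simp [sphereLine]

/-- A parametrized piece of a hypersurface of `𝕊ⁿ × ℝ` on which the coordinates `⟪F, e⟫` and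
`⟪F, ∂/∂xₙ₊₂⟫` along the axis spanned by `e` and `∂/∂xₙ₊₂` have everywhere proportional
differentials. Every rotation hypersurface with this axis is locally of this form. -/
structure RotationPatch (n : ℕ) (e : EAmb n) (F : EuclideanSpace ℝ (Fin n) → EAmb n)
    (U : Set (EuclideanSpace ℝ (Fin n))) : Prop where
  norm_axis : ‖e‖ = 1
  axis_vertical : ⟪e, vertical n⟫ = 0
  isOpen : IsOpen U
  smooth : ContDiffOn ℝ ∞ F U
  injective : ∀ u ∈ U, Function.Injective (fderiv ℝ F u)
  mem : ∀ u ∈ U, F u ∈ sphereLine n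
  wedge : ∀ u ∈ U, ∀ X Y, ⟪fderiv ℝ F u X, e⟫ * ⟪fderiv ℝ F u Y, vertical n⟫ =
    ⟪fderiv ℝ F u Y, e⟫ * ⟪fderiv ℝ F u X, vertical n⟫

/-- All the sectional curvatures of the metric induced by `F` on `U` are equal to `c`. -/
def HasCurvatureOn {n : ℕ} (F : EuclideanSpace ℝ (Fin n) → EAmb n)
    (U : Set (EuclideanSpace ℝ (Fin n))) (c : ℝ) : Prop :=
  ∀ u ∈ U, ∀ X Y : EuclideanSpace ℝ (Fin n), LinearIndependent ℝ ![X, Y] →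
    sectionalCurvature (inducedMetric F) u X Y = c

namespace RotationPatch

variable {n : ℕ} {e : EAmb n} {F : EuclideanSpace ℝ (Fin n) → EAmb n}
  {U : Set (EuclideanSpace ℝ (Fin n))} {u : EuclideanSpace ℝ (Fin n)} {c : ℝ}

theorem hasFDerivAt (hP : RotationPatch n e F U) (hu : u ∈ U) :
    HasFDerivAt F (fderiv ℝ F u) u :=
  (differentiableAt_of_smooth hP.isOpen hP.smooth hu).hasFDerivAt

theorem hasFDerivAt_inner (hP : RotationPatch n e F U) (hu : u ∈ U) (y : EAmb n) :
    HasFDerivAt (fun v => ⟪F v, y⟫) ((innerSL ℝ y).comp (fderiv ℝ F u)) u := by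
  have h := ((innerSL ℝ y).hasFDerivAt (x := F u)).comp u (hP.hasFDerivAt hu)
  refine h.congr_of_eventuallyEq (Eventually.of_forall fun v => ?_)
  simp [real_inner_comm]

theorem hasFDerivAt_inner_fderiv (hP : RotationPatch n e F U) (hu : u ∈ U)
    (X : EuclideanSpace ℝ (Fin n)) (y : EAmb n) :
    HasFDerivAt (fun v => ⟪fderiv ℝ F v X, y⟫)
      ((innerSL ℝ y).comp ((fderiv ℝ (fderiv ℝ F) u).flip X)) u := by
  have h := ((innerSL ℝ y).hasFDerivAt (x := fderiv ℝ F u X)).comp u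
    (hasFDerivAt_fderiv_apply hP.isOpen hP.smooth hu X)
  refine h.congr_of_eventuallyEq (Eventually.of_forall fun v => ?_)
  simp [real_inner_comm]

theorem inner_fderiv (hP : RotationPatch n e F U) (hu : u ∈ U) (X : EuclideanSpace ℝ (Fin n)) :
    ⟪F u, fderiv ℝ F u X⟫ = ⟪F u, vertical n⟫ * ⟪fderiv ℝ F u X, vertical n⟫ := by
  have h1 := ((hP.hasFDerivAt hu).inner ℝ (hP.hasFDerivAt hu)).sub
    ((hP.hasFDerivAt_inner hu (vertical n)).pow 2)
  have h2 : HasFDerivAt (fun _ : EuclideanSpace ℝ (Fin n) => (1 : ℝ)) _ u :=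
    h1.congr_of_eventuallyEq (by
      filter_upwards [hP.isOpen.mem_nhds hu] with v hv
      exact (mem_sphereLine_iff.1 (hP.mem v hv)).symm)
  have h3 := congrArg (fun L => L X) (h2.unique (hasFDerivAt_const (1 : ℝ) u))
  simp at h3
  rw [real_inner_comm (fderiv ℝ F u X) (vertical n)] at h3
  linarith [real_inner_comm (F u) (fderiv ℝ F u X)]

theorem inner_fderiv_fderiv (hP : RotationPatch n e F U) (hu : u ∈ U)
    (X Y : EuclideanSpace ℝ (Fin n)) :
    ⟪fderiv ℝ F u X, fderiv ℝ F u Y⟫ + ⟪F u, fderiv ℝ (fderiv ℝ F) u X Y⟫ =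
      ⟪fderiv ℝ F u X, vertical n⟫ * ⟪fderiv ℝ F u Y, vertical n⟫ +
      ⟪F u, vertical n⟫ * ⟪fderiv ℝ (fderiv ℝ F) u X Y, vertical n⟫ := by
  have h1 := (hP.hasFDerivAt hu).inner ℝ (hasFDerivAt_fderiv_apply hP.isOpen hP.smooth hu Y)
  have h2 := (hP.hasFDerivAt_inner hu (vertical n)).mul
    (hP.hasFDerivAt_inner_fderiv hu Y (vertical n))
  have h3 := h1.congr_of_eventuallyEq (f₁ := fun v => ⟪F v, vertical n⟫ *
    ⟪fderiv ℝ F v Y, vertical n⟫) (by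
      filter_upwards [hP.isOpen.mem_nhds hu] with v hv
      exact (hP.inner_fderiv hv Y).symm)
  have h4 := congrArg (fun L => L X) (h3.unique h2)
  simp at h4
  rw [real_inner_comm (fderiv ℝ F u X) (vertical n),
    real_inner_comm (fderiv ℝ (fderiv ℝ F) u X Y) (vertical n)] at h4
  linarith

theorem wedge_fderiv (hP : RotationPatch n e F U) (hu : u ∈ U)
    (X Y Z : EuclideanSpace ℝ (Fin n)) :
    ⟪fderiv ℝ (fderiv ℝ F) u Z X, e⟫ * ⟪fderiv ℝ F u Y, vertical n⟫ +
      ⟪fderiv ℝ F u X, e⟫ * ⟪fderiv ℝ (fderiv ℝ F) u Z Y, vertical n⟫ =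
    ⟪fderiv ℝ (fderiv ℝ F) u Z Y, e⟫ * ⟪fderiv ℝ F u X, vertical n⟫ +
      ⟪fderiv ℝ F u Y, e⟫ * ⟪fderiv ℝ (fderiv ℝ F) u Z X, vertical n⟫ := by
  have h1 := (hP.hasFDerivAt_inner_fderiv hu X e).mul
    (hP.hasFDerivAt_inner_fderiv hu Y (vertical n))
  have h2 := (hP.hasFDerivAt_inner_fderiv hu Y e).mul
    (hP.hasFDerivAt_inner_fderiv hu X (vertical n))
  have h3 := h1.congr_of_eventuallyEq (f₁ := fun v => ⟪fderiv ℝ F v Y, e⟫ *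
    ⟪fderiv ℝ F v X, vertical n⟫) (by
      filter_upwards [hP.isOpen.mem_nhds hu] with v hv
      exact (hP.wedge v hv X Y).symm)
  have h4 := congrArg (fun L => L Z) (h3.unique h2)
  simp at h4
  simp only [real_inner_comm _ e, real_inner_comm _ (vertical n)] at h4 ⊢
  linarith

/-- The radial vector: the component of `F u` orthogonal to the axis. -/
noncomputable def radial (e : EAmb n) (F : EuclideanSpace ℝ (Fin n) → EAmb n)
    (u : EuclideanSpace ℝ (Fin n)) : EAmb n :=
  F u - ⟪F u, e⟫ • e - ⟪F u, vertical n⟫ • vertical n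

theorem inner_axis_self (hP : RotationPatch n e F U) : ⟪e, e⟫ = 1 := by
  rw [real_inner_self_eq_norm_sq, hP.norm_axis]; norm_num

theorem inner_axis_radial (hP : RotationPatch n e F U) (u : EuclideanSpace ℝ (Fin n)) :
    ⟪e, radial e F u⟫ = 0 := by
  simp only [radial, inner_sub_right, real_inner_smul_right, hP.inner_axis_self, hP.axis_vertical]
  rw [real_inner_comm]; ring

theorem inner_vertical_radial (hP : RotationPatch n e F U) (u : EuclideanSpace ℝ (Fin n)) :
    ⟪vertical n, radial e F u⟫ = 0 := by
  simp only [radial, inner_sub_right, real_inner_smul_right, inner_vertical_self]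
  have h := hP.axis_vertical
  rw [real_inner_comm] at h
  rw [h, real_inner_comm (F u)]; ring

theorem inner_radial (u : EuclideanSpace ℝ (Fin n)) (y : EAmb n) :
    ⟪radial e F u, y⟫ = ⟪F u, y⟫ - ⟪F u, e⟫ * ⟪y, e⟫ - ⟪F u, vertical n⟫ * ⟪y, vertical n⟫ := by
  simp only [radial, inner_sub_left, real_inner_smul_left]
  rw [real_inner_comm y e, real_inner_comm y (vertical n)]

theorem norm_sq_radial (hP : RotationPatch n e F U) (hu : u ∈ U) :
    ‖radial e F u‖ ^ 2 = 1 - ⟪F u, e⟫ ^ 2 := by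
  have h := mem_sphereLine_iff.1 (hP.mem u hu)
  rw [← real_inner_self_eq_norm_sq, inner_radial, real_inner_comm e (radial e F u),
    hP.inner_axis_radial, real_inner_comm (vertical n) (radial e F u), hP.inner_vertical_radial,
    real_inner_comm (radial e F u) (F u), inner_radial]
  linarith

theorem inner_radial_fderiv (hP : RotationPatch n e F U) (hu : u ∈ U)
    (X : EuclideanSpace ℝ (Fin n)) :
    ⟪radial e F u, fderiv ℝ F u X⟫ = -⟪F u, e⟫ * ⟪fderiv ℝ F u X, e⟫ := by
  rw [inner_radial, hP.inner_fderiv hu]; ring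

theorem inner_radial_fderiv_fderiv (hP : RotationPatch n e F U) (hu : u ∈ U)
    (X Y : EuclideanSpace ℝ (Fin n)) :
    ⟪radial e F u, fderiv ℝ (fderiv ℝ F) u X Y⟫ =
      ⟪fderiv ℝ F u X, vertical n⟫ * ⟪fderiv ℝ F u Y, vertical n⟫ -
      ⟪fderiv ℝ F u X, fderiv ℝ F u Y⟫ -
      ⟪F u, e⟫ * ⟪fderiv ℝ (fderiv ℝ F) u X Y, e⟫ := by
  have h := hP.inner_fderiv_fderiv hu X Y
  rw [inner_radial]; linarith

theorem linearIndependent_pair_of_inner {X Y : EuclideanSpace ℝ (Fin n)}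
    {L : EuclideanSpace ℝ (Fin n) →L[ℝ] EAmb n} (hX : ⟪L X, L X⟫ ≠ 0) (hY : ⟪L Y, L Y⟫ ≠ 0)
    (hXY : ⟪L X, L Y⟫ = 0) : LinearIndependent ℝ ![X, Y] := by
  rw [LinearIndependent.pair_iff]
  intro s t hst
  have h0 : s • L X + t • L Y = 0 := by rw [← map_smul, ← map_smul, ← map_add, hst, map_zero]
  have h1 := congrArg (fun z => ⟪L X, z⟫) h0
  have h2 := congrArg (fun z => ⟪L Y, z⟫) h0
  simp only [inner_add_right, real_inner_smul_right, inner_zero_right, hXY, real_inner_comm (L X),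
    mul_zero, add_zero, zero_add] at h1 h2
  exact ⟨(mul_eq_zero.1 h1).resolve_right hX, (mul_eq_zero.1 h2).resolve_right hY⟩

/-- Off the axis the second fundamental form restricted to the directions orthogonal to the
meridian is umbilical, so the curvature of the tangent planes orthogonal to the meridian determines
the slope of the meridian. -/
theorem exists_slope (hn : 3 ≤ n) (hP : RotationPatch n e F U) (hK : HasCurvatureOn F U c)
    (hu : u ∈ U) (hpole : ⟪F u, e⟫ ^ 2 < 1) :
    ∃ A B : ℝ, 0 < A ^ 2 + B ^ 2 ∧ c * (A ^ 2 + (1 - ⟪F u, e⟫ ^ 2) * B ^ 2) = A ^ 2 + B ^ 2 ∧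
      (∃ T, ⟪fderiv ℝ F u T, e⟫ = A ∧ ⟪fderiv ℝ F u T, vertical n⟫ = B) ∧
      (∀ X, ∃ t, ⟪fderiv ℝ F u X, e⟫ = t * A ∧ ⟪fderiv ℝ F u X, vertical n⟫ = t * B) ∧
      -- where the axial coordinate `⟪F, e⟫` is constant, the hypersurface is locally a product
      ((∀ Y Z, ⟪fderiv ℝ F u Z, e⟫ = 0 ∧ ⟪fderiv ℝ (fderiv ℝ F) u Y Z, e⟫ = 0) → c = 0) := by
  set w := radial e F u with hw
  set a := ⟪F u, e⟫ with ha
  set D := fderiv ℝ F u with hDdef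
  set D2 := fderiv ℝ (fderiv ℝ F) u with hD2def
  have hww : ‖w‖ ^ 2 = 1 - a ^ 2 := hP.norm_sq_radial hu
  have hwpos : 0 < ‖w‖ ^ 2 := by rw [hww]; linarith
  have hw0 : w ≠ 0 := by
    intro h; rw [h] at hwpos; simp at hwpos
  have hV : Module.finrank ℝ (EAmb n) = n + 2 := by simp
  have hee := hP.inner_axis_self
  have hvv := inner_vertical_self n
  have hew : ⟪e, w⟫ = 0 := hP.inner_axis_radial u
  have hvw : ⟪vertical n, w⟫ = 0 := hP.inner_vertical_radial u
  have hwself : ⟪w, w⟫ = ‖w‖ ^ 2 := real_inner_self_eq_norm_sq w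
  obtain ⟨T, A, B, hAB, hT, hsurj, hdec⟩ := exists_meridian_direction hV hP.norm_axis
    (norm_vertical n) hw0 hP.axis_vertical hew hvw (hP.injective u hu) (hP.wedge u hu)
    (a := a) (fun X => hP.inner_radial_fderiv hu X)
  rw [← hDdef] at hT hsurj hdec
  obtain ⟨y, z, ⟨hey, hvy, hwy⟩, ⟨hez, hvz, hwz⟩, hyy, hzz, hyz⟩ := exists_orthonormal_parallel_pair
    hn hV hP.norm_axis (norm_vertical n) hw0 hP.axis_vertical hew hvw
  obtain ⟨X, hX⟩ := hsurj y hey hvy hwy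
  obtain ⟨Y, hY⟩ := hsurj z hez hvz hwz
  have hTe : ⟪D T, e⟫ = A := by
    rw [real_inner_comm, hT]
    simp only [inner_sub_right, inner_add_right, real_inner_smul_right, hee, hP.axis_vertical, hew]
    ring
  have hTv : ⟪D T, vertical n⟫ = B := by
    rw [real_inner_comm, hT]
    simp only [inner_sub_right, inner_add_right, real_inner_smul_right, hvv, hvw]
    rw [real_inner_comm, hP.axis_vertical]; ring
  have hTw : ⟪w, D T⟫ = -a * A := by
    have := hP.inner_radial_fderiv hu T
    rw [← hDdef, hTe] at this; exact this
  -- `⟪y, D T⟫` for `y` orthogonal to the axis and to the radial vector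
  have hTy : ∀ y, ⟪e, y⟫ = 0 → ⟪vertical n, y⟫ = 0 → ⟪w, y⟫ = 0 → ⟪D T, y⟫ = 0 := by
    intro y h1 h2 h3
    rw [hT]
    simp only [inner_sub_left, inner_add_left, real_inner_smul_left, h1, h2, h3]
    ring
  have hTT : ⟪D T, D T⟫ = A ^ 2 + B ^ 2 + a ^ 2 * A ^ 2 / ‖w‖ ^ 2 := by
    nth_rewrite 1 [hT]
    simp only [inner_sub_left, inner_add_left, real_inner_smul_left]
    rw [real_inner_comm, hTe, real_inner_comm, hTv, hTw]
    ring
  have hTTpos : 0 < ⟪D T, D T⟫ := by rw [hTT]; positivity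
  set N := w - (⟪w, D T⟫ / ⟪D T, D T⟫) • D T with hN
  have hNorth : ∀ Z, ⟪D Z, N⟫ = 0 := by
    intro Z
    obtain ⟨t, Z', rfl, h1, h2, h3⟩ := hdec Z
    have h4 : ⟪D Z', D T⟫ = 0 := by rw [real_inner_comm]; exact hTy _ h1 h2 h3
    rw [map_add, map_smul, inner_add_left, real_inner_smul_left, hN, inner_sub_right,
      inner_sub_right, real_inner_smul_right, real_inner_smul_right, h4, real_inner_comm, h3,
      real_inner_comm w (D T), div_mul_cancel₀ _ hTTpos.ne']
    ring
  have hNN : ⟪N, N⟫ = ‖w‖ ^ 2 - a ^ 2 * A ^ 2 / ⟪D T, D T⟫ := by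
    have h1 : ⟪N, N⟫ = ⟪w, N⟫ := by
      nth_rewrite 1 [hN]
      rw [inner_sub_left, real_inner_smul_left, hNorth, mul_zero, sub_zero]
    rw [h1, hN, inner_sub_right, real_inner_smul_right, hwself, hTw]
    ring
  -- umbilicity in the directions orthogonal to the meridian
  have hII : ∀ S R, (⟪e, D S⟫ = 0 ∧ ⟪vertical n, D S⟫ = 0) →
      (⟪e, D R⟫ = 0 ∧ ⟪vertical n, D R⟫ = 0) →
      ∃ p, D2 S R = D p + (-(⟪D S, D R⟫ / ‖w‖ ^ 2)) • N := by
    rintro S R ⟨h1, h2⟩ ⟨h3, h4⟩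
    have hwd := hP.wedge_fderiv hu R T S
    rw [← hDdef, ← hD2def, hTe, hTv, real_inner_comm e (D R), h3,
      real_inner_comm (vertical n) (D R), h4, zero_mul, mul_zero, add_zero, zero_add] at hwd
    set α := ⟪D2 S R, e⟫ with hα
    set β := ⟪D2 S R, vertical n⟫ with hβ
    set μ := (A * α + B * β) / (A ^ 2 + B ^ 2) with hμ
    have hμA : α = μ * A := by
      rw [hμ, div_mul_eq_mul_div, eq_div_iff hAB.ne']; linear_combination B * hwd
    have hμB : β = μ * B := by
      rw [hμ, div_mul_eq_mul_div, eq_div_iff hAB.ne']; linear_combination -A * hwd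
    have hrad := hP.inner_radial_fderiv_fderiv hu S R
    rw [← hDdef, ← hD2def, real_inner_comm (vertical n) (D S), h2, zero_mul, zero_sub,
      ← hα, ← ha, ← hw] at hrad
    obtain ⟨q, hq⟩ := hsurj (D2 S R - μ • D T + (⟪D S, D R⟫ / ‖w‖ ^ 2) • w)
      (by simp only [inner_sub_right, inner_add_right, real_inner_smul_right, hew]
          rw [real_inner_comm, ← hα, real_inner_comm, hTe]; linarith)
      (by simp only [inner_sub_right, inner_add_right, real_inner_smul_right, hvw]
          rw [real_inner_comm, ← hβ, real_inner_comm, hTv]; linarith)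
      (by simp only [inner_sub_right, inner_add_right, real_inner_smul_right, hrad, hTw, hwself]
          rw [hμA]; field_simp; ring)
    refine ⟨q + (μ - (⟪D S, D R⟫ / ‖w‖ ^ 2) * (⟪w, D T⟫ / ⟪D T, D T⟫)) • T, ?_⟩
    rw [map_add, map_smul, hq, hN]
    module
  have heX : ⟪e, D X⟫ = 0 ∧ ⟪vertical n, D X⟫ = 0 := by rw [hX]; exact ⟨hey, hvy⟩
  have heY : ⟪e, D Y⟫ = 0 ∧ ⟪vertical n, D Y⟫ = 0 := by rw [hY]; exact ⟨hez, hvz⟩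
  obtain ⟨p₁, hp₁⟩ := hII X X heX heX
  obtain ⟨p₂, hp₂⟩ := hII Y Y heY heY
  obtain ⟨p₃, hp₃⟩ := hII X Y heX heY
  have hperp : ∀ r : ℝ, ∀ Z, ⟪D Z, r • N⟫ = 0 := fun r Z => by
    rw [real_inner_smul_right, hNorth, mul_zero]
  refine ⟨A, B, hAB, ?_, ⟨T, hTe, hTv⟩, fun S => ?_, fun hflat => ?_⟩
  · have hg := gauss_equation hP.isOpen hP.smooth hP.injective hu hp₁ hp₂ hp₃ (hperp _) (hperp _)
    rw [← hDdef, hX, hY, hyy, hzz, hyz, hK u hu X Y (linearIndependent_pair_of_inner (L := D)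
      (by rw [hX, hyy]; exact one_ne_zero) (by rw [hY, hzz]; exact one_ne_zero)
      (by rw [hX, hY, hyz]))] at hg
    simp only [real_inner_smul_left, real_inner_smul_right, hNN, hTT] at hg
    have hS : ‖w‖ ^ 2 * (A ^ 2 + B ^ 2 + a ^ 2 * A ^ 2 / ‖w‖ ^ 2) =
        A ^ 2 + (1 - a ^ 2) * B ^ 2 := by
      rw [mul_add, mul_div_cancel₀ _ hwpos.ne', hww]; ring
    have hSpos : 0 < A ^ 2 + (1 - a ^ 2) * B ^ 2 := by
      rw [← hS]; rw [hTT] at hTTpos; positivity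
    have hS' : A ^ 2 + B ^ 2 + a ^ 2 * A ^ 2 / ‖w‖ ^ 2 =
        (A ^ 2 + (1 - a ^ 2) * B ^ 2) / ‖w‖ ^ 2 := by
      rw [← hS, mul_div_cancel_left₀ _ hwpos.ne']
    rw [hS', hww] at hg
    have hq : (1 - a ^ 2) ≠ 0 := by rw [← hww]; exact hwpos.ne'
    have hne := hSpos.ne'
    field_simp at hg
    have h3 : (1 - a ^ 2) * (c * (A ^ 2 + (1 - a ^ 2) * B ^ 2) - (A ^ 2 + B ^ 2)) = 0 := by
      linear_combination hg
    linarith [(mul_eq_zero.1 h3).resolve_left hq]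
  · obtain ⟨t, Z', rfl, h1, h2, -⟩ := hdec S
    refine ⟨t, ?_, ?_⟩
    · rw [map_add, map_smul, inner_add_left, real_inner_smul_left, hTe, real_inner_comm, h1,
        zero_add]
    · rw [map_add, map_smul, inner_add_left, real_inner_smul_left, hTv, real_inner_comm, h2,
        zero_add]
  · have hA0 : A = 0 := by rw [← hTe]; exact (hflat T T).1
    have hB0 : B ≠ 0 := by rintro rfl; simp [hA0] at hAB
    -- the second derivatives along the meridian are tangential
    have htan : ∀ R, ⟪D T, D R⟫ = B * ⟪D R, vertical n⟫ → ∃ p, D2 T R = D p + (0 : EAmb n) := by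
      intro R hR
      have hrad := hP.inner_radial_fderiv_fderiv hu T R
      rw [← hDdef, ← hD2def, hTv, hR, (hflat T R).2, ← hw] at hrad
      obtain ⟨q, hq⟩ := hsurj (D2 T R - (⟪D2 T R, vertical n⟫ / B) • D T)
        (by rw [inner_sub_right, real_inner_smul_right, real_inner_comm, (hflat T R).2,
              real_inner_comm (D T) e, hTe, hA0]; ring)
        (by rw [inner_sub_right, real_inner_smul_right, real_inner_comm,
              real_inner_comm (D T) (vertical n), hTv, div_mul_cancel₀ _ hB0, sub_self])
        (by rw [inner_sub_right, real_inner_smul_right, hrad, hTw, hA0]; ring)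
      refine ⟨q + (⟪D2 T R, vertical n⟫ / B) • T, ?_⟩
      rw [map_add, map_smul, hq]; module
    obtain ⟨q₁, hq₁⟩ := htan T (by rw [hTT, hTv, hA0]; ring)
    have hTX : ⟪D T, D X⟫ = 0 := by rw [hX]; exact hTy y hey hvy hwy
    obtain ⟨q₃, hq₃⟩ := htan X (by rw [hTX, real_inner_comm, heX.2, mul_zero])
    have hg := gauss_equation hP.isOpen hP.smooth hP.injective hu hq₁ hp₁ hq₃ (hperp _) (by simp)
    rw [hK u hu T X (linearIndependent_pair_of_inner (L := D) hTTpos.ne'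
      (by rw [hX, hyy]; exact one_ne_zero) hTX)] at hg
    simpa using hg

end RotationPatch

/-! ### Local shape of the meridian -/

namespace RotationPatch

variable {n : ℕ} {e : EAmb n} {F : EuclideanSpace ℝ (Fin n) → EAmb n}
  {U : Set (EuclideanSpace ℝ (Fin n))} {u : EuclideanSpace ℝ (Fin n)} {c : ℝ}

theorem fderiv_inner_eq_zero_of_const (hP : RotationPatch n e F U)
    {W : Set (EuclideanSpace ℝ (Fin n))} (hW : IsOpen W) (hWU : W ⊆ U) {y : EAmb n} {r : ℝ}
    (hr : ∀ x ∈ W, ⟪F x, y⟫ = r) (hu : u ∈ W) (X : EuclideanSpace ℝ (Fin n)) :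
    ⟪fderiv ℝ F u X, y⟫ = 0 := by
  have h1 : HasFDerivAt (fun _ : EuclideanSpace ℝ (Fin n) => r) _ u :=
    (hP.hasFDerivAt_inner (hWU hu) y).congr_of_eventuallyEq (by
      filter_upwards [hW.mem_nhds hu] with x hx using (hr x hx).symm)
  have h2 := congrArg (fun L => L X) (h1.unique (hasFDerivAt_const r u))
  simp at h2
  rw [real_inner_comm]; exact h2

theorem continuousOn_inner (hP : RotationPatch n e F U) (y : EAmb n) :
    ContinuousOn (fun x => ⟪F x, y⟫) U := fun _ hx =>
  (hP.hasFDerivAt_inner hx y).continuousAt.continuousWithinAt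

theorem continuousOn_inner_fderiv (hP : RotationPatch n e F U) (y : EAmb n)
    (X : EuclideanSpace ℝ (Fin n)) : ContinuousOn (fun x => ⟪fderiv ℝ F x X, y⟫) U := fun _ hx =>
  (hP.hasFDerivAt_inner_fderiv hx X y).continuousAt.continuousWithinAt

theorem inner_axis_sq_le_one (hP : RotationPatch n e F U) (hu : u ∈ U) : ⟪F u, e⟫ ^ 2 ≤ 1 := by
  have := hP.norm_sq_radial hu
  nlinarith [sq_nonneg ‖radial e F u‖]

theorem fderiv_axis_eq_zero_of_pole (hP : RotationPatch n e F U) (hu : u ∈ U)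
    (hpole : ⟪F u, e⟫ ^ 2 = 1) (X : EuclideanSpace ℝ (Fin n)) : ⟪fderiv ℝ F u X, e⟫ = 0 := by
  have h1 := hP.norm_sq_radial hu
  have h2 : radial e F u = 0 := by
    rw [hpole, sub_self] at h1
    simpa using h1
  have h3 := hP.inner_radial_fderiv hu X
  rw [h2, inner_zero_left] at h3
  have h4 : ⟪F u, e⟫ ≠ 0 := by intro h; rw [h] at hpole; norm_num at hpole
  have h5 : ⟪F u, e⟫ * ⟪fderiv ℝ F u X, e⟫ = 0 := by linarith
  exact (mul_eq_zero.1 h5).resolve_left h4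

/-- An immersed hypersurface meets the axis in a set without interior. -/
theorem exists_off_axis (hn : 3 ≤ n) (hP : RotationPatch n e F U)
    {W : Set (EuclideanSpace ℝ (Fin n))} (hW : IsOpen W) (hWU : W ⊆ U) (hne : W.Nonempty) :
    ∃ x ∈ W, ⟪F x, e⟫ ^ 2 < 1 := by
  by_contra! hcon
  obtain ⟨u, hu⟩ := hne
  have hpole : ∀ x ∈ W, ⟪F x, e⟫ ^ 2 = 1 := fun x hx =>
    le_antisymm (hP.inner_axis_sq_le_one (hWU hx)) (hcon x hx)
  have hF : ∀ x ∈ W, F x = ⟪F x, e⟫ • e + ⟪F x, vertical n⟫ • vertical n := by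
    intro x hx
    have h1 := hP.norm_sq_radial (hWU hx)
    rw [hpole x hx, sub_self] at h1
    have h2 : radial e F x = 0 := by simpa using h1
    rw [radial, sub_sub, sub_eq_zero] at h2
    exact h2
  have h1 : HasFDerivAt F _ u := (((hP.hasFDerivAt_inner (hWU hu) e).smul_const e).add
    ((hP.hasFDerivAt_inner (hWU hu) (vertical n)).smul_const (vertical n))).congr_of_eventuallyEq
    (by filter_upwards [hW.mem_nhds hu] with x hx using hF x hx)
  have h2 : ∀ X, fderiv ℝ F u X = ⟪fderiv ℝ F u X, vertical n⟫ • vertical n := by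
    intro X
    have h3 := congrArg (fun L => L X) ((hP.hasFDerivAt (hWU hu)).unique h1)
    simp at h3
    rw [real_inner_comm (fderiv ℝ F u X) e, hP.fderiv_axis_eq_zero_of_pole (hWU hu) (hpole u hu) X,
      zero_smul, zero_add, real_inner_comm (fderiv ℝ F u X)] at h3
    exact h3
  let L : EuclideanSpace ℝ (Fin n) →ₗ[ℝ] ℝ :=
    (innerₛₗ ℝ (vertical n)) ∘ₗ (fderiv ℝ F u : EuclideanSpace ℝ (Fin n) →ₗ[ℝ] EAmb n)
  have hL : Function.Injective L := by
    intro X Y hXY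
    apply hP.injective u (hWU hu)
    have h4 : ⟪fderiv ℝ F u X, vertical n⟫ = ⟪fderiv ℝ F u Y, vertical n⟫ := by
      simpa [L, real_inner_comm] using hXY
    rw [h2 X, h2 Y, h4]
  have := LinearMap.finrank_le_finrank_of_injective hL
  simp at this
  omega

/-- Where the coordinate along the axis is constant the curvature vanishes. -/
theorem curvature_eq_zero_of_fderiv_axis_eq_zero (hn : 3 ≤ n) (hP : RotationPatch n e F U)
    (hK : HasCurvatureOn F U c) {W : Set (EuclideanSpace ℝ (Fin n))} (hW : IsOpen W) (hWU : W ⊆ U)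
    (hne : W.Nonempty) (hconst : ∀ x ∈ W, ∀ X, ⟪fderiv ℝ F x X, e⟫ = 0) : c = 0 := by
  obtain ⟨u, hu, hpole⟩ := hP.exists_off_axis hn hW hWU hne
  obtain ⟨A, B, -, -, -, -, h⟩ := hP.exists_slope hn hK (hWU hu) hpole
  refine h fun Y Z => ⟨hconst u hu Z, ?_⟩
  have h1 : HasFDerivAt (fun _ : EuclideanSpace ℝ (Fin n) => (0 : ℝ)) _ u :=
    (hP.hasFDerivAt_inner_fderiv (hWU hu) Z e).congr_of_eventuallyEq (by
      filter_upwards [hW.mem_nhds hu] with x hx using (hconst x hx Z).symm)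
  have h2 := congrArg (fun L => L Y) (h1.unique (hasFDerivAt_const (0 : ℝ) u))
  simp at h2
  rw [real_inner_comm]; exact h2

theorem one_le_curvature (hn : 3 ≤ n) (hP : RotationPatch n e F U) (hK : HasCurvatureOn F U c)
    (hne : U.Nonempty) : 1 ≤ c := by
  obtain ⟨u, hu, hpole⟩ := hP.exists_off_axis hn hP.isOpen le_rfl hne
  obtain ⟨A, B, hAB, h, -⟩ := hP.exists_slope hn hK hu hpole
  have h1 : A ^ 2 + (1 - ⟪F u, e⟫ ^ 2) * B ^ 2 ≤ A ^ 2 + B ^ 2 := by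
    nlinarith [sq_nonneg (⟪F u, e⟫ * B)]
  have h2 : 0 ≤ A ^ 2 + (1 - ⟪F u, e⟫ ^ 2) * B ^ 2 := by
    have : 0 ≤ 1 - ⟪F u, e⟫ ^ 2 := by linarith
    positivity
  have h3 : 0 < A ^ 2 + (1 - ⟪F u, e⟫ ^ 2) * B ^ 2 := by
    refine lt_of_le_of_ne h2 fun h0 => ?_
    rw [← h0, mul_zero] at h
    linarith
  by_contra! hc
  linarith [mul_lt_mul_of_pos_right hc h3]

/-- The differential equation of the meridian: for a meridian `(a, h)` in terms of arc length it
says `(c - 1) a'² = (1 - c + c a²) h'²`. It extends to the axis by continuity. -/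
theorem meridian_equation (hn : 3 ≤ n) (hP : RotationPatch n e F U) (hK : HasCurvatureOn F U c)
    (hu : u ∈ U) (X : EuclideanSpace ℝ (Fin n)) :
    (c - 1) * ⟪fderiv ℝ F u X, e⟫ ^ 2 =
      (1 - c + c * ⟪F u, e⟫ ^ 2) * ⟪fderiv ℝ F u X, vertical n⟫ ^ 2 := by
  by_contra hcon
  set G : EuclideanSpace ℝ (Fin n) → ℝ := fun x => (c - 1) * ⟪fderiv ℝ F x X, e⟫ ^ 2 -
      (1 - c + c * ⟪F x, e⟫ ^ 2) * ⟪fderiv ℝ F x X, vertical n⟫ ^ 2 with hG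
  have hGc : ContinuousOn G U := by
    have h1 := hP.continuousOn_inner e
    have h2 := hP.continuousOn_inner_fderiv e X
    have h3 := hP.continuousOn_inner_fderiv (vertical n) X
    exact (continuousOn_const.mul (h2.pow 2)).sub
      ((continuousOn_const.add (continuousOn_const.mul (h1.pow 2))).mul (h3.pow 2))
  have hopen : IsOpen (U ∩ G ⁻¹' {0}ᶜ) := hGc.isOpen_inter_preimage hP.isOpen isOpen_compl_singleton
  obtain ⟨x, ⟨hxU, hxG⟩, hpole⟩ := hP.exists_off_axis hn hopen inter_subset_left
    ⟨u, hu, fun h => hcon (sub_eq_zero.1 h)⟩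
  obtain ⟨A, B, -, h, -, ht, -⟩ := hP.exists_slope hn hK hxU hpole
  obtain ⟨t, h1, h2⟩ := ht X
  apply hxG
  simp only [hG, mem_singleton_iff, h1, h2]
  linear_combination t ^ 2 * h

theorem fderiv_height_eq_zero (hn : 3 ≤ n) (hP : RotationPatch n e F U)
    (hK : HasCurvatureOn F U 1) (hu : u ∈ U) (X : EuclideanSpace ℝ (Fin n)) :
    ⟪fderiv ℝ F u X, vertical n⟫ = 0 := by
  by_contra hcon
  have hopen : IsOpen (U ∩ (fun x => ⟪fderiv ℝ F x X, vertical n⟫) ⁻¹' {0}ᶜ) :=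
    (hP.continuousOn_inner_fderiv (vertical n) X).isOpen_inter_preimage hP.isOpen
      isOpen_compl_singleton
  have h0 : ∀ x ∈ U ∩ (fun x => ⟪fderiv ℝ F x X, vertical n⟫) ⁻¹' {0}ᶜ, ⟪F x, e⟫ = 0 := by
    rintro x ⟨hxU, hx⟩
    have h1 := hP.meridian_equation hn hK hxU X
    have h2 : ⟪F x, e⟫ ^ 2 * ⟪fderiv ℝ F x X, vertical n⟫ ^ 2 = 0 := by linarith
    simpa using (mul_eq_zero.1 h2).resolve_right (pow_ne_zero 2 hx)
  have := hP.curvature_eq_zero_of_fderiv_axis_eq_zero hn hK hopen inter_subset_left ⟨u, hu, hcon⟩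
    fun x hx Y => hP.fderiv_inner_eq_zero_of_const hopen inter_subset_left h0 hx Y
  norm_num at this

theorem exists_fderiv_height_ne_zero (hn : 3 ≤ n) (hP : RotationPatch n e F U)
    (hK : HasCurvatureOn F U c) (hc : 1 < c) (hu : u ∈ U) (hpole : ⟪F u, e⟫ ^ 2 < 1) :
    ∃ X, ⟪fderiv ℝ F u X, vertical n⟫ ≠ 0 := by
  obtain ⟨A, B, hAB, -, ⟨T, hA, hB⟩, -⟩ := hP.exists_slope hn hK hu hpole
  refine ⟨T, fun h => ?_⟩
  have h1 := hP.meridian_equation hn hK hu T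
  rw [h, hA] at h1
  have h2 : A ^ 2 = 0 := by
    have : (c - 1) * A ^ 2 = 0 := by linarith
    exact (mul_eq_zero.1 this).resolve_left (by linarith)
  rw [h2, ← hB, h] at hAB
  norm_num at hAB

theorem le_inner_axis_sq (hn : 3 ≤ n) (hP : RotationPatch n e F U)
    (hK : HasCurvatureOn F U c) (hc : 1 < c) (hu : u ∈ U) : c - 1 ≤ c * ⟪F u, e⟫ ^ 2 := by
  rcases (hP.inner_axis_sq_le_one hu).lt_or_eq with hpole | hpole
  · obtain ⟨X, hX⟩ := hP.exists_fderiv_height_ne_zero hn hK hc hu hpole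
    have h1 := hP.meridian_equation hn hK hu X
    have h2 : 0 < ⟪fderiv ℝ F u X, vertical n⟫ ^ 2 := by positivity
    by_contra! h3
    nlinarith [sq_nonneg ⟪fderiv ℝ F u X, e⟫]
  · rw [hpole]; linarith

/-- The height function is not constant on any open set. -/
theorem height_frequently_ne (hn : 3 ≤ n) (hP : RotationPatch n e F U)
    (hK : HasCurvatureOn F U c) (hc : 1 < c) (hu : u ∈ U) (r : ℝ) :
    ∃ᶠ x in 𝓝 u, ⟪F x, vertical n⟫ ≠ r := by
  intro hcon
  simp only [not_not] at hcon
  obtain ⟨W, hWr, hW, huW⟩ := mem_nhds_iff.1 (hcon.and (hP.isOpen.mem_nhds hu))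
  obtain ⟨x, hx, hpole⟩ := hP.exists_off_axis hn hW (fun x hx => (hWr hx).2) ⟨u, huW⟩
  obtain ⟨X, hX⟩ := hP.exists_fderiv_height_ne_zero hn hK hc (hWr hx).2 hpole
  exact hX (hP.fderiv_inner_eq_zero_of_const hW (fun x hx => (hWr hx).2)
    (fun x hx => (hWr hx).1) hx X)

end RotationPatch

/-- The catenary `a = κ cosh ((h - t) / κ)`, `κ² = (c - 1) / c`, with parameter `t`: the meridian of
a rotation hypersurface of constant curvature `c > 1`. -/
noncomputable def catenary (c t h : ℝ) : ℝ :=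
  √((c - 1) / c) * Real.cosh ((h - t) / √((c - 1) / c))

theorem continuous_catenary (c t : ℝ) : Continuous (catenary c t) := by
  unfold catenary; fun_prop

theorem catenary_modulus_pos {c : ℝ} (hc : 1 < c) : 0 < √((c - 1) / c) :=
  Real.sqrt_pos.2 (div_pos (by linarith) (by linarith))

theorem catenary_modulus_sq {c : ℝ} (hc : 1 < c) : √((c - 1) / c) ^ 2 = (c - 1) / c :=
  Real.sq_sqrt (div_pos (by linarith) (by linarith)).le

/-- If two catenaries agree along a height function that is not locally constant, they coincide. -/
theorem catenary_unique {X : Type*} [TopologicalSpace X] {h : X → ℝ} {x : X} {c t t' : ℝ}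
    (hc : 1 < c) (hh : ∀ r, ∃ᶠ y in 𝓝 x, h y ≠ r)
    (heq : ∀ᶠ y in 𝓝 x, catenary c t (h y) = catenary c t' (h y)) : t = t' := by
  by_contra hne
  apply hh ((t + t') / 2)
  filter_upwards [heq] with y hy
  have hκ := catenary_modulus_pos hc
  have h1 := mul_left_cancel₀ hκ.ne' hy
  have h2 : |(h y - t) / √((c - 1) / c)| = |(h y - t') / √((c - 1) / c)| :=
    le_antisymm (Real.cosh_le_cosh.1 h1.le) (Real.cosh_le_cosh.1 h1.ge)
  rcases abs_eq_abs.1 h2 with h3 | h3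
  · have := (div_left_inj' hκ.ne').1 h3
    exact absurd (by linarith) hne
  · rw [← neg_div] at h3
    have := (div_left_inj' hκ.ne').1 h3
    rw [not_not]; linarith

/-- If a pair of functions lies locally on catenaries, it lies on one of them on each connected
set. -/
theorem exists_catenary_of_locally {X : Type*} [TopologicalSpace X] {a h : X → ℝ} {S : Set X}
    {c : ℝ} (hc : 1 < c) (hS : IsPreconnected S) (hne : S.Nonempty)
    (hh : ∀ x ∈ S, ∀ r, ∃ᶠ y in 𝓝 x, h y ≠ r)
    (hloc : ∀ x ∈ S, ∃ t, ∀ᶠ y in 𝓝 x, a y = catenary c t (h y)) :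
    ∃ t, ∀ x ∈ S, a x = catenary c t (h x) := by
  have huniq : ∀ x ∈ S, ∀ t t', (∀ᶠ y in 𝓝 x, a y = catenary c t (h y)) →
      (∀ᶠ y in 𝓝 x, a y = catenary c t' (h y)) → t = t' := by
    intro x hx t t' h1 h2
    refine catenary_unique hc (hh x hx) ?_
    filter_upwards [h1, h2] with y hy1 hy2
    rw [← hy1, hy2]
  obtain ⟨x₀, hx₀⟩ := hne
  obtain ⟨t, ht⟩ := hloc x₀ hx₀
  refine ⟨t, fun x hx => ?_⟩
  have key : (∀ᶠ y in 𝓝 x₀, a y = catenary c t (h y)) ↔ ∀ᶠ y in 𝓝 x, a y = catenary c t (h y) := by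
    refine hS.induction₂ (fun x y => (∀ᶠ z in 𝓝 x, a z = catenary c t (h z)) ↔
      ∀ᶠ z in 𝓝 y, a z = catenary c t (h z)) ?_ ?_ ?_ hx₀ hx
    · intro y hy
      obtain ⟨t', ht'⟩ := hloc y hy
      filter_upwards [mem_nhdsWithin_of_mem_nhds ht'.eventually_nhds, self_mem_nhdsWithin]
        with z hz hzS
      constructor
      · intro h1
        rw [huniq y hy t t' h1 ht']; exact hz
      · intro h1
        rw [huniq z hzS t t' h1 hz]; exact ht'
    · intro x y z _ _ _ h1 h2; exact h1.trans h2
    · intro x y _ _ h1; exact h1.symm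
  exact (key.1 ht).self_of_nhds

theorem isConnected_punctured_ball {E : Type*} [NormedAddCommGroup E] [InnerProductSpace ℝ E]
    (hE : 1 < Module.rank ℝ E) (x : E) {r : ℝ} (hr : 0 < r) :
    IsConnected (Metric.ball x r \ {x}) := by
  have h1 := (isConnected_compl_singleton_of_one_lt_rank hE (0 : E)).image
    (OpenPartialHomeomorph.univBall x r)
    (OpenPartialHomeomorph.continuous_univBall x r).continuousOn
  convert h1 using 1
  set φ := OpenPartialHomeomorph.univBall (P := E) x r with hφ
  have hs : φ.source = univ := OpenPartialHomeomorph.univBall_source x r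
  have ht : φ.target = Metric.ball x r := OpenPartialHomeomorph.univBall_target x hr
  have h0 : φ 0 = x := OpenPartialHomeomorph.univBall_apply_zero x r
  ext y
  constructor
  · rintro ⟨hy, hyx⟩
    rw [← ht] at hy
    refine ⟨φ.symm y, fun h => hyx ?_, φ.right_inv hy⟩
    rw [mem_singleton_iff] at h
    rw [mem_singleton_iff, ← h0, ← h, φ.right_inv hy]
  · rintro ⟨z, hz, rfl⟩
    refine ⟨ht ▸ φ.map_source (hs ▸ mem_univ z), fun h => hz ?_⟩
    rw [mem_singleton_iff, ← h0] at h
    exact φ.injOn (hs ▸ mem_univ z) (hs ▸ mem_univ 0) h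

theorem catenary_of_exp {c s₁ s₂ a h : ℝ} (hc : 1 < c)
    (hs : s₁ * s₂ = √((c - 1) / c) ^ 2) (hs₁ : 0 < s₁)
    (ha : a = (s₁ * Real.exp (h / √((c - 1) / c)) + s₂ * Real.exp (-(h / √((c - 1) / c)))) / 2) :
    a = catenary c (-√((c - 1) / c) * Real.log (s₁ / √((c - 1) / c))) h := by
  have hκ := catenary_modulus_pos hc
  set κ := √((c - 1) / c)
  unfold catenary
  rw [Real.cosh_eq, ha]
  have h1 : (h - -κ * Real.log (s₁ / κ)) / κ = h / κ + Real.log (s₁ / κ) := by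
    field_simp; ring
  have h2 : s₂ = κ ^ 2 / s₁ := by rw [← hs]; field_simp
  change _ = κ * ((Real.exp ((h - -κ * Real.log (s₁ / κ)) / κ) +
    Real.exp (-((h - -κ * Real.log (s₁ / κ)) / κ))) / 2)
  rw [h1, neg_add, Real.exp_add, Real.exp_add, Real.exp_neg (Real.log _),
    Real.exp_log (div_pos hs₁ hκ), h2]
  field_simp

namespace RotationPatch

variable {n : ℕ} {e : EAmb n} {F : EuclideanSpace ℝ (Fin n) → EAmb n}
  {U : Set (EuclideanSpace ℝ (Fin n))} {u : EuclideanSpace ℝ (Fin n)} {c : ℝ}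

/-- Off the axis the meridian lies locally on a catenary: with the slope `A = da/dh`, both
`(a + κ A) exp (-h/κ)` and `(a - κ A) exp (h/κ)` are constant. -/
theorem exists_catenary_off_axis (hn : 3 ≤ n) (hP : RotationPatch n e F U)
    (hK : HasCurvatureOn F U c) (hc : 1 < c) (hpos : ∀ x ∈ U, 0 < ⟪F x, e⟫) (hu : u ∈ U)
    (hpole : ⟪F u, e⟫ ^ 2 < 1) :
    ∃ t, ∀ᶠ x in 𝓝 u, ⟪F x, e⟫ = catenary c t ⟪F x, vertical n⟫ := by
  have hκ := catenary_modulus_pos hc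
  have hκ2 := catenary_modulus_sq hc
  set κ := √((c - 1) / c) with hκdef
  have hc0 : 0 < c := by linarith
  obtain ⟨Z, hZ⟩ := hP.exists_fderiv_height_ne_zero hn hK hc hu hpole
  have hopen : IsOpen (U ∩ (fun x => ⟪fderiv ℝ F x Z, vertical n⟫) ⁻¹' {0}ᶜ) :=
    (hP.continuousOn_inner_fderiv (vertical n) Z).isOpen_inter_preimage hP.isOpen
      isOpen_compl_singleton
  obtain ⟨r, hr, hball⟩ := Metric.isOpen_iff.1 hopen u ⟨hu, hZ⟩
  set W := Metric.ball u r with hW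
  have hWo : IsOpen W := Metric.isOpen_ball
  have hWU : W ⊆ U := fun x hx => (hball hx).1
  have hWZ : ∀ x ∈ W, ⟪fderiv ℝ F x Z, vertical n⟫ ≠ 0 := fun x hx => (hball hx).2
  set A : EuclideanSpace ℝ (Fin n) → ℝ := fun x =>
    ⟪fderiv ℝ F x Z, e⟫ / ⟪fderiv ℝ F x Z, vertical n⟫ with hA
  have hAX : ∀ x ∈ W, ∀ X, ⟪fderiv ℝ F x X, e⟫ = A x * ⟪fderiv ℝ F x X, vertical n⟫ := by
    intro x hx X
    have h1 := hP.wedge x (hWU hx) X Z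
    have h2 := hWZ x hx
    rw [hA]
    field_simp
    linarith
  have hAsq : ∀ x ∈ W, κ ^ 2 * A x ^ 2 = ⟪F x, e⟫ ^ 2 - κ ^ 2 := by
    intro x hx
    have h1 := hP.meridian_equation hn hK (hWU hx) Z
    have h2 := hWZ x hx
    rw [hAX x hx Z, mul_pow, ← mul_assoc] at h1
    have h3 := mul_right_cancel₀ (pow_ne_zero 2 h2) h1
    rw [hκ2]
    field_simp
    linarith
  have hF1 := (contDiffOn_fderiv_of_smooth hP.isOpen hP.smooth).mono hWU
  have hsm : ∀ y : EAmb n, ContDiffOn ℝ ∞ (fun x => ⟪fderiv ℝ F x Z, y⟫) W := fun y =>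
    (hF1.clm_apply contDiffOn_const).inner ℝ contDiffOn_const
  have hAsm : ContDiffOn ℝ ∞ A W := (hsm e).div (hsm (vertical n)) hWZ
  have hAd : ∀ x ∈ W, HasFDerivAt A (fderiv ℝ A x) x := fun x hx =>
    (differentiableAt_of_smooth hWo hAsm hx).hasFDerivAt
  have had : ∀ x ∈ W, ∀ y, HasFDerivAt (fun x => ⟪F x, y⟫) ((innerSL ℝ y).comp (fderiv ℝ F x)) x :=
    fun x hx y => hP.hasFDerivAt_inner (hWU hx) y
  -- differentiating `κ² A² = a² - κ²` gives `κ² dA = a dh` where `A ≠ 0`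
  have hdA' : ∀ x ∈ W, ∀ X, A x * (κ ^ 2 * fderiv ℝ A x X -
      ⟪F x, e⟫ * ⟪fderiv ℝ F x X, vertical n⟫) = 0 := by
    intro x hx X
    have h1 := ((hAd x hx).pow 2).const_mul (κ ^ 2)
    have h2 := ((had x hx e).pow 2).sub_const (κ ^ 2)
    have h3 := h1.congr_of_eventuallyEq (f₁ := fun x => ⟪F x, e⟫ ^ 2 - κ ^ 2) (by
      filter_upwards [hWo.mem_nhds hx] with y hy using (hAsq y hy).symm)
    have h4 := congrArg (fun L => L X) (h3.unique h2)
    simp at h4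
    rw [real_inner_comm (fderiv ℝ F x X) e, hAX x hx X] at h4
    linarith
  -- and the zeros of `A` have empty interior because the curvature is not zero
  have hdA : ∀ x ∈ W, ∀ X, κ ^ 2 * fderiv ℝ A x X = ⟪F x, e⟫ * ⟪fderiv ℝ F x X, vertical n⟫ := by
    intro x hx X
    by_contra hcon
    set G : EuclideanSpace ℝ (Fin n) → ℝ := fun x => κ ^ 2 * fderiv ℝ A x X -
      ⟪F x, e⟫ * ⟪fderiv ℝ F x X, vertical n⟫ with hG
    have hGc : ContinuousOn G W := by
      have h1 := (contDiffOn_fderiv_of_smooth hWo hAsm).continuousOn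
      exact (continuousOn_const.mul (h1.clm_apply continuousOn_const)).sub
        (((hP.continuousOn_inner e).mono hWU).mul
          ((hP.continuousOn_inner_fderiv (vertical n) X).mono hWU))
    have ho : IsOpen (W ∩ G ⁻¹' {0}ᶜ) := hGc.isOpen_inter_preimage hWo isOpen_compl_singleton
    have := hP.curvature_eq_zero_of_fderiv_axis_eq_zero hn hK ho
      (inter_subset_left.trans hWU) ⟨x, hx, fun h => hcon (sub_eq_zero.1 h)⟩ (by
        rintro y ⟨hy, hyG⟩ Y
        rw [hAX y hy Y, (mul_eq_zero.1 (hdA' y hy X)).resolve_right hyG, zero_mul])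
    linarith
  have hfirst : ∀ σ : ℝ, σ ^ 2 = 1 → ∀ x ∈ W, HasFDerivAt (fun x => (⟪F x, e⟫ + σ * κ * A x) *
      Real.exp (-(σ * (⟪F x, vertical n⟫ / κ))))
      (0 : EuclideanSpace ℝ (Fin n) →L[ℝ] ℝ) x := by
    intro σ hσ x hx
    have h1 := ((had x hx e).add ((hAd x hx).const_mul (σ * κ))).mul
      ((((had x hx (vertical n)).mul_const (κ⁻¹)).const_mul σ).neg.exp)
    refine (h1.congr_fderiv ?_).congr_of_eventuallyEq (Eventually.of_forall fun y => by
      simp [div_eq_mul_inv])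
    ext X
    have h2 := hdA x hx X
    have h3 := hAX x hx X
    have h4 : fderiv ℝ A x X = ⟪F x, e⟫ * ⟪fderiv ℝ F x X, vertical n⟫ / κ ^ 2 := by
      rw [← h2]; field_simp
    simp
    rw [real_inner_comm (fderiv ℝ F x X) e, real_inner_comm (fderiv ℝ F x X) (vertical n), h3, h4]
    generalize Real.exp _ = E
    field_simp
    linear_combination (-(E * A x * κ * ⟪fderiv ℝ F x X, vertical n⟫)) * hσ
  have hconst : ∀ σ : ℝ, σ ^ 2 = 1 → ∃ s, ∀ x ∈ W, (⟪F x, e⟫ + σ * κ * A x) *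
      Real.exp (-(σ * (⟪F x, vertical n⟫ / κ))) = s := fun σ hσ =>
    hWo.exists_is_const_of_fderiv_eq_zero Metric.isPreconnected_ball
      (fun x hx => (hfirst σ hσ x hx).differentiableAt.differentiableWithinAt)
      (fun x hx => (hfirst σ hσ x hx).fderiv)
  obtain ⟨s₁, h₁⟩ := hconst 1 (by norm_num)
  obtain ⟨s₂, h₂⟩ := hconst (-1) (by norm_num)
  have hprod : s₁ * s₂ = κ ^ 2 := by
    rw [← h₁ u (Metric.mem_ball_self hr), ← h₂ u (Metric.mem_ball_self hr), mul_mul_mul_comm,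
      ← Real.exp_add]
    have := hAsq u (Metric.mem_ball_self hr)
    rw [show -(1 * (⟪F u, vertical n⟫ / κ)) + -(-1 * (⟪F u, vertical n⟫ / κ)) = 0 by ring,
      Real.exp_zero]
    linarith
  have hsum : ∀ x ∈ W, ⟪F x, e⟫ = (s₁ * Real.exp (⟪F x, vertical n⟫ / κ) +
      s₂ * Real.exp (-(⟪F x, vertical n⟫ / κ))) / 2 := by
    intro x hx
    have e₁ : Real.exp (-(1 * (⟪F x, vertical n⟫ / κ))) * Real.exp (⟪F x, vertical n⟫ / κ) = 1 := by
      rw [← Real.exp_add, one_mul, neg_add_cancel, Real.exp_zero]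
    have e₂ : Real.exp (-(-1 * (⟪F x, vertical n⟫ / κ))) *
        Real.exp (-(⟪F x, vertical n⟫ / κ)) = 1 := by
      rw [← Real.exp_add, neg_one_mul, neg_neg, add_neg_cancel, Real.exp_zero]
    rw [← h₁ x hx, ← h₂ x hx]
    linear_combination -(⟪F x, e⟫ + κ * A x) / 2 * e₁ - (⟪F x, e⟫ - κ * A x) / 2 * e₂
  have hs₁ : 0 < s₁ := by
    by_contra! hs
    have hs₂ : s₂ ≤ 0 := by
      by_contra! h
      nlinarith [pow_pos hκ 2]
    have h3 := hsum u (Metric.mem_ball_self hr)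
    have h4 := hpos u hu
    have h5 := mul_nonpos_of_nonpos_of_nonneg hs (Real.exp_pos (⟪F u, vertical n⟫ / κ)).le
    have h6 := mul_nonpos_of_nonpos_of_nonneg hs₂ (Real.exp_pos (-(⟪F u, vertical n⟫ / κ))).le
    linarith
  refine ⟨-κ * Real.log (s₁ / κ), ?_⟩
  filter_upwards [hWo.mem_nhds (Metric.mem_ball_self hr)] with x hx
  exact catenary_of_exp hc hprod hs₁ (hsum x hx)

/-- Around a point on the axis the hypersurface meets the axis only there, so the punctured
neighbourhood is connected and its meridian lies on one catenary. -/
theorem exists_catenary (hn : 3 ≤ n) (hP : RotationPatch n e F U)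
    (hK : HasCurvatureOn F U c) (hc : 1 < c) (hpos : ∀ x ∈ U, 0 < ⟪F x, e⟫) (hu : u ∈ U) :
    ∃ t, ∀ᶠ x in 𝓝 u, ⟪F x, e⟫ = catenary c t ⟪F x, vertical n⟫ := by
  rcases (hP.inner_axis_sq_le_one hu).lt_or_eq with hpole | hpole
  · exact hP.exists_catenary_off_axis hn hK hc hpos hu hpole
  have hde := hP.fderiv_axis_eq_zero_of_pole hu hpole
  have hdv : ∀ X, ⟪fderiv ℝ F u X, vertical n⟫ = 0 := by
    intro X
    have h1 := hP.meridian_equation hn hK hu X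
    rw [hde X, hpole] at h1
    have : ⟪fderiv ℝ F u X, vertical n⟫ ^ 2 = 0 := by linarith
    simpa using this
  -- the radial vector has the same injective differential as `F`, so `u` is an isolated zero of it
  have hrad : HasFDerivAt (radial e F) (fderiv ℝ F u) u := by
    have h1 := ((hP.hasFDerivAt hu).sub ((hP.hasFDerivAt_inner hu e).smul_const e)).sub
      ((hP.hasFDerivAt_inner hu (vertical n)).smul_const (vertical n))
    refine h1.congr_fderiv ?_
    ext1 X
    simp
    rw [real_inner_comm (fderiv ℝ F u X) e, hde, real_inner_comm (fderiv ℝ F u X), hdv]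
    simp
  obtain ⟨K, -, hanti⟩ := ((fderiv ℝ F u : EuclideanSpace ℝ (Fin n) →L[ℝ] EAmb n) :
    EuclideanSpace ℝ (Fin n) →ₗ[ℝ] EAmb n).injective_iff_antilipschitz.1 (hP.injective u hu)
  have hiso : ∀ᶠ x in 𝓝[≠] u, radial e F x ≠ 0 := hrad.eventually_ne ⟨K, hanti⟩
  rw [eventually_nhdsWithin_iff] at hiso
  obtain ⟨r, hr, hball⟩ := Metric.mem_nhds_iff.1 (hiso.and (hP.isOpen.mem_nhds hu))
  set S := Metric.ball u r \ {u} with hS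
  have hSU : S ⊆ U := fun x hx => (hball hx.1).2
  have hconn : IsConnected S := isConnected_punctured_ball (by
    rw [← Module.finrank_eq_rank]; simp; omega) u hr
  obtain ⟨t, ht⟩ := exists_catenary_of_locally (a := fun x => ⟪F x, e⟫)
    (h := fun x => ⟪F x, vertical n⟫) hc hconn.isPreconnected hconn.nonempty
    (fun x hx r => hP.height_frequently_ne hn hK hc (hSU hx) r)
    (fun x hx => hP.exists_catenary_off_axis hn hK hc hpos (hSU hx) (by
      have h1 := hP.norm_sq_radial (hSU hx)
      have h2 : 0 < ‖radial e F x‖ := norm_pos_iff.2 ((hball hx.1).1 hx.2)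
      nlinarith [pow_pos h2 2]))
  refine ⟨t, ?_⟩
  have hcl : ⟪F u, e⟫ = catenary c t ⟪F u, vertical n⟫ := by
    have h1 : ContinuousAt (fun x => ⟪F x, e⟫ - catenary c t ⟪F x, vertical n⟫) u :=
      (hP.hasFDerivAt_inner hu e).continuousAt.sub ((continuous_catenary c t).continuousAt.comp
        (hP.hasFDerivAt_inner hu (vertical n)).continuousAt)
    have : (𝓝[S] u).NeBot := by
      have h2 : 𝓝[S] u = 𝓝[≠] u := by
        rw [hS, sdiff_eq, nhdsWithin_inter', nhdsWithin_eq_nhds.2 (Metric.ball_mem_nhds u hr)]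
        rfl
      rw [h2]
      have : Nontrivial (EuclideanSpace ℝ (Fin n)) :=
        Module.nontrivial_of_finrank_pos (R := ℝ) (by simp; omega)
      exact Module.punctured_nhds_neBot ℝ _ u
    have h3 := tendsto_nhds_unique (f := fun x => ⟪F x, e⟫ - catenary c t ⟪F x, vertical n⟫)
      (h1.tendsto.mono_left nhdsWithin_le_nhds) (tendsto_const_nhds.congr' (by
        filter_upwards [self_mem_nhdsWithin] with x hx
        exact (sub_eq_zero.2 (ht x hx)).symm) : Tendsto _ (𝓝[S] u) (𝓝 (0 : ℝ)))
    exact sub_eq_zero.1 h3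
  filter_upwards [Metric.ball_mem_nhds u hr] with x hx
  by_cases hxu : x = u
  · rw [hxu]; exact hcl
  · exact ht x ⟨hx, hxu⟩

end RotationPatch

/-! ### Immersions into a level set are open -/

theorem HasStrictFDerivAt.exists_injOn_nhds {E V : Type*} [NormedAddCommGroup E] [NormedSpace ℝ E]
    [FiniteDimensional ℝ E] [NormedAddCommGroup V] [NormedSpace ℝ V] {G : E → V} {L : E →L[ℝ] V}
    {x : E} (hG : HasStrictFDerivAt G L x) (hL : Function.Injective L) :
    ∃ O ∈ 𝓝 x, InjOn G O := by
  obtain ⟨K, hK, hanti⟩ := (L : E →ₗ[ℝ] V).injective_iff_antilipschitz.1 hL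
  have h1 := hG.isLittleO.def (c := (2 * (K : ℝ))⁻¹) (by positivity)
  rw [nhds_prod_eq] at h1
  obtain ⟨O, hO, h2⟩ := mem_prod_same_iff.1 h1
  refine ⟨O, hO, fun p hp q hq hpq => ?_⟩
  have h3 : ‖G p - G q - L (p - q)‖ ≤ (2 * (K : ℝ))⁻¹ * ‖p - q‖ := h2 (mk_mem_prod hp hq)
  rw [hpq, sub_self, zero_sub, norm_neg] at h3
  have h4 : ‖p - q‖ ≤ K * ‖L (p - q)‖ := by
    simpa using hanti.le_mul_dist (p - q) 0
  have hK' : (0 : ℝ) < K := hK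
  have h5 : K * ‖L (p - q)‖ ≤ K * ((2 * (K : ℝ))⁻¹ * ‖p - q‖) := by gcongr
  have h6 : K * ((2 * (K : ℝ))⁻¹ * ‖p - q‖) = ‖p - q‖ / 2 := by field_simp
  have h7 : ‖p - q‖ = 0 := by linarith [norm_nonneg (p - q)]
  exact sub_eq_zero.1 (norm_eq_zero.1 h7)

/-- An immersion into a regular level set of the same dimension maps neighbourhoods onto relative
neighbourhoods. -/
theorem image_mem_nhdsWithin_level {E V W : Type*} [NormedAddCommGroup E] [NormedSpace ℝ E]
    [FiniteDimensional ℝ E] [NormedAddCommGroup V] [NormedSpace ℝ V] [FiniteDimensional ℝ V]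
    [NormedAddCommGroup W] [NormedSpace ℝ W] [FiniteDimensional ℝ W]
    (hdim : Module.finrank ℝ V = Module.finrank ℝ E + Module.finrank ℝ W)
    {F : E → V} {D : E →L[ℝ] V} {Ψ : V → W} {L : V →L[ℝ] W} {u : E} {r : W}
    (hF : HasStrictFDerivAt F D u) (hD : Function.Injective D)
    (hΨ : HasStrictFDerivAt Ψ L (F u)) (hL : Function.Surjective L)
    (hlevel : ∀ᶠ x in 𝓝 u, Ψ (F x) = r) {N : Set E} (hN : N ∈ 𝓝 u) :
    F '' N ∈ 𝓝[{y | Ψ y = r}] (F u) := by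
  obtain ⟨π', hπ'⟩ := LinearMap.exists_leftInverse_of_injective (D : E →ₗ[ℝ] V)
    (LinearMap.ker_eq_bot.2 hD)
  set π : V →L[ℝ] E := LinearMap.toContinuousLinearMap π' with hπdef
  have hπ : ∀ x, π (D x) = x := fun x => LinearMap.congr_fun hπ' x
  have hLD : ∀ x, L (D x) = 0 := by
    intro x
    have h1 : HasFDerivAt (fun _ : E => r) (L.comp D) u :=
      (hΨ.hasFDerivAt.comp u hF.hasFDerivAt).congr_of_eventuallyEq (by
        filter_upwards [hlevel] with y hy using hy.symm)
    have h2 := congrArg (fun T => T x) (h1.unique (hasFDerivAt_const r u))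
    simpa using h2
  have hker : LinearMap.range (D : E →ₗ[ℝ] V) = LinearMap.ker (L : V →ₗ[ℝ] W) := by
    refine Submodule.eq_of_le_of_finrank_le ?_ ?_
    · rintro _ ⟨x, rfl⟩
      exact hLD x
    · have h1 := LinearMap.finrank_range_add_finrank_ker (L : V →ₗ[ℝ] W)
      rw [LinearMap.range_eq_top.2 hL, finrank_top] at h1
      rw [LinearMap.finrank_range_of_inj (f := (D : E →ₗ[ℝ] V)) hD]
      omega
  -- `(π, Ψ)` is injective near `F u`, and `π ∘ F` is open at `u`
  have hinj : Function.Injective (π.prod L) := by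
    rw [injective_iff_map_eq_zero]
    intro z hz
    have h1 : π z = 0 := congrArg Prod.fst hz
    have h2 : L z = 0 := congrArg Prod.snd hz
    have h3 : z ∈ LinearMap.range (D : E →ₗ[ℝ] V) := by rw [hker]; exact h2
    obtain ⟨x, rfl⟩ := h3
    change π (D x) = 0 at h1
    rw [hπ] at h1
    rw [h1, map_zero]
  obtain ⟨O, hO, hOinj⟩ := (π.hasStrictFDerivAt.prodMk hΨ).exists_injOn_nhds hinj
  have hπF : HasStrictFDerivAt (fun x => π (F x)) (π.comp D) u := π.hasStrictFDerivAt.comp u hF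
  have hsurj : (π.comp D).range = ⊤ := LinearMap.range_eq_top.2 fun x => ⟨x, hπ x⟩
  have hN' : N ∩ F ⁻¹' O ∩ {x | Ψ (F x) = r} ∈ 𝓝 u :=
    inter_mem (inter_mem hN (hF.continuousAt hO)) hlevel
  have himg := image_mem_map (m := fun x => π (F x)) hN'
  rw [hπF.map_nhds_eq_of_surj hsurj] at himg
  have hpre := π.continuous.continuousAt (x := F u) himg
  filter_upwards [nhdsWithin_le_nhds hO, nhdsWithin_le_nhds hpre, self_mem_nhdsWithin]
    with y hyO hyπ hyr
  obtain ⟨x, ⟨⟨hxN, hxO⟩, hxr⟩, hxy⟩ := hyπ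
  refine ⟨x, hxN, hOinj hxO hyO (Prod.ext hxy ?_)⟩
  change Ψ (F x) = Ψ y
  rw [hxr, hyr]

theorem isOpenSubsetOf_of_mem_nhdsWithin {X : Type*} [TopologicalSpace X] {A B : Set X}
    (hAB : A ⊆ B) (h : ∀ y ∈ A, A ∈ 𝓝[B] y) : IsOpenSubsetOf A B := by
  refine ⟨interior (A ∪ Bᶜ), isOpen_interior, Subset.antisymm (fun y hy => ⟨?_, hAB hy⟩) ?_⟩
  · rw [mem_interior_iff_mem_nhds]
    filter_upwards [mem_nhdsWithin_iff_eventually.1 (h y hy)] with z hz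
    by_cases hzB : z ∈ B
    · exact Or.inl (hz hzB)
    · exact Or.inr hzB
  · rintro y ⟨hy, hyB⟩
    exact (interior_subset hy).resolve_right fun h => h hyB

/-! ### Rotation hypersurfaces in charts -/

/-- An axis is spanned by `∂/∂xₙ₊₂` and a unit vector orthogonal to it. -/
theorem IsAxis.exists_frame {n : ℕ} {P : Submodule ℝ (EAmb n)} (hP : IsAxis n P) :
    ∃ e : EAmb n, ‖e‖ = 1 ∧ ⟪e, vertical n⟫ = 0 ∧ P = Submodule.span ℝ {e, vertical n} := by
  have hvv : ⟪vertical n, vertical n⟫ = 1 := inner_vertical_self n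
  have hv0 : vertical n ≠ 0 := fun h => by rw [h, inner_zero_left] at hvv; norm_num at hvv
  obtain ⟨p, hp, hpv⟩ : ∃ p ∈ P, p ∉ Submodule.span ℝ {vertical n} := by
    by_contra! hcon
    have h1 := Submodule.finrank_mono (s := P) (t := Submodule.span ℝ {vertical n}) hcon
    rw [hP.finrank_eq, finrank_span_singleton hv0] at h1
    omega
  set q := p - ⟪p, vertical n⟫ • vertical n with hq
  have hq0 : q ≠ 0 := fun h => hpv (by
    rw [hq, sub_eq_zero] at h
    rw [h]; exact Submodule.smul_mem _ _ (Submodule.mem_span_singleton_self _))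
  have hqv : ⟪q, vertical n⟫ = 0 := by
    rw [hq, inner_sub_left, real_inner_smul_left, hvv]; ring
  have hqP : q ∈ P := P.sub_mem hp (P.smul_mem _ hP.vertical_mem)
  have he : ‖‖q‖⁻¹ • q‖ = 1 := by
    rw [norm_smul, norm_inv, norm_norm, inv_mul_cancel₀ (norm_ne_zero_iff.2 hq0)]
  have he0 : ‖q‖⁻¹ • q ≠ 0 := norm_ne_zero_iff.1 (by rw [he]; exact one_ne_zero)
  have hev : ⟪‖q‖⁻¹ • q, vertical n⟫ = 0 := by rw [real_inner_smul_left, hqv, mul_zero]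
  refine ⟨‖q‖⁻¹ • q, he, hev, ?_⟩
  symm
  refine Submodule.eq_of_le_of_finrank_le ?_ ?_
  · rw [Submodule.span_le]
    rintro x (rfl | rfl)
    · exact P.smul_mem _ hqP
    · exact hP.vertical_mem
  · rw [hP.finrank_eq]
    have hli : LinearIndependent ℝ ![‖q‖⁻¹ • q, vertical n] := by
      refine linearIndependent_of_ne_zero_of_inner_eq_zero (𝕜 := ℝ) ?_ ?_
      · intro i
        fin_cases i
        · exact he0
        · exact hv0
      · intro i j hij
        fin_cases i <;> fin_cases j
        · exact absurd rfl hij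
        · exact hev
        · change ⟪vertical n, ‖q‖⁻¹ • q⟫ = 0
          rw [real_inner_comm]; exact hev
        · exact absurd rfl hij
    have h1 := finrank_span_eq_card hli
    rw [Matrix.range_cons, Matrix.range_cons, Matrix.range_empty, union_empty,
      singleton_union, Fintype.card_fin] at h1
    rw [h1]

theorem surjective_prod_of_det_ne_zero {E : Type*} [AddCommGroup E] [Module ℝ E]
    (ξ η : E →ₗ[ℝ] ℝ) {X Y : E} (h : ξ X * η Y ≠ ξ Y * η X) (p q : ℝ) :
    ∃ z, ξ z = p ∧ η z = q := by
  have hd : ξ X * η Y - ξ Y * η X ≠ 0 := sub_ne_zero.2 h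
  refine ⟨((p * η Y - q * ξ Y) / (ξ X * η Y - ξ Y * η X)) • X +
    ((q * ξ X - p * η X) / (ξ X * η Y - ξ Y * η X)) • Y, ?_, ?_⟩
  · simp only [map_add, map_smul, smul_eq_mul]
    rw [div_mul_eq_mul_div, div_mul_eq_mul_div, ← add_div, div_eq_iff hd]; ring
  · simp only [map_add, map_smul, smul_eq_mul]
    rw [div_mul_eq_mul_div, div_mul_eq_mul_div, ← add_div, div_eq_iff hd]; ring

section Charts

variable {n : ℕ} {M : Type*} [TopologicalSpace M] [ChartedSpace (EuclideanSpace ℝ (Fin n)) M]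
  [IsManifold (𝓡 n) ∞ M] {f : M → EAmb n}

theorem IsHypersurface.contDiffOn_comp_symm (hf : IsHypersurface n f)
    {φ : OpenPartialHomeomorph M (EuclideanSpace ℝ (Fin n))} (hφ : φ ∈ atlas _ M) :
    ContDiffOn ℝ ∞ (f ∘ φ.symm) φ.target := by
  rw [← contMDiffOn_iff_contDiffOn]
  exact hf.smooth.comp_contMDiffOn
    (contMDiffOn_symm_of_mem_maximalAtlas (IsManifold.subset_maximalAtlas hφ))

theorem IsHypersurface.injective_fderiv_comp_symm (hf : IsHypersurface n f)
    {φ : OpenPartialHomeomorph M (EuclideanSpace ℝ (Fin n))} (hφ : φ ∈ atlas _ M)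
    {u : EuclideanSpace ℝ (Fin n)} (hu : u ∈ φ.target) :
    Function.Injective (fderiv ℝ (f ∘ φ.symm) u) := by
  have : IsManifold (𝓡 n) 1 M := IsManifold.of_le (n := ∞) (by norm_num)
  have hφd : φ.MDifferentiable (𝓡 n) (𝓡 n) := mdifferentiable_of_mem_atlas hφ
  have hfd : MDifferentiableAt (𝓡 n) 𝓘(ℝ, EAmb n) f (φ.symm u) :=
    (hf.smooth _).mdifferentiableAt (by simp)
  rw [← mfderiv_eq_fderiv, mfderiv_comp u hfd (hφd.mdifferentiableAt_symm hu)]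
  exact (hf.immersion _).comp (hφd.symm.mfderiv_injective hu)

/-- The axial coordinates of a rotation hypersurface take values in a curve, which has empty
interior in the plane; hence their differentials are everywhere linearly dependent. -/
theorem IsRotationHypersurface.rotationPatch {P : Submodule ℝ (EAmb n)}
    (hf : IsRotationHypersurface n P f) {e : EAmb n} (he : ‖e‖ = 1) (hev : ⟪e, vertical n⟫ = 0)
    (heP : e ∈ P) {φ : OpenPartialHomeomorph M (EuclideanSpace ℝ (Fin n))} (hφ : φ ∈ atlas _ M) :
    RotationPatch n e (f ∘ φ.symm) φ.target where
  norm_axis := he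
  axis_vertical := hev
  isOpen := φ.open_target
  smooth := hf.isHypersurface.contDiffOn_comp_symm hφ
  injective u hu := hf.isHypersurface.injective_fderiv_comp_symm hφ hu
  mem u _ := hf.isHypersurface.mem _
  wedge := by
    intro u hu X Y
    by_contra hne
    obtain ⟨α, I, hα, hrange⟩ := hf.orbit
    -- the axial coordinates `g` would be an open map at `u`, but their values lie on the curve `γ`
    set γ : ℝ → ℝ × ℝ := fun s => (⟪α s, e⟫, ⟪α s, vertical n⟫)
    have hγ : ContDiffOn ℝ 1 γ I := ((hα.smooth.inner ℝ contDiffOn_const).prodMk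
      (hα.smooth.inner ℝ contDiffOn_const)).of_le (by norm_num)
    have hdense : Dense (γ '' I)ᶜ := by
      refine hγ.dense_compl_image_of_dimH_lt_finrank hα.ordConnected.convex le_rfl ?_
      refine (dimH_mono (subset_univ I)).trans_lt ?_
      rw [Real.dimH_univ]
      simp
    set F := f ∘ φ.symm with hF
    set g : EuclideanSpace ℝ (Fin n) → ℝ × ℝ := fun x => (⟪F x, e⟫, ⟪F x, vertical n⟫) with hg
    have hgmem : ∀ x, g x ∈ γ '' I := by
      intro x
      have hx : F x ∈ rotationOrbit n P α I := hrange ▸ mem_range_self (φ.symm x)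
      obtain ⟨A, hA, s, hs, hxs⟩ := hx
      refine ⟨s, hs, ?_⟩
      have h1 : ∀ p ∈ P, ⟪F x, p⟫ = ⟪α s, p⟫ := by
        intro p hp
        rw [hxs]
        nth_rewrite 1 [← hA p hp]
        exact A.inner_map_map _ _
      simp only [γ, hg, h1 e heP, h1 _ hf.isAxis.vertical_mem]
    have hFs : HasStrictFDerivAt F (fderiv ℝ F u) u :=
      ((hf.isHypersurface.contDiffOn_comp_symm hφ).contDiffAt
        (φ.open_target.mem_nhds hu)).hasStrictFDerivAt (by simp)
    set Lg : EuclideanSpace ℝ (Fin n) →L[ℝ] ℝ × ℝ :=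
      ((innerSL ℝ e).comp (fderiv ℝ F u)).prod ((innerSL ℝ (vertical n)).comp (fderiv ℝ F u))
    have hgs : HasStrictFDerivAt g Lg u := by
      have h1 := ((innerSL ℝ e).hasStrictFDerivAt.comp u hFs).prodMk
        ((innerSL ℝ (vertical n)).hasStrictFDerivAt.comp u hFs)
      refine h1.congr_of_eventuallyEq (Eventually.of_forall fun x => ?_)
      simp [hg, real_inner_comm]
    have hsurj : Lg.range = ⊤ := by
      refine LinearMap.range_eq_top.2 fun pq => ?_
      obtain ⟨z, h1, h2⟩ := surjective_prod_of_det_ne_zero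
        ((innerSL ℝ e).comp (fderiv ℝ F u)).toLinearMap
        ((innerSL ℝ (vertical n)).comp (fderiv ℝ F u)).toLinearMap (X := X) (Y := Y)
        (by simpa [real_inner_comm] using hne) pq.1 pq.2
      exact ⟨z, Prod.ext h1 h2⟩
    have hnhds : γ '' I ∈ 𝓝 (g u) := by
      rw [← hgs.map_nhds_eq_of_surj hsurj]
      exact mem_map.2 (univ_mem' hgmem)
    obtain ⟨y, hy1, hy2⟩ := hdense.inter_nhds_nonempty hnhds
    exact hy1 hy2

theorem HasConstantSectionalCurvature.hasCurvatureOn {c : ℝ}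
    (hc : HasConstantSectionalCurvature n f c)
    {φ : OpenPartialHomeomorph M (EuclideanSpace ℝ (Fin n))} (hφ : φ ∈ atlas _ M) :
    HasCurvatureOn (f ∘ φ.symm) φ.target c :=
  fun u hu X Y h => hc φ (IsManifold.subset_maximalAtlas hφ) u hu X Y h

end Charts

/-! ### Rotation hypersurfaces of constant curvature lie on slices and catenoids -/

/-- The subset of `𝕊ⁿ × ℝ` obtained by rotating the catenary with parameter `t` about the plane
spanned by `e` and `∂/∂xₙ₊₂`. -/
def catenoid (n : ℕ) (c : ℝ) (e : EAmb n) (t : ℝ) : Set (EAmb n) :=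
  {x | x ∈ sphereLine n ∧ ⟪x, e⟫ = catenary c t ⟪x, vertical n⟫}

/-- The differential of `x ↦ |x|² - xₙ₊₂²`, whose level set at height `1` is `𝕊ⁿ × ℝ`. -/
noncomputable def sphereLineDifferential {n : ℕ} (x : EAmb n) : EAmb n →L[ℝ] ℝ :=
  2 • (innerSL ℝ x - ⟪x, vertical n⟫ • innerSL ℝ (vertical n))

theorem sphereLineDifferential_apply {n : ℕ} (x z : EAmb n) :
    sphereLineDifferential x z = 2 * (⟪x, z⟫ - ⟪x, vertical n⟫ * ⟪vertical n, z⟫) := by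
  simp [sphereLineDifferential]

theorem hasStrictFDerivAt_sphereLine {n : ℕ} (x : EAmb n) :
    HasStrictFDerivAt (fun y : EAmb n => ⟪y, y⟫ - ⟪y, vertical n⟫ ^ 2)
      (sphereLineDifferential x) x := by
  have h0 : HasStrictFDerivAt (fun y : EAmb n => ⟪y, vertical n⟫) (innerSL ℝ (vertical n)) x :=
    (innerSL ℝ (vertical n)).hasStrictFDerivAt.congr_of_eventuallyEq
      (Eventually.of_forall fun y => by simp [real_inner_comm])
  have h1 := ((hasStrictFDerivAt_id x).inner ℝ (hasStrictFDerivAt_id x)).sub (h0.pow 2)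
  refine (h1.congr_fderiv ?_)
  ext1 z
  rw [sphereLineDifferential_apply]
  simp
  rw [real_inner_comm x z]; ring

section

variable {n : ℕ} {M : Type*} [TopologicalSpace M] [ChartedSpace (EuclideanSpace ℝ (Fin n)) M]
  {f : M → EAmb n}

theorem tendsto_chart_symm (p : M) :
    Tendsto (chartAt (EuclideanSpace ℝ (Fin n)) p).symm
      (𝓝 (chartAt (EuclideanSpace ℝ (Fin n)) p p)) (𝓝 p) := by
  have h := (chartAt (EuclideanSpace ℝ (Fin n)) p).continuousAt_symm
    ((chartAt (EuclideanSpace ℝ (Fin n)) p).map_source (mem_chart_source _ p))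
  rwa [ContinuousAt, (chartAt (EuclideanSpace ℝ (Fin n)) p).left_inv (mem_chart_source _ p)] at h

theorem eventually_of_chart {p : M} {Q : EAmb n → Prop}
    (h : ∀ᶠ x in 𝓝 (chartAt (EuclideanSpace ℝ (Fin n)) p p),
      Q ((f ∘ (chartAt (EuclideanSpace ℝ (Fin n)) p).symm) x)) : ∀ᶠ q in 𝓝 p, Q (f q) := by
  set φ := chartAt (EuclideanSpace ℝ (Fin n)) p
  have hp : p ∈ φ.source := mem_chart_source _ p
  filter_upwards [(φ.continuousAt hp).eventually h, φ.open_source.mem_nhds hp] with q hq hqs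
  simpa [φ.left_inv hqs] using hq

end

section

variable {n : ℕ} {M : Type*} [TopologicalSpace M] [ChartedSpace (EuclideanSpace ℝ (Fin n)) M]
  [IsManifold (𝓡 n) ∞ M] {f : M → EAmb n}

/-- A hypersurface of `𝕊ⁿ × ℝ` contained in a regular hypersurface `ψ = r` is open in it. -/
theorem IsHypersurface.isOpenSubsetOf_level (hf : IsHypersurface n f) {ψ : EAmb n → ℝ}
    {ψ' : EAmb n → EAmb n →L[ℝ] ℝ} {r : ℝ} (hψ : ∀ x, HasStrictFDerivAt ψ (ψ' x) x)
    (hval : ∀ p, ψ (f p) = r)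
    (hreg : ∀ p, ∃ X Y, sphereLineDifferential (f p) X * ψ' (f p) Y ≠
      sphereLineDifferential (f p) Y * ψ' (f p) X) :
    IsOpenSubsetOf (range f) {x | x ∈ sphereLine n ∧ ψ x = r} := by
  have hset : {x | x ∈ sphereLine n ∧ ψ x = r} =
      {x | (fun y : EAmb n => (⟪y, y⟫ - ⟪y, vertical n⟫ ^ 2, ψ y)) x = (1, r)} := by
    ext x
    simp [mem_sphereLine_iff]
  refine isOpenSubsetOf_of_mem_nhdsWithin ?_ ?_
  · rintro _ ⟨p, rfl⟩
    exact ⟨hf.mem p, hval p⟩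
  · rintro _ ⟨p, rfl⟩
    set φ := chartAt (EuclideanSpace ℝ (Fin n)) p with hφ
    have hφa : φ ∈ atlas (EuclideanSpace ℝ (Fin n)) M := chart_mem_atlas _ p
    have hp : p ∈ φ.source := mem_chart_source _ p
    have hu : φ p ∈ φ.target := φ.map_source hp
    have hFp : (f ∘ φ.symm) (φ p) = f p := by simp [φ.left_inv hp]
    have hFs : HasStrictFDerivAt (f ∘ φ.symm) (fderiv ℝ (f ∘ φ.symm) (φ p)) (φ p) :=
      ((hf.contDiffOn_comp_symm hφa).contDiffAt
        (φ.open_target.mem_nhds hu)).hasStrictFDerivAt (by simp)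
    have hΨ := (hasStrictFDerivAt_sphereLine (f p)).prodMk (hψ (f p))
    rw [← hFp] at hΨ
    obtain ⟨X, Y, hXY⟩ := hreg p
    rw [← hFp] at hXY
    have h1 := image_mem_nhdsWithin_level (by simp) hFs (hf.injective_fderiv_comp_symm hφa hu) hΨ
      (fun pq => by
        obtain ⟨z, h1, h2⟩ := surjective_prod_of_det_ne_zero
          (sphereLineDifferential ((f ∘ φ.symm) (φ p))).toLinearMap
          (ψ' ((f ∘ φ.symm) (φ p))).toLinearMap (X := X) (Y := Y) hXY pq.1 pq.2
        exact ⟨z, Prod.ext h1 h2⟩)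
      (r := (1, r)) (Eventually.of_forall fun x =>
        Prod.ext (mem_sphereLine_iff.1 (hf.mem (φ.symm x))) (hval (φ.symm x))) univ_mem
    rw [hset]
    rw [hFp, image_univ] at h1
    exact mem_of_superset h1 (range_comp_subset_range _ _)

theorem hasStrictFDerivAt_inner_right (e x : EAmb n) :
    HasStrictFDerivAt (fun y : EAmb n => ⟪y, e⟫) (innerSL ℝ e) x :=
  (innerSL ℝ e).hasStrictFDerivAt.congr_of_eventuallyEq
    (Eventually.of_forall fun y => by simp [real_inner_comm])

theorem IsHypersurface.isOpenSubsetOf_slice (hf : IsHypersurface n f) {t : ℝ}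
    (ht : ∀ p, ⟪f p, vertical n⟫ = t) : IsOpenSubsetOf (range f) (sphereSlice n t) := by
  have h : sphereSlice n t = {x | x ∈ sphereLine n ∧ ⟪x, vertical n⟫ = t} := by
    ext x; simp [sphereSlice, inner_vertical]
  rw [h]
  refine hf.isOpenSubsetOf_level (hasStrictFDerivAt_inner_right (vertical n)) ht fun p => ?_
  have hvv := inner_vertical_self n
  refine ⟨f p - ⟪f p, vertical n⟫ • vertical n, vertical n, ?_⟩
  have h1 := mem_sphereLine_iff.1 (hf.mem p)
  have h2 := real_inner_comm (f p) (vertical n)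
  simp only [sphereLineDifferential_apply, innerSL_apply_apply, inner_sub_right,
    real_inner_smul_right, hvv, h2]
  nlinarith

theorem hasStrictDerivAt_catenary {c : ℝ} (hc : 1 < c) (t h : ℝ) :
    HasStrictDerivAt (catenary c t) (Real.sinh ((h - t) / √((c - 1) / c))) h := by
  have hκ := catenary_modulus_pos hc
  have h0 : HasStrictDerivAt (fun h => (h - t) / √((c - 1) / c)) (√((c - 1) / c))⁻¹ h := by
    have h1 : HasStrictDerivAt (fun h => h - t) 1 h := (hasStrictDerivAt_id h).sub_const t
    simpa [div_eq_mul_inv] using HasStrictDerivAt.mul_const h1 (√((c - 1) / c))⁻¹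
  refine (h0.cosh.const_mul (√((c - 1) / c))).congr_deriv ?_
  field_simp

theorem IsHypersurface.isOpenSubsetOf_catenoid (hf : IsHypersurface n f) {c : ℝ} (hc : 1 < c)
    {e : EAmb n} (he : ‖e‖ = 1) (hev : ⟪e, vertical n⟫ = 0) {t : ℝ}
    (ht : ∀ p, ⟪f p, e⟫ = catenary c t ⟪f p, vertical n⟫) :
    IsOpenSubsetOf (range f) (catenoid n c e t) := by
  have h : catenoid n c e t =
      {x | x ∈ sphereLine n ∧ ⟪x, e⟫ - catenary c t ⟪x, vertical n⟫ = 0} := by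
    ext x; simp [catenoid, sub_eq_zero]
  rw [h]
  have hψ : ∀ x : EAmb n, HasStrictFDerivAt
      (fun x : EAmb n => ⟪x, e⟫ - catenary c t ⟪x, vertical n⟫)
      (innerSL ℝ e - Real.sinh ((⟪x, vertical n⟫ - t) / √((c - 1) / c)) •
        innerSL ℝ (vertical n)) x := fun x =>
    (hasStrictFDerivAt_inner_right e x).sub
      (HasStrictDerivAt.comp_hasStrictFDerivAt (h₂ := catenary c t) x
        (hasStrictDerivAt_catenary hc t ⟪x, vertical n⟫)
        (hasStrictFDerivAt_inner_right (vertical n) x))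
  refine hf.isOpenSubsetOf_level hψ (fun p => sub_eq_zero.2 (ht p)) fun p => ?_
  have hvv := inner_vertical_self n
  have hee : ⟪e, e⟫ = 1 := by rw [real_inner_self_eq_norm_sq, he]; norm_num
  have h1 := mem_sphereLine_iff.1 (hf.mem p)
  have h2 := real_inner_comm (f p) (vertical n)
  have h3 := real_inner_comm e (vertical n)
  have h4 := real_inner_comm (f p) e
  set a := ⟪f p, e⟫
  set b := ⟪f p, vertical n⟫
  by_cases hs : Real.sinh ((b - t) / √((c - 1) / c)) = 0
  · -- at the neck of the catenary the hypersurface does not meet the axis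
    refine ⟨f p - b • vertical n, e, ?_⟩
    have ha : a ^ 2 < 1 := by
      have h5 := Real.cosh_sq ((b - t) / √((c - 1) / c))
      rw [hs] at h5
      have h6 : a ^ 2 = (c - 1) / c := by
        change ⟪f p, e⟫ ^ 2 = _
        rw [ht p, catenary, mul_pow, catenary_modulus_sq hc]
        change (c - 1) / c * Real.cosh ((b - t) / √((c - 1) / c)) ^ 2 = _
        rw [h5]; ring
      rw [h6, div_lt_one (by linarith)]; linarith
    simp only [sphereLineDifferential_apply, _root_.sub_apply, _root_.smul_apply,
      innerSL_apply_apply, inner_sub_right, real_inner_smul_right, hvv, hee, h2, h3, h4, hev, hs,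
      smul_eq_mul]
    change _ ≠ 2 * (a - b * 0) * _
    nlinarith
  · refine ⟨f p - b • vertical n, vertical n, ?_⟩
    simp only [sphereLineDifferential_apply, _root_.sub_apply, _root_.smul_apply,
      innerSL_apply_apply, inner_sub_right, real_inner_smul_right, hvv, h2, h4, hev,
      smul_eq_mul]
    intro h0
    apply hs
    change 2 * (⟪f p, f p⟫ - b * b - b * (b - b * 1)) * (0 - _ * 1) = 2 * (b - b * 1) * _ at h0
    nlinarith

variable [ConnectedSpace M] {P : Submodule ℝ (EAmb n)} {e : EAmb n} {c : ℝ}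

theorem IsRotationHypersurface.one_le_curvature (hn : 3 ≤ n) (hf : IsRotationHypersurface n P f)
    (he : ‖e‖ = 1) (hev : ⟪e, vertical n⟫ = 0) (heP : e ∈ P)
    (hK : HasConstantSectionalCurvature n f c) : 1 ≤ c := by
  obtain ⟨p⟩ : Nonempty M := inferInstance
  have hφ := chart_mem_atlas (EuclideanSpace ℝ (Fin n)) p
  exact (hf.rotationPatch he hev heP hφ).one_le_curvature hn (hK.hasCurvatureOn hφ)
    ⟨_, (chartAt _ p).map_source (mem_chart_source _ p)⟩

theorem IsRotationHypersurface.exists_height (hn : 3 ≤ n) (hf : IsRotationHypersurface n P f)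
    (he : ‖e‖ = 1) (hev : ⟪e, vertical n⟫ = 0) (heP : e ∈ P)
    (hK : HasConstantSectionalCurvature n f 1) : ∃ t, ∀ p, ⟪f p, vertical n⟫ = t := by
  have hloc : IsLocallyConstant fun p => ⟪f p, vertical n⟫ := by
    rw [IsLocallyConstant.iff_eventually_eq]
    intro p
    have hφ := chart_mem_atlas (EuclideanSpace ℝ (Fin n)) p
    have hP := hf.rotationPatch he hev heP hφ
    set φ := chartAt (EuclideanSpace ℝ (Fin n)) p with hφdef
    have hp : p ∈ φ.source := mem_chart_source _ p
    have hu : φ p ∈ φ.target := φ.map_source hp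
    obtain ⟨r, hr, hball⟩ := Metric.isOpen_iff.1 φ.open_target _ hu
    refine eventually_of_chart (Q := fun y => ⟪y, vertical n⟫ = ⟪f p, vertical n⟫) ?_
    filter_upwards [Metric.ball_mem_nhds _ hr] with x hx
    have h1 := Metric.isOpen_ball.is_const_of_fderiv_eq_zero (𝕜 := ℝ)
      (f := fun y => ⟪(f ∘ φ.symm) y, vertical n⟫) Metric.isPreconnected_ball
      (fun y hy => (hP.hasFDerivAt_inner (hball hy) _).differentiableAt.differentiableWithinAt)
      (fun y hy => by
        rw [(hP.hasFDerivAt_inner (hball hy) _).fderiv]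
        ext X
        have := hP.fderiv_height_eq_zero hn (hK.hasCurvatureOn hφ) (hball hy) X
        rw [real_inner_comm] at this
        simpa using this) hx (Metric.mem_ball_self hr)
    simpa [φ.left_inv hp] using h1
  obtain ⟨p⟩ : Nonempty M := inferInstance
  exact ⟨_, fun q => hloc.apply_eq_of_preconnectedSpace q p⟩

theorem IsRotationHypersurface.exists_catenary (hn : 3 ≤ n) (hf : IsRotationHypersurface n P f)
    (he : ‖e‖ = 1) (hev : ⟪e, vertical n⟫ = 0) (heP : e ∈ P)
    (hK : HasConstantSectionalCurvature n f c) (hc : 1 < c) (hpos : ∀ p, 0 < ⟪f p, e⟫) :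
    ∃ t, ∀ p, ⟪f p, e⟫ = catenary c t ⟪f p, vertical n⟫ := by
  obtain ⟨t, ht⟩ := exists_catenary_of_locally (X := M) (a := fun p => ⟪f p, e⟫)
    (h := fun p => ⟪f p, vertical n⟫) hc isPreconnected_univ univ_nonempty
    (fun p _ r => by
      have hφ := chart_mem_atlas (EuclideanSpace ℝ (Fin n)) p
      exact (tendsto_chart_symm p).frequently ((hf.rotationPatch he hev heP
        hφ).height_frequently_ne hn (hK.hasCurvatureOn hφ) hc
        ((chartAt _ p).map_source (mem_chart_source _ p)) r))
    (fun p _ => by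
      have hφ := chart_mem_atlas (EuclideanSpace ℝ (Fin n)) p
      obtain ⟨t, ht⟩ := (hf.rotationPatch he hev heP hφ).exists_catenary hn
        (hK.hasCurvatureOn hφ) hc (fun x _ => hpos _)
        ((chartAt _ p).map_source (mem_chart_source _ p))
      exact ⟨t, eventually_of_chart (Q := fun y => ⟪y, e⟫ = catenary c t ⟪y, vertical n⟫) ht⟩)
  exact ⟨t, fun p => ht p (mem_univ p)⟩

/-- The coordinate along the axis has no zeros when `c > 1`, so it has a constant sign. -/
theorem IsRotationHypersurface.inner_axis_pos_or_neg (hn : 3 ≤ n)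
    (hf : IsRotationHypersurface n P f)
    (he : ‖e‖ = 1) (hev : ⟪e, vertical n⟫ = 0) (heP : e ∈ P)
    (hK : HasConstantSectionalCurvature n f c) (hc : 1 < c) :
    (∀ p, 0 < ⟪f p, e⟫) ∨ ∀ p, 0 < ⟪f p, -e⟫ := by
  have hne : ∀ p, ⟪f p, e⟫ ≠ 0 := by
    intro p h0
    have hφ := chart_mem_atlas (EuclideanSpace ℝ (Fin n)) p
    have h1 := (hf.rotationPatch he hev heP hφ).le_inner_axis_sq hn (hK.hasCurvatureOn hφ) hc
        ((chartAt _ p).map_source (mem_chart_source _ p))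
    rw [Function.comp_apply, (chartAt _ p).left_inv (mem_chart_source _ p), h0] at h1
    linarith
  have hcont : Continuous fun p => ⟪f p, e⟫ :=
    (hf.isHypersurface.smooth.continuous).inner continuous_const
  by_contra! hcon
  obtain ⟨⟨p, hp⟩, q, hq⟩ := hcon
  rw [inner_neg_right] at hq
  obtain ⟨z, hz⟩ := mem_range_of_exists_le_of_exists_ge hcont ⟨p, hp⟩
    ⟨q, (by linarith : (0 : ℝ) ≤ ⟪f q, e⟫)⟩
  exact hne z hz

end

/-! ### The catenoid is a complete rotation hypersurface -/

/-- The height of the catenary with parameter `t` at which its slope is `E / √(c - 1)`, oriented so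
that `E = cos (√c s)` along the explicit profile. -/
noncomputable def catenaryHeight (c t E : ℝ) : ℝ :=
  t - √((c - 1) / c) * Real.arsinh (E / √(c - 1))

/-- The inverse of `catenaryHeight`. -/
noncomputable def catenarySlope (c t h : ℝ) : ℝ :=
  √(c - 1) * Real.sinh ((t - h) / √((c - 1) / c))

section Catenary

variable {c : ℝ}

theorem catenaryHeight_catenarySlope (hc : 1 < c) (t h : ℝ) :
    catenaryHeight c t (catenarySlope c t h) = h := by
  have hκ := catenary_modulus_pos hc
  have hq : 0 < √(c - 1) := Real.sqrt_pos.2 (by linarith)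
  rw [catenaryHeight, catenarySlope, mul_div_cancel_left₀ _ hq.ne', Real.arsinh_sinh,
    mul_div_cancel₀ _ hκ.ne']
  ring

theorem catenarySlope_catenaryHeight (hc : 1 < c) (t E : ℝ) :
    catenarySlope c t (catenaryHeight c t E) = E := by
  have hκ := catenary_modulus_pos hc
  have hq : 0 < √(c - 1) := Real.sqrt_pos.2 (by linarith)
  rw [catenaryHeight, catenarySlope, sub_sub_cancel, mul_div_cancel_left₀ _ hκ.ne',
    Real.sinh_arsinh, mul_div_cancel₀ _ hq.ne']

theorem catenary_sq (hc : 1 < c) (t h : ℝ) :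
    c * catenary c t h ^ 2 = c - 1 + catenarySlope c t h ^ 2 := by
  have hsinh : Real.sinh ((t - h) / √((c - 1) / c)) = -Real.sinh ((h - t) / √((c - 1) / c)) := by
    rw [← Real.sinh_neg, ← neg_div, neg_sub]
  rw [catenary, catenarySlope, mul_pow, mul_pow, catenary_modulus_sq hc,
    Real.sq_sqrt (by linarith : (0 : ℝ) ≤ c - 1), Real.cosh_sq, hsinh, neg_sq]
  field_simp
  ring

theorem catenary_pos (hc : 1 < c) (t h : ℝ) : 0 < catenary c t h :=
  mul_pos (catenary_modulus_pos hc) (Real.cosh_pos _)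

theorem catenary_eq_sqrt (hc : 1 < c) (t h : ℝ) :
    catenary c t h = √((c - 1 + catenarySlope c t h ^ 2) / c) := by
  rw [← catenary_sq hc, mul_div_cancel_left₀ _ (by linarith : c ≠ 0),
    Real.sqrt_sq (catenary_pos hc t h).le]

theorem catenary_catenaryHeight (hc : 1 < c) (t E : ℝ) :
    catenary c t (catenaryHeight c t E) = √((c - 1 + E ^ 2) / c) := by
  rw [catenary_eq_sqrt hc, catenarySlope_catenaryHeight hc]

end Catenary

theorem contDiff_catenaryHeight (c t : ℝ) : ContDiff ℝ ∞ (catenaryHeight c t) :=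
  contDiff_const.sub (contDiff_const.mul (Real.contDiff_arsinh.comp (contDiff_id.div_const _)))

theorem contDiff_catenarySlope (c t : ℝ) : ContDiff ℝ ∞ (catenarySlope c t) :=
  contDiff_const.mul (Real.contDiff_sinh.comp ((contDiff_const.sub contDiff_id).div_const _))

section Frame

variable {n : ℕ} {e : EAmb n}

/-- Points of `𝕊ⁿ × ℝ` with the same coordinates along the axis are exchanged by a reflection that
fixes the axis. -/
theorem exists_isometry_fixing_axis {x y : EAmb n} (hx : x ∈ sphereLine n) (hy : y ∈ sphereLine n)
    (he : ⟪x, e⟫ = ⟪y, e⟫) (hv : ⟪x, vertical n⟫ = ⟪y, vertical n⟫) :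
    ∃ A : EAmb n ≃ₗᵢ[ℝ] EAmb n, (∀ p ∈ Submodule.span ℝ {e, vertical n}, A p = p) ∧ x = A y := by
  have hnorm : ‖y‖ = ‖x‖ := by
    have h1 := mem_sphereLine_iff.1 hx
    have h2 := mem_sphereLine_iff.1 hy
    rw [real_inner_self_eq_norm_sq] at h1 h2
    rw [← sq_eq_sq₀ (norm_nonneg _) (norm_nonneg _)]
    rw [hv] at h1; linarith
  refine ⟨(Submodule.span ℝ {y - x})ᗮ.reflection, fun p hp => ?_,
    (Submodule.reflection_sub hnorm).symm⟩
  refine Submodule.reflection_mem_subspace_eq_self ?_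
  have hle : Submodule.span ℝ {e, vertical n} ≤ (Submodule.span ℝ {y - x})ᗮ := by
    rw [Submodule.span_le]
    rintro z (rfl | rfl)
    · refine Submodule.mem_orthogonal_singleton_iff_inner_right.2 ?_
      rw [inner_sub_left, he, sub_self]
    · refine Submodule.mem_orthogonal_singleton_iff_inner_right.2 ?_
      rw [inner_sub_left, hv, sub_self]
  exact hle hp

theorem rotationOrbit_eq (P : Submodule ℝ (EAmb n))
    (hP : P = Submodule.span ℝ {e, vertical n}) {α : ℝ → EAmb n} {I : Set ℝ}
    (hα : ∀ s ∈ I, α s ∈ sphereLine n) :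
    rotationOrbit n P α I = {x | x ∈ sphereLine n ∧ ∃ s ∈ I, ⟪x, e⟫ = ⟪α s, e⟫ ∧
      ⟪x, vertical n⟫ = ⟪α s, vertical n⟫} := by
  have heP : e ∈ P := hP ▸ Submodule.subset_span (by simp)
  have hvP : vertical n ∈ P := hP ▸ Submodule.subset_span (by simp)
  ext x
  constructor
  · rintro ⟨A, hA, s, hs, rfl⟩
    have h1 : ∀ p ∈ P, ⟪A (α s), p⟫ = ⟪α s, p⟫ := by
      intro p hp
      nth_rewrite 1 [← hA p hp]
      exact A.inner_map_map _ _
    refine ⟨?_, s, hs, h1 e heP, h1 _ hvP⟩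
    rw [mem_sphereLine_iff, h1 _ hvP, A.inner_map_map]
    exact mem_sphereLine_iff.1 (hα s hs)
  · rintro ⟨hx, s, hs, h1, h2⟩
    obtain ⟨A, hA, hxA⟩ := exists_isometry_fixing_axis hx (hα s hs) h1 h2
    exact ⟨A, fun p hp => hA p (hP ▸ hp), s, hs, hxA⟩

/-- The profile curve of the catenoid, in the half-plane direction `b`. -/
noncomputable def catenoidProfile (c t : ℝ) (e b : EAmb n) (s : ℝ) : EAmb n :=
  √((c - 1 + Real.cos (√c * s) ^ 2) / c) • e + (Real.sin (√c * s) / √c) • b +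
    catenaryHeight c t (Real.cos (√c * s)) • vertical n

theorem inner_frame_combination (he : ‖e‖ = 1) (hev : ⟪e, vertical n⟫ = 0) {b : EAmb n}
    (hb : ‖b‖ = 1) (hbe : ⟪b, e⟫ = 0) (hbv : ⟪b, vertical n⟫ = 0) (p q r : ℝ) :
    ⟪p • e + q • b + r • vertical n, e⟫ = p ∧ ⟪p • e + q • b + r • vertical n, b⟫ = q ∧
    ⟪p • e + q • b + r • vertical n, vertical n⟫ = r ∧
    ⟪p • e + q • b + r • vertical n, p • e + q • b + r • vertical n⟫ = p ^ 2 + q ^ 2 + r ^ 2 := by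
  have hee : ⟪e, e⟫ = 1 := by rw [real_inner_self_eq_norm_sq, he]; norm_num
  have hbb : ⟪b, b⟫ = 1 := by rw [real_inner_self_eq_norm_sq, hb]; norm_num
  have hvv := inner_vertical_self n
  have hve : ⟪vertical n, e⟫ = 0 := by rw [real_inner_comm]; exact hev
  have heb : ⟪e, b⟫ = 0 := by rw [real_inner_comm]; exact hbe
  have hvb : ⟪vertical n, b⟫ = 0 := by rw [real_inner_comm]; exact hbv
  simp only [inner_add_left, inner_add_right, real_inner_smul_left, real_inner_smul_right, hee, hbb,
    hvv, hev, hve, hbe, heb, hbv, hvb]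
  refine ⟨by ring, by ring, by ring, by ring⟩

theorem isProfileCurve_catenoidProfile {P : Submodule ℝ (EAmb n)}
    (hP : P = Submodule.span ℝ {e, vertical n}) (he : ‖e‖ = 1) (hev : ⟪e, vertical n⟫ = 0)
    {b : EAmb n} (hb : ‖b‖ = 1) (hbe : ⟪b, e⟫ = 0) (hbv : ⟪b, vertical n⟫ = 0) {c : ℝ} (hc : 1 < c)
    (t : ℝ) : IsProfileCurve n P (catenoidProfile c t e b) (Icc 0 (Real.pi / √c)) := by
  have hc0 : 0 < c := by linarith
  have hsc : 0 < √c := Real.sqrt_pos.2 hc0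
  have hsc2 : √c ^ 2 = c := Real.sq_sqrt hc0.le
  have hI : 0 < Real.pi / √c := div_pos Real.pi_pos hsc
  have hApos : ∀ s, 0 < (c - 1 + Real.cos (√c * s) ^ 2) / c := fun s =>
    div_pos (by nlinarith [sq_nonneg (Real.cos (√c * s))]) hc0
  have hsmooth : ContDiff ℝ ∞ (catenoidProfile c t e b) := by
    have hlin : ContDiff ℝ ∞ fun s : ℝ => √c * s := contDiff_const.mul contDiff_id
    have hcos := Real.contDiff_cos.comp hlin
    have hsin := Real.contDiff_sin.comp hlin
    have hA : ContDiff ℝ ∞ fun s : ℝ => √((c - 1 + Real.cos (√c * s) ^ 2) / c) :=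
      ((contDiff_const.add (hcos.pow 2)).div_const c).sqrt fun s => (hApos s).ne'
    exact ((hA.smul contDiff_const).add ((hsin.div_const _).smul contDiff_const)).add
      (((contDiff_catenaryHeight c t).comp hcos).smul contDiff_const)
  refine ⟨ordConnected_Icc, ⟨0, left_mem_Icc.2 hI.le, _, right_mem_Icc.2 hI.le, hI.ne⟩,
    hsmooth.contDiffOn, ?_, ?_, ?_⟩
  · intro s hs
    set C := Real.cos (√c * s) with hC
    set S := Real.sin (√c * s) with hS
    set a := √((c - 1 + C ^ 2) / c) with ha
    have ha2 : a ^ 2 = (c - 1 + C ^ 2) / c := Real.sq_sqrt (hApos s).le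
    have hapos : 0 < a := Real.sqrt_pos.2 (hApos s)
    have hq : 0 < √(c - 1) := Real.sqrt_pos.2 (by linarith)
    have hq2 : √(c - 1) ^ 2 = c - 1 := Real.sq_sqrt (by linarith)
    have hκ := catenary_modulus_pos hc
    have hκ2 := catenary_modulus_sq hc
    have hlin : HasDerivAt (fun s : ℝ => √c * s) (√c) s := by
      simpa using (hasDerivAt_id s).const_mul (√c)
    have hcos : HasDerivAt (fun s => Real.cos (√c * s)) (-S * √c) s := hlin.cos
    have hsin : HasDerivAt (fun s => Real.sin (√c * s)) (C * √c) s := hlin.sin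
    have hA := (((hcos.pow 2).const_add (c - 1)).div_const c).sqrt (hApos s).ne'
    have hH := ((hcos.div_const (√(c - 1))).arsinh.const_mul (√((c - 1) / c))).const_sub t
    -- the square root in the derivative of `arsinh` is a multiple of the coordinate `a` along `e`
    have hsq : √(1 + (C / √(c - 1)) ^ 2) = √c * a / √(c - 1) := by
      rw [← Real.sqrt_sq (by positivity : 0 ≤ √c * a / √(c - 1)), div_pow, div_pow, mul_pow, hsc2,
        hq2, ha2]
      congr 1
      have : c - 1 ≠ 0 := by linarith
      field_simp
    have hα : HasDerivAt (catenoidProfile c t e b) ((-(C * S) / (√c * a)) • e + C • b +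
        (√((c - 1) / c) * S / a) • vertical n) s := by
      refine (((hA.smul_const e).add ((hsin.div_const (√c)).smul_const b)).add
        (hH.smul_const (vertical n))).congr_deriv ?_
      congr 1
      · congr 1
        · congr 1
          change _ / (2 * a) = _
          rw [← hC]
          field_simp
          rw [hsc2]
          simp
          ring
        · congr 1
          field_simp
      · congr 1
        change -(_ * ((√(1 + (C / √(c - 1)) ^ 2))⁻¹ • _)) = _
        rw [hsq, smul_eq_mul]
        field_simp
    rw [hα.hasDerivWithinAt.derivWithin (uniqueDiffOn_Icc hI s hs)]
    have h1 := (inner_frame_combination he hev hb hbe hbv (-(C * S) / (√c * a)) C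
      (√((c - 1) / c) * S / a)).2.2.2
    rw [real_inner_self_eq_norm_sq] at h1
    have h2 : (-(C * S) / (√c * a)) ^ 2 + C ^ 2 + (√((c - 1) / c) * S / a) ^ 2 = 1 := by
      have hCS : S ^ 2 + C ^ 2 = 1 := Real.sin_sq_add_cos_sq _
      rw [div_pow, div_pow, mul_pow, mul_pow, hκ2, hsc2, ha2]
      have h3 : c - 1 + C ^ 2 ≠ 0 := by
        have := (div_pos_iff_of_pos_right hc0).1 (hApos s)
        exact this.ne'
      field_simp
      have hS2 : S ^ 2 = 1 - C ^ 2 := by linarith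
      rw [hS2]
      ring
    rw [h2] at h1
    nlinarith [norm_nonneg ((-(C * S) / (√c * a)) • e + C • b +
      (√((c - 1) / c) * S / a) • vertical n)]
  · intro s _
    obtain ⟨-, -, h1, h2⟩ := inner_frame_combination he hev hb hbe hbv
      (√((c - 1 + Real.cos (√c * s) ^ 2) / c)) (Real.sin (√c * s) / √c)
      (catenaryHeight c t (Real.cos (√c * s)))
    rw [mem_sphereLine_iff, catenoidProfile, h1, h2, Real.sq_sqrt (hApos s).le, div_pow, hsc2]
    have := Real.sin_sq_add_cos_sq (√c * s)
    field_simp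
    linarith
  · have heP : e ∈ P := hP ▸ Submodule.subset_span (by simp)
    have hvP : vertical n ∈ P := hP ▸ Submodule.subset_span (by simp)
    have hPle : P ≤ Submodule.span ℝ (range ![e, b, vertical n]) := by
      rw [hP, Submodule.span_le]
      rintro z (rfl | rfl)
      · exact Submodule.subset_span ⟨0, rfl⟩
      · exact Submodule.subset_span ⟨2, rfl⟩
    have hbQ : b ∈ Submodule.span ℝ (range ![e, b, vertical n]) := Submodule.subset_span ⟨1, rfl⟩
    have hb0 : b ≠ 0 := fun h => by simp [h] at hb
    refine ⟨Submodule.span ℝ (range ![e, b, vertical n]), ?_, hPle, fun s _ => ?_, b, hbQ, hb0,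
      fun p hp => ?_, fun s hs => ?_⟩
    · have hli : LinearIndependent ℝ ![e, b, vertical n] := by
        have he0 : e ≠ 0 := fun h => by simp [h] at he
        have hv0 : vertical n ≠ 0 := fun h => by
          have := norm_vertical n
          simp [h] at this
        refine linearIndependent_of_ne_zero_of_inner_eq_zero (𝕜 := ℝ) ?_ ?_
        · intro i; fin_cases i <;> assumption
        · intro i j hij
          fin_cases i <;> fin_cases j <;>
            simp_all [real_inner_comm]
      simpa using finrank_span_eq_card hli
    · exact Submodule.add_mem _ (Submodule.add_mem _ (Submodule.smul_mem _ _ (hPle heP))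
        (Submodule.smul_mem _ _ hbQ)) (Submodule.smul_mem _ _ (hPle hvP))
    · rw [hP] at hp
      obtain ⟨p, q, rfl⟩ := Submodule.mem_span_pair.1 hp
      rw [inner_add_right, real_inner_smul_right, real_inner_smul_right, hbe, hbv]; ring
    · rw [real_inner_comm, catenoidProfile, (inner_frame_combination he hev hb hbe hbv _ _ _).2.1]
      refine div_nonneg (Real.sin_nonneg_of_nonneg_of_le_pi (mul_nonneg hsc.le hs.1) ?_) hsc.le
      have := mul_le_mul_of_nonneg_left hs.2 hsc.le
      rwa [mul_div_cancel₀ _ hsc.ne'] at this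

/-- The squared distance to the axis of a point of `𝕊ⁿ × ℝ`. -/
theorem inner_radial_self_of_mem_sphereLine (he : ‖e‖ = 1) (hev : ⟪e, vertical n⟫ = 0) {x : EAmb n}
    (hx : x ∈ sphereLine n) :
    ⟪x - ⟪x, e⟫ • e - ⟪x, vertical n⟫ • vertical n, x - ⟪x, e⟫ • e - ⟪x, vertical n⟫ • vertical n⟫
      = 1 - ⟪x, e⟫ ^ 2 := by
  have hee : ⟪e, e⟫ = 1 := by rw [real_inner_self_eq_norm_sq, he]; norm_num
  have hvv := inner_vertical_self n
  have hve : ⟪vertical n, e⟫ = 0 := by rw [real_inner_comm]; exact hev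
  have h1 := mem_sphereLine_iff.1 hx
  simp only [inner_sub_left, inner_sub_right, real_inner_smul_left, real_inner_smul_right, hee,
    hvv, hev, hve, real_inner_comm x e, real_inner_comm x (vertical n)]
  linarith

theorem rotationOrbit_catenoidProfile {P : Submodule ℝ (EAmb n)}
    (hP : P = Submodule.span ℝ {e, vertical n}) (he : ‖e‖ = 1) (hev : ⟪e, vertical n⟫ = 0)
    {b : EAmb n} (hb : ‖b‖ = 1) (hbe : ⟪b, e⟫ = 0) (hbv : ⟪b, vertical n⟫ = 0) {c : ℝ} (hc : 1 < c)
    (t : ℝ) : rotationOrbit n P (catenoidProfile c t e b) (Icc 0 (Real.pi / √c)) =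
      catenoid n c e t := by
  have hsc : 0 < √c := Real.sqrt_pos.2 (by linarith)
  rw [rotationOrbit_eq P hP (isProfileCurve_catenoidProfile hP he hev hb hbe hbv hc t).mem]
  have hcoord : ∀ s, ⟪catenoidProfile c t e b s, e⟫ = √((c - 1 + Real.cos (√c * s) ^ 2) / c) ∧
      ⟪catenoidProfile c t e b s, vertical n⟫ = catenaryHeight c t (Real.cos (√c * s)) := fun s =>
    ⟨(inner_frame_combination he hev hb hbe hbv _ _ _).1,
      (inner_frame_combination he hev hb hbe hbv _ _ _).2.2.1⟩
  ext x
  constructor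
  · rintro ⟨hx, s, -, h1, h2⟩
    refine ⟨hx, ?_⟩
    rw [h1, h2, (hcoord s).1, (hcoord s).2, catenary_catenaryHeight hc]
  · rintro ⟨hx, h1⟩
    have h2 := catenary_sq hc t ⟪x, vertical n⟫
    rw [← h1] at h2
    have h3 : 0 ≤ 1 - ⟪x, e⟫ ^ 2 := by
      rw [← inner_radial_self_of_mem_sphereLine he hev hx]; exact real_inner_self_nonneg
    set E := catenarySlope c t ⟪x, vertical n⟫ with hE
    have hE1 : E ^ 2 ≤ 1 := by nlinarith
    have hE2 := abs_le.1 ((sq_le_one_iff_abs_le_one E).1 hE1)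
    have hcos : Real.cos (√c * (Real.arccos E / √c)) = E := by
      rw [mul_div_cancel₀ _ hsc.ne', Real.cos_arccos hE2.1 hE2.2]
    refine ⟨hx, Real.arccos E / √c, ⟨div_nonneg (Real.arccos_nonneg _) hsc.le, by
      gcongr; exact Real.arccos_le_pi _⟩, ?_, ?_⟩
    · rw [(hcoord _).1, hcos, h1, catenary_eq_sqrt hc, hE]
    · rw [(hcoord _).2, hcos, hE, catenaryHeight_catenarySlope hc]

end Frame

section Completeness

variable {n : ℕ} {N : Type*} [TopologicalSpace N] [ChartedSpace (EuclideanSpace ℝ (Fin n)) N]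

/-- A path in `N` is at least as long as the chord between the images of its end points. -/
theorem edist_le_inducedEDist {F : N → EAmb n} (hF : ContMDiff (𝓡 n) 𝓘(ℝ, EAmb n) ∞ F) (p q : N) :
    edist (F p) (F q) ≤ inducedEDist n F p q := by
  refine le_iInf fun γ => le_iInf fun h0 => le_iInf fun h1 => le_iInf fun hγ => ?_
  have hFγ : ContDiffOn ℝ 1 (F ∘ γ) (Icc 0 1) :=
    contMDiffOn_iff_contDiffOn.1 ((hF.of_le (by exact_mod_cast le_top)).comp_contMDiffOn hγ)
  have h := enorm_sub_le_lintegral_deriv_of_contDiffOn_Icc hFγ zero_le_one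
  rwa [Function.comp_apply, Function.comp_apply, h0, h1, ← edist_eq_enorm_sub, edist_comm] at h

/-- A closed embedding into a Euclidean space is complete: chords are shorter than paths, so a
Cauchy sequence for the induced distance converges in the ambient space. -/
theorem isCompleteInduced_of_isClosedEmbedding {F : N → EAmb n}
    (hF : ContMDiff (𝓡 n) 𝓘(ℝ, EAmb n) ∞ F) (hcl : IsClosedEmbedding F) :
    IsCompleteInduced n F := by
  intro x hx
  have hc : CauchySeq fun i => F (x i) := by
    refine EMetric.cauchySeq_iff.2 fun ε hε => ?_
    obtain ⟨K, hK⟩ := hx ε hε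
    exact ⟨K, fun i hi j hj => (edist_le_inducedEDist hF _ _).trans_lt (hK i hi j hj)⟩
  obtain ⟨y, hy⟩ := cauchySeq_tendsto_of_complete hc
  obtain ⟨p, rfl⟩ : y ∈ range F :=
    hcl.isClosed_range.mem_of_tendsto hy (Eventually.of_forall fun i => mem_range_self _)
  exact ⟨p, hcl.isEmbedding.tendsto_nhds_iff.2 hy⟩

end Completeness

section Model

variable {n : ℕ}

theorem finrank_orthogonal_vertical (n : ℕ) :
    Module.finrank ℝ (Submodule.span ℝ {vertical n})ᗮ = n + 1 := by
  have : Fact (Module.finrank ℝ (EAmb n) = n + 1 + 1) := ⟨by simp [EAmb]⟩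
  refine Submodule.finrank_orthogonal_span_singleton fun h => ?_
  have := norm_vertical n
  simp [h] at this

/-- The embedding of the unit sphere of the hyperplane orthogonal to `∂/∂xₙ₊₂` whose image is the
catenoid: the parameter is `y = cos (√c s) e + sin (√c s) φ`, with `φ` orthogonal to the axis. -/
noncomputable def catenoidEmbedding (n : ℕ) (c : ℝ) (e : EAmb n) (t : ℝ) (y : EAmb n) : EAmb n :=
  √((c - 1 + ⟪y, e⟫ ^ 2) / c) • e + (√c)⁻¹ • (y - ⟪y, e⟫ • e) +
    catenaryHeight c t ⟪y, e⟫ • vertical n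

/-- A left inverse of `catenoidEmbedding`. -/
noncomputable def catenoidProjection (n : ℕ) (c : ℝ) (e : EAmb n) (t : ℝ) (x : EAmb n) : EAmb n :=
  catenarySlope c t ⟪x, vertical n⟫ • e +
    √c • (x - ⟪x, e⟫ • e - ⟪x, vertical n⟫ • vertical n)

theorem contDiff_catenoidEmbedding {c : ℝ} (hc : 1 < c) (e : EAmb n) (t : ℝ) :
    ContDiff ℝ ∞ (catenoidEmbedding n c e t) := by
  have hi : ContDiff ℝ ∞ fun y : EAmb n => ⟪y, e⟫ := contDiff_id.inner ℝ contDiff_const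
  have hA : ContDiff ℝ ∞ fun y : EAmb n => √((c - 1 + ⟪y, e⟫ ^ 2) / c) :=
    ((contDiff_const.add (hi.pow 2)).div_const c).sqrt fun y =>
      (div_pos (by nlinarith [sq_nonneg ⟪y, e⟫]) (by linarith)).ne'
  have hH : ContDiff ℝ ∞ fun y : EAmb n => catenaryHeight c t ⟪y, e⟫ :=
    (contDiff_catenaryHeight c t).comp hi
  unfold catenoidEmbedding
  fun_prop

theorem contDiff_catenoidProjection (c : ℝ) (e : EAmb n) (t : ℝ) :
    ContDiff ℝ ∞ (catenoidProjection n c e t) := by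
  have hi : ∀ z : EAmb n, ContDiff ℝ ∞ fun y : EAmb n => ⟪y, z⟫ := fun z =>
    contDiff_id.inner ℝ contDiff_const
  have hS : ContDiff ℝ ∞ fun x : EAmb n => catenarySlope c t ⟪x, vertical n⟫ :=
    (contDiff_catenarySlope c t).comp (hi _)
  unfold catenoidProjection
  fun_prop

theorem catenoidEmbedding_inner {c : ℝ} {e y : EAmb n} (he : ‖e‖ = 1)
    (hev : ⟪e, vertical n⟫ = 0) (hy : ⟪y, vertical n⟫ = 0) (t : ℝ) :
    ⟪catenoidEmbedding n c e t y, e⟫ = √((c - 1 + ⟪y, e⟫ ^ 2) / c) ∧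
    ⟪catenoidEmbedding n c e t y, vertical n⟫ = catenaryHeight c t ⟪y, e⟫ := by
  have hee : ⟪e, e⟫ = 1 := by rw [real_inner_self_eq_norm_sq, he]; norm_num
  have hvv := inner_vertical_self n
  have hve : ⟪vertical n, e⟫ = 0 := by rw [real_inner_comm]; exact hev
  simp only [catenoidEmbedding, inner_add_left, inner_sub_left, real_inner_smul_left, hee, hvv,
    hev, hve, hy]
  constructor <;> ring

theorem catenoidProjection_catenoidEmbedding {c : ℝ} (hc : 1 < c) {e y : EAmb n} (he : ‖e‖ = 1)
    (hev : ⟪e, vertical n⟫ = 0) (hy : ⟪y, vertical n⟫ = 0) (t : ℝ) :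
    catenoidProjection n c e t (catenoidEmbedding n c e t y) = y := by
  have hsc : √c ≠ 0 := (Real.sqrt_pos.2 (by linarith)).ne'
  obtain ⟨h1, h2⟩ := catenoidEmbedding_inner (c := c) he hev hy t
  rw [catenoidProjection, h1, h2, catenarySlope_catenaryHeight hc, catenoidEmbedding,
    add_sub_right_comm, add_sub_cancel_right, add_sub_cancel_left, smul_smul,
    mul_inv_cancel₀ hsc, one_smul, add_sub_cancel]

theorem catenoidEmbedding_mem {c : ℝ} (hc : 1 < c) {e y : EAmb n} (he : ‖e‖ = 1)
    (hev : ⟪e, vertical n⟫ = 0) (hy : ⟪y, vertical n⟫ = 0) (hy1 : ‖y‖ = 1) (t : ℝ) :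
    catenoidEmbedding n c e t y ∈ catenoid n c e t := by
  have hc0 : 0 < c := by linarith
  have hsc2 : √c ^ 2 = c := Real.sq_sqrt hc0.le
  have hee : ⟪e, e⟫ = 1 := by rw [real_inner_self_eq_norm_sq, he]; norm_num
  have hyy : ⟪y, y⟫ = 1 := by rw [real_inner_self_eq_norm_sq, hy1]; norm_num
  have hvv := inner_vertical_self n
  have hve : ⟪vertical n, e⟫ = 0 := by rw [real_inner_comm]; exact hev
  have hvy : ⟪vertical n, y⟫ = 0 := by rw [real_inner_comm]; exact hy
  obtain ⟨h1, h2⟩ := catenoidEmbedding_inner (c := c) he hev hy t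
  refine ⟨?_, by rw [h1, h2, catenary_catenaryHeight hc]⟩
  rw [mem_sphereLine_iff, h2]
  have hA : √((c - 1 + ⟪y, e⟫ ^ 2) / c) ^ 2 = (c - 1 + ⟪y, e⟫ ^ 2) / c :=
    Real.sq_sqrt (div_pos (by nlinarith [sq_nonneg ⟪y, e⟫]) hc0).le
  have hB : (√c)⁻¹ ^ 2 = c⁻¹ := by rw [inv_pow, hsc2]
  have h3 : ⟪catenoidEmbedding n c e t y, catenoidEmbedding n c e t y⟫ =
      √((c - 1 + ⟪y, e⟫ ^ 2) / c) ^ 2 + (√c)⁻¹ ^ 2 * (1 - ⟪y, e⟫ ^ 2) +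
        catenaryHeight c t ⟪y, e⟫ ^ 2 := by
    simp only [catenoidEmbedding, inner_add_left, inner_sub_left, real_inner_smul_left,
      inner_add_right, inner_sub_right, real_inner_smul_right, hee, hvv,
      hev, hve, hy, hvy, hyy, real_inner_comm y e]
    ring
  rw [h3, hA, hB]
  field_simp
  ring

/-- The left inverse maps the catenoid into the unit sphere of the hyperplane orthogonal to
`∂/∂xₙ₊₂`, hence the embedding is onto the catenoid. -/
theorem catenoidEmbedding_catenoidProjection {c : ℝ} (hc : 1 < c) {e x : EAmb n} (he : ‖e‖ = 1)
    (hev : ⟪e, vertical n⟫ = 0) {t : ℝ} (hx : x ∈ catenoid n c e t) :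
    ⟪catenoidProjection n c e t x, vertical n⟫ = 0 ∧ ‖catenoidProjection n c e t x‖ = 1 ∧
    catenoidEmbedding n c e t (catenoidProjection n c e t x) = x := by
  have hc0 : 0 < c := by linarith
  have hsc2 : √c ^ 2 = c := Real.sq_sqrt hc0.le
  have hsc : √c ≠ 0 := (Real.sqrt_pos.2 hc0).ne'
  have hee : ⟪e, e⟫ = 1 := by rw [real_inner_self_eq_norm_sq, he]; norm_num
  have hvv := inner_vertical_self n
  have hve : ⟪vertical n, e⟫ = 0 := by rw [real_inner_comm]; exact hev
  obtain ⟨hx1, hx2⟩ := hx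
  have hw := inner_radial_self_of_mem_sphereLine he hev hx1
  have hsq := catenary_sq hc t ⟪x, vertical n⟫
  rw [← hx2] at hsq
  set E := catenarySlope c t ⟪x, vertical n⟫ with hE
  set w := x - ⟪x, e⟫ • e - ⟪x, vertical n⟫ • vertical n with hwdef
  have hwe : ⟪w, e⟫ = 0 := by
    simp only [hwdef, inner_sub_left, real_inner_smul_left, hee, hve]; ring
  have hwv : ⟪w, vertical n⟫ = 0 := by
    simp only [hwdef, inner_sub_left, real_inner_smul_left, hvv, hev]; ring
  have hew : ⟪e, w⟫ = 0 := by rw [real_inner_comm]; exact hwe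
  have hp : catenoidProjection n c e t x = E • e + √c • w := rfl
  have hpe : ⟪catenoidProjection n c e t x, e⟫ = E := by
    simp only [hp, inner_add_left, real_inner_smul_left, hee, hwe]; ring
  refine ⟨?_, ?_, ?_⟩
  · simp only [hp, inner_add_left, real_inner_smul_left, hev, hwv]; ring
  · have h1 : ⟪catenoidProjection n c e t x, catenoidProjection n c e t x⟫ = 1 := by
      simp only [hp, inner_add_left, real_inner_smul_left, inner_add_right, real_inner_smul_right,
        hee, hwe, hew, hw]
      linear_combination (1 - ⟪x, e⟫ ^ 2) * hsc2 - hsq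
    rw [real_inner_self_eq_norm_sq] at h1
    exact (pow_eq_one_iff_of_nonneg (norm_nonneg _) two_ne_zero).1 h1
  · rw [catenoidEmbedding, hpe, hE, ← catenary_eq_sqrt hc, ← hx2, catenaryHeight_catenarySlope hc,
      ← hE, hp, add_sub_cancel_left, smul_smul, inv_mul_cancel₀ hsc, one_smul, hwdef]
    abel

theorem isCompleteRotationHypersurface_catenoid (hn : 3 ≤ n) {P : Submodule ℝ (EAmb n)}
    (hP : IsAxis n P) {e : EAmb n} (heP : P = Submodule.span ℝ {e, vertical n}) (he : ‖e‖ = 1)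
    (hev : ⟪e, vertical n⟫ = 0) {c : ℝ} (hc : 1 < c) (t : ℝ) :
    IsCompleteRotationHypersurface n P (catenoid n c e t) := by
  have : Fact (Module.finrank ℝ (Submodule.span ℝ {vertical n})ᗮ = n + 1) :=
    ⟨finrank_orthogonal_vertical n⟩
  let V := (Submodule.span ℝ {vertical n})ᗮ
  let N := Metric.sphere (0 : V) 1
  have hVv : ∀ y : V, ⟪(y : EAmb n), vertical n⟫ = 0 := fun y =>
    Submodule.mem_orthogonal_singleton_iff_inner_left.1 y.2
  let ι : N → EAmb n := fun y => ((y : V) : EAmb n)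
  let F : N → EAmb n := fun y => catenoidEmbedding n c e t (ι y)
  have hι : ContMDiff (𝓡 n) 𝓘(ℝ, EAmb n) ∞ ι :=
    V.subtypeL.contMDiff.comp contMDiff_coe_sphere
  have hιinj : ∀ y, Function.Injective (mfderiv (𝓡 n) 𝓘(ℝ, EAmb n) ι y) := by
    intro y
    have h1 : Function.Injective
        (mfderiv (𝓡 n) 𝓘(ℝ, V) ((↑) : N → V) y) := injective_mvfderiv_subtypeVal_sphere y
    have h2 : mfderiv (𝓡 n) 𝓘(ℝ, EAmb n) ι y =
        (mfderiv 𝓘(ℝ, V) 𝓘(ℝ, EAmb n) V.subtypeL (y : V)).comp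
          (mfderiv (𝓡 n) 𝓘(ℝ, V) ((↑) : N → V) y) :=
      mfderiv_comp y (V.subtypeL.mdifferentiableAt)
        ((contMDiff_coe_sphere (m := 1) y).mdifferentiableAt one_ne_zero)
    rw [h2, ContinuousLinearMap.mfderiv_eq]
    exact Subtype.val_injective.comp h1
  have hF : ContMDiff (𝓡 n) 𝓘(ℝ, EAmb n) ∞ F :=
    (contDiff_catenoidEmbedding hc e t).contMDiff.comp hι
  have hRF : catenoidProjection n c e t ∘ F = ι := by
    funext y
    exact catenoidProjection_catenoidEmbedding hc he hev (hVv y) t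
  have hFinj : ∀ y, Function.Injective (mfderiv (𝓡 n) 𝓘(ℝ, EAmb n) F y) := by
    intro y
    have h1 := hιinj y
    rw [← hRF, mfderiv_comp y
      ((contDiff_catenoidProjection c e t).contMDiff.mdifferentiable (by simp) _)
      (hF.mdifferentiable (by simp) y)] at h1
    exact Function.Injective.of_comp h1
  have hmem : ∀ y, F y ∈ catenoid n c e t := fun y =>
    catenoidEmbedding_mem hc he hev (hVv y) (norm_eq_of_mem_sphere y) t
  have hrange : range F = catenoid n c e t := by
    refine Subset.antisymm (range_subset_iff.2 hmem) fun x hx => ?_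
    obtain ⟨h1, h2, h3⟩ := catenoidEmbedding_catenoidProjection hc he hev hx
    exact ⟨⟨⟨catenoidProjection n c e t x,
      Submodule.mem_orthogonal_singleton_iff_inner_left.2 h1⟩, mem_sphere_zero_iff_norm.2 h2⟩, h3⟩
  have hinj : Function.Injective F := by
    refine Function.Injective.of_comp (f := catenoidProjection n c e t) ?_
    rw [hRF]
    exact Subtype.val_injective.comp Subtype.val_injective
  obtain ⟨b, hb, hbe, hbv⟩ : ∃ b : EAmb n, ‖b‖ = 1 ∧ ⟪b, e⟫ = 0 ∧ ⟪b, vertical n⟫ = 0 := by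
    have h1 : 0 < Module.finrank ℝ Pᗮ := by
      have h2 := P.finrank_add_finrank_orthogonal
      rw [hP.finrank_eq, finrank_euclideanSpace_fin] at h2
      omega
    have := Module.finrank_pos_iff.1 h1
    obtain ⟨b, hb⟩ := exists_norm_eq (Pᗮ) (zero_le_one (α := ℝ))
    exact ⟨b, hb, Submodule.inner_left_of_mem_orthogonal
      (heP ▸ Submodule.subset_span (by simp) : e ∈ P) b.2,
      Submodule.inner_left_of_mem_orthogonal hP.vertical_mem b.2⟩
  have : ConnectedSpace N := by
    refine isConnected_iff_connectedSpace.1 (isConnected_sphere ?_ _ zero_le_one)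
    rw [← Module.finrank_eq_rank, finrank_orthogonal_vertical]
    exact_mod_cast (by omega : 1 < n + 1)
  refine ⟨N, inferInstance, inferInstance, inferInstance, inferInstance, inferInstance,
    inferInstance, F, ⟨⟨hF, hFinj, fun y => (hmem y).1⟩, hP, catenoidProfile c t e b, _,
      isProfileCurve_catenoidProfile heP he hev hb hbe hbv hc t, ?_⟩,
    isCompleteInduced_of_isClosedEmbedding hF (hF.continuous.isClosedEmbedding hinj), hrange⟩
  rw [hrange, rotationOrbit_catenoidProfile heP he hev hb hbe hbv hc t]

end Model

/-! ### The explicit hypersurface is a catenoid -/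

/-- The height of the waist of the catenoid described by `profileK` and `profileH`. -/
noncomputable def explicitHeight (c : ℝ) : ℝ :=
  √((c - 1) / c) * Real.arsinh (1 / √(c - 1))

theorem arsinh_div_eq_log {q : ℝ} (hq : 0 < q) (x : ℝ) :
    Real.arsinh (x / q) = Real.log (x + √(q ^ 2 + x ^ 2)) - Real.log q := by
  have hlt : |x| < √(q ^ 2 + x ^ 2) := by
    rw [← Real.sqrt_sq_eq_abs]
    exact Real.sqrt_lt_sqrt (sq_nonneg x) (by nlinarith)
  have hpos : 0 < x + √(q ^ 2 + x ^ 2) := by linarith [neg_abs_le x]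
  have h : √(1 + (x / q) ^ 2) = √(q ^ 2 + x ^ 2) / q := by
    rw [← Real.sqrt_sq hq.le, ← Real.sqrt_div' _ (sq_nonneg q), Real.sqrt_sq hq.le]
    congr 1
    field_simp
  rw [Real.arsinh, h, ← add_div, Real.log_div hpos.ne' hq.ne']

theorem profileH_eq {c : ℝ} (hc : 1 < c) (s : ℝ) :
    profileH c s = catenaryHeight c (explicitHeight c) (Real.cos (√c * s)) := by
  have hq : 0 < √(c - 1) := Real.sqrt_pos.2 (by linarith)
  have hq2 : √(c - 1) ^ 2 = c - 1 := Real.sq_sqrt (by linarith)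
  have hlt : |Real.cos (√c * s)| < √(c - Real.sin (√c * s) ^ 2) := by
    rw [← Real.sqrt_sq_eq_abs, Real.cos_sq']
    exact Real.sqrt_lt_sqrt (by nlinarith [Real.sin_sq_le_one (√c * s)]) (by linarith)
  have hpos : 0 < Real.cos (√c * s) + √(c - Real.sin (√c * s) ^ 2) := by
    linarith [neg_abs_le (Real.cos (√c * s))]
  rw [profileH, catenaryHeight, explicitHeight, arsinh_div_eq_log hq, arsinh_div_eq_log hq, hq2,
    Real.log_div hpos.ne' (by positivity), Real.cos_sq']
  ring_nf

theorem sin_profileK {c : ℝ} (hc : 0 < c) (s : ℝ) :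
    Real.sin (profileK c s) = √((c - 1 + Real.cos (√c * s) ^ 2) / c) := by
  rw [profileK, Real.sin_arccos, mul_pow, div_pow, Real.sq_sqrt hc.le, Real.sin_sq]
  congr 1
  field_simp
  ring

theorem cos_profileK {c : ℝ} (hc : 1 < c) (s : ℝ) :
    Real.cos (profileK c s) = Real.sin (√c * s) / √c := by
  have hsc : 1 ≤ √c := Real.one_le_sqrt.2 hc.le
  have h : |1 / √c * Real.sin (√c * s)| ≤ 1 := by
    rw [abs_mul, abs_of_nonneg (by positivity)]
    exact mul_le_one₀ ((div_le_one (by linarith)).2 hsc) (abs_nonneg _) (Real.abs_sin_le_one _)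
  rw [profileK, Real.cos_arccos (abs_le.1 h).1 (abs_le.1 h).2]
  ring

section Coordinates

variable {n : ℕ}

theorem inner_single_zero (x : EAmb n) : ⟪x, EuclideanSpace.single 0 (1 : ℝ)⟫ = x 0 := by
  simp [EuclideanSpace.inner_single_right]

theorem mem_sphereLine_iff_coordinates {x : EAmb n} :
    x ∈ sphereLine n ↔ x 0 ^ 2 + ∑ i : Fin n, x i.castSucc.succ ^ 2 = 1 := by
  rw [sphereLine, mem_ofPred_eq, Fin.sum_univ_succ]
  simp

theorem rotationParam_coordinates (k h : ℝ → ℝ) (s : ℝ) (φ : EuclideanSpace ℝ (Fin n)) :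
    rotationParam n k h s φ 0 = Real.sin (k s) ∧
    (∀ i : Fin n, rotationParam n k h s φ i.castSucc.succ = Real.cos (k s) * φ i) ∧
    rotationParam n k h s φ (Fin.last (n + 1)) = h s := by
  refine ⟨rfl, fun i => ?_, ?_⟩
  · simp [rotationParam]
  · rw [← Fin.succ_last]
    simp [rotationParam]

theorem exists_unit_smul_norm {V : Type*} [NormedAddCommGroup V] [NormedSpace ℝ V] [Nontrivial V]
    (w : V) : ∃ φ : V, ‖φ‖ = 1 ∧ w = ‖w‖ • φ := by
  by_cases hw : w = 0
  · obtain ⟨φ, hφ⟩ := exists_norm_eq V (zero_le_one (α := ℝ))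
    exact ⟨φ, hφ, by simp [hw]⟩
  · have h := norm_ne_zero_iff.2 hw
    exact ⟨‖w‖⁻¹ • w, by rw [norm_smul, norm_inv, norm_norm, inv_mul_cancel₀ h],
      by rw [smul_smul, mul_inv_cancel₀ h, one_smul]⟩

theorem explicitHypersurface_eq_catenoid (hn : 0 < n) {c : ℝ} (hc : 1 < c) :
    explicitHypersurface n c =
      catenoid n c (EuclideanSpace.single 0 1) (explicitHeight c) := by
  have hc0 : 0 < c := by linarith
  have hsc : 0 < √c := Real.sqrt_pos.2 hc0
  have : Nonempty (Fin n) := ⟨⟨0, hn⟩⟩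
  ext x
  constructor
  · rintro ⟨s, -, φ, hφ, rfl⟩
    obtain ⟨h0, h1, h2⟩ := rotationParam_coordinates (profileK c) (profileH c) s φ
    refine ⟨?_, ?_⟩
    · rw [mem_sphereLine_iff_coordinates, h0]
      simp only [h1, mul_pow]
      rw [← Finset.mul_sum, ← EuclideanSpace.real_norm_sq_eq, hφ, one_pow, mul_one]
      exact Real.sin_sq_add_cos_sq _
    · rw [inner_single_zero, inner_vertical, h0, h2, profileH_eq hc, sin_profileK hc0,
        catenary_catenaryHeight hc]
  · rintro ⟨hx, hx0⟩
    have hsq := catenary_sq hc (explicitHeight c) ⟪x, vertical n⟫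
    have heq := catenary_eq_sqrt hc (explicitHeight c) ⟪x, vertical n⟫
    rw [← hx0] at hsq heq
    rw [inner_single_zero] at hsq heq
    rw [mem_sphereLine_iff_coordinates] at hx
    set E := catenarySlope c (explicitHeight c) ⟪x, vertical n⟫ with hE
    let w : EuclideanSpace ℝ (Fin n) := WithLp.toLp 2 fun i => x i.castSucc.succ
    have hw : ‖w‖ ^ 2 = 1 - x 0 ^ 2 := by
      rw [EuclideanSpace.real_norm_sq_eq]
      change ∑ i : Fin n, x i.castSucc.succ ^ 2 = _
      linarith
    have hE1 : E ^ 2 ≤ 1 := by nlinarith [sq_nonneg ‖w‖]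
    have hE2 := abs_le.1 ((sq_le_one_iff_abs_le_one E).1 hE1)
    have harg : √c * (Real.arccos E / √c) = Real.arccos E := mul_div_cancel₀ _ hsc.ne'
    have hρ : Real.cos (profileK c (Real.arccos E / √c)) = ‖w‖ := by
      rw [cos_profileK hc, harg, Real.sin_arccos, ← Real.sqrt_div' _ hc0.le,
        ← Real.sqrt_sq (norm_nonneg w), hw]
      congr 1
      field_simp
      linarith
    obtain ⟨φ, hφ, hwφ⟩ := exists_unit_smul_norm w
    obtain ⟨h0, h1, h2⟩ := rotationParam_coordinates (profileK c) (profileH c)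
      (Real.arccos E / √c) φ
    refine ⟨Real.arccos E / √c, ⟨div_nonneg (Real.arccos_nonneg _) hsc.le, by
      gcongr; exact Real.arccos_le_pi _⟩, φ, hφ, ?_⟩
    ext i
    induction i using Fin.cases with
    | zero => rw [h0, sin_profileK hc0, harg, Real.cos_arccos hE2.1 hE2.2, heq]
    | succ i =>
      induction i using Fin.lastCases with
      | last =>
        rw [Fin.succ_last, h2, profileH_eq hc, harg, Real.cos_arccos hE2.1 hE2.2, hE,
          catenaryHeight_catenarySlope hc, inner_vertical]
      | cast i =>
        rw [h1, hρ]
        exact congrArg (fun z : EuclideanSpace ℝ (Fin n) => z i) hwφ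

/-- Catenoids about different axes are exchanged by a motion of `𝕊ⁿ × ℝ`: a reflection that fixes
`∂/∂xₙ₊₂`, followed by a vertical translation. -/
theorem exists_isometry_image_catenoid {e e' : EAmb n} (he : ‖e‖ = 1) (he' : ‖e'‖ = 1)
    (hev : ⟪e, vertical n⟫ = 0) (hev' : ⟪e', vertical n⟫ = 0) (c t t' : ℝ) :
    ∃ Φ : EAmb n ≃ᵢ EAmb n, Φ '' sphereLine n = sphereLine n ∧
      Φ '' catenoid n c e t = catenoid n c e' t' := by
  let L : EAmb n ≃ₗᵢ[ℝ] EAmb n := (Submodule.span ℝ {e - e'})ᗮ.reflection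
  have hLe : L e = e' := Submodule.reflection_sub (by rw [he, he'])
  have hLv : L (vertical n) = vertical n := by
    refine Submodule.reflection_mem_subspace_eq_self ?_
    refine Submodule.mem_orthogonal_singleton_iff_inner_right.2 ?_
    rw [inner_sub_left, hev, hev', sub_zero]
  let Φ : EAmb n ≃ᵢ EAmb n :=
    L.toIsometryEquiv.trans (IsometryEquiv.addRight ((t' - t) • vertical n))
  have hΦ : ∀ x, Φ x = L x + (t' - t) • vertical n := fun x => rfl
  have hvv := inner_vertical_self n
  have hve' : ⟪vertical n, e'⟫ = 0 := by rw [real_inner_comm]; exact hev'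
  have hLxv : ∀ x, ⟪L x, vertical n⟫ = ⟪x, vertical n⟫ := fun x => by
    nth_rewrite 1 [← hLv]
    exact L.inner_map_map _ _
  have hv : ∀ x, ⟪Φ x, vertical n⟫ = ⟪x, vertical n⟫ + (t' - t) := fun x => by
    rw [hΦ, inner_add_left, hLxv, real_inner_smul_left, hvv, mul_one]
  have he1 : ∀ x, ⟪Φ x, e'⟫ = ⟪x, e⟫ := fun x => by
    rw [hΦ, inner_add_left, real_inner_smul_left, hve', mul_zero, add_zero, ← hLe]
    exact L.inner_map_map _ _
  have hmem : ∀ x, Φ x ∈ sphereLine n ↔ x ∈ sphereLine n := fun x => by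
    rw [mem_sphereLine_iff, mem_sphereLine_iff, hv, hΦ]
    simp only [inner_add_left, inner_add_right, real_inner_smul_left, real_inner_smul_right, hvv,
      hLxv, real_inner_comm (L x) (vertical n), L.inner_map_map]
    constructor <;> intro h <;> linarith
  have himage : ∀ A B : Set (EAmb n), (∀ x, Φ x ∈ B ↔ x ∈ A) → Φ '' A = B := by
    intro A B h
    ext y
    obtain ⟨x, rfl⟩ := Φ.surjective y
    rw [Φ.injective.mem_set_image, h]
  refine ⟨Φ, himage _ _ hmem, himage _ _ fun x => and_congr (hmem x) ?_⟩
  rw [he1, hv, catenary, catenary]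
  ring_nf

end Coordinates

theorem theorem4p1 (n : ℕ) (hn : 3 ≤ n) {M : Type*} [TopologicalSpace M] [T2Space M]
    [SecondCountableTopology M] [ConnectedSpace M] [ChartedSpace (EuclideanSpace ℝ (Fin n)) M]
    [IsManifold (𝓡 n) ∞ M] (P : Submodule ℝ (EAmb n)) (f : M → EAmb n)
    (hf : IsRotationHypersurface n P f) (c : ℝ) (hc : HasConstantSectionalCurvature n f c) :
    1 ≤ c ∧
    (c = 1 → ∃ t : ℝ, IsOpenSubsetOf (range f) (sphereSlice n t)) ∧
    (1 < c → ∃ Φ : EAmb n ≃ᵢ EAmb n, Φ '' sphereLine n = sphereLine n ∧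
      IsCompleteRotationHypersurface n P (Φ '' explicitHypersurface n c) ∧
      IsOpenSubsetOf (range f) (Φ '' explicitHypersurface n c)) := by
  obtain ⟨e₀, he₀, hev₀, heP₀⟩ := hf.isAxis.exists_frame
  have he₀P : e₀ ∈ P := heP₀ ▸ Submodule.subset_span (by simp)
  refine ⟨hf.one_le_curvature hn he₀ hev₀ he₀P hc, fun h1 => ?_, fun h1 => ?_⟩
  · subst h1
    obtain ⟨t, ht⟩ := hf.exists_height hn he₀ hev₀ he₀P hc
    exact ⟨t, hf.isHypersurface.isOpenSubsetOf_slice ht⟩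
  · -- the unit vector of the axis is oriented so that `f` is on its side
    obtain ⟨e, he, hev, heP, hpos⟩ : ∃ e : EAmb n, ‖e‖ = 1 ∧ ⟪e, vertical n⟫ = 0 ∧
        P = Submodule.span ℝ {e, vertical n} ∧ ∀ p, 0 < ⟪f p, e⟫ := by
      obtain h | h := hf.inner_axis_pos_or_neg hn he₀ hev₀ he₀P hc h1
      · exact ⟨e₀, he₀, hev₀, heP₀, h⟩
      · refine ⟨-e₀, by rwa [norm_neg], by rw [inner_neg_left, hev₀, neg_zero], ?_, h⟩
        rw [heP₀, Submodule.span_insert, Submodule.span_insert, ← Set.neg_singleton,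
          Submodule.span_neg]
    obtain ⟨t, ht⟩ :=
      hf.exists_catenary hn he hev (heP ▸ Submodule.subset_span (by simp)) hc h1 hpos
    obtain ⟨Φ, hΦ, hΦc⟩ := exists_isometry_image_catenoid
      (e := EuclideanSpace.single 0 1) (by simp) he (by rw [inner_vertical]; simp) hev c
      (explicitHeight c) t
    rw [← explicitHypersurface_eq_catenoid (by omega : 0 < n) h1] at hΦc
    refine ⟨Φ, hΦ, ?_, ?_⟩ <;> rw [hΦc]
    · exact isCompleteRotationHypersurface_catenoid hn hf.isAxis heP he hev h1 t
    · exact hf.isHypersurface.isOpenSubsetOf_catenoid h1 he hev ht
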